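/- **Setting.** Let $G$ be a finite group, and write $\bar g=g^{-1}$. A *spin chain* assigns to each site $j\in\mathbb Z$ a Hilbert space $\mathbb C^{d_j}$ with $1\le d_j\le d_{\max}$ for some $d_{\max}$; $\mathcal A$ is the $C^*$-inductive limit of the algebras $\mathcal A_S=\bigotimes_{j\in S}\mathrm{End}(\mathbb C^{d_j})$, $S\subset\mathbb Z$ finite, and for $X\subseteq\mathbb Z$, $\mathcal A_X\subseteq\mathcal A$ is the norm closure of $\bigcup_{S\subseteq X\text{ finite}}\mathcal A_S$. Put $\mathcal A_{\ge j}=\mathcal A_{[j,\infty)}$, $\mathcal A_{<j}=\mathcal A_{(-\infty,j-1]}$. A unitary is *local* if it lies in $\mathcal A_S$ for some finite $S$, and $\mathrm{Ad}[U](x)=UxU^*$. A *quantum cellular automaton* (QCA) is a $*$-automorphism $\alpha$ of $\mathcal A$ for which there is $r\ge 0$ with $\alpha(\mathcal A_X)\subseteq\mathcal A_{X^{(r)}}$ for all $X\subseteq\mathbb Z$, where $X^{(r)}=\{j:\mathrm{dist}(j,X)\le r\}$; it is then said to have range at most $r$. A *block-partitioned* QCA is one of the form $\bigotimes_{a\in\mathbb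 Z}\mathrm{Ad}[U_a]$ with unitaries $U_a\in\mathcal A_{I_a}$, where $\{I_a\}_{a\in\mathbb Z}$ is a partition of $\mathbb Z$ into intervals (blocks) of bounded size. A *finite depth quantum circuit* (FDQC) is a composition of finitely many block-partitioned QCAs. A *symmetry* on $\mathcal A$ is a homomorphism $g\mapsto\alpha^{(g)}$ from $G$ to the group of QCAs of $\mathcal A$; it has range at most $R$ if every $\alpha^{(g)}$ has. It is *decoupled* if all $\alpha^{(g)}$ are block-partitioned with common blocks. $\mathrm{Sym}_G$ denotes the symmetries on arbitrary spin chains. The *stack* of $\alpha$ on $\mathcal A$ and $\beta$ on $\mathcal B$ is $\alpha\otimes\beta$, with components $\alpha^{(g)}\otimes\beta^{(g)}$, on the spin chain $\mathcal A\otimes\mathcal B$ with on-site algebras $\mathcal A_j\otimes\mathcal B_j$. Two symmetries $\alpha',\alpha$ are *equivalent*, $\alpha'\sim_0\alpha$, if, after identifying their spin chains by a $*$-isomorphism that maps on-site algebras onto on-site algebras, $\alpha'^{(g)}=\gamma^{-1}\alpha^{(g)}\gamma$ for all $g\in G$ for some FDQC $\gamma$. They are *stably equivalent*, $\alpha\sim\alpha'$,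 if $\alpha\otimes\beta\sim_0\alpha'\otimes\beta'$ for some symmetries $\beta,\beta'$ of range $0$. A *right restriction* of a symmetry $\alpha$ at a site $j$ with defect size $L\in\mathbb N$ is a family of $*$-automorphisms $\alpha_\ge^{(g)}$ of $\mathcal A$, $g\in G$, with $\alpha_\ge^{(g)}=\alpha^{(g)}$ on $\mathcal A_{\ge j+L}$ and $\alpha_\ge^{(g)}=\mathrm{id}$ on $\mathcal A_{<j-L}$. *Crossing operators* for it are local unitaries $C_g(k)$ with $$\alpha^{(k)}\circ\alpha_\ge^{(\bar kgk)}\circ\alpha^{(\bar k)}\circ(\alpha_\ge^{(g)})^{-1}=\mathrm{Ad}[C_g(k)]\qquad(g,k\in G),$$ and their *phases* are numbers $\lambda_g(k,l)\in U(1)$ with $$\alpha^{(k)}\big(C_{\bar kgk}(l)\big)\,C_g(k)=\lambda_g(k,l)\,C_g(kl)\qquad(g,k,l\in G).$$ Let $U(1)[G]$ be the $G$-module of maps $G\to U(1)$ under pointwise multiplication, with $(k\cdot f)_g=f_{\bar kgk}$. Regard $\lambda$ as the map $G^2\to U(1)[G]$, $(k,l)\mapsto(\lambda_g(k,l))_{g}$.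 **Proposition.** There is a map $\Lambda:\mathrm{Sym}_G\to H^2(G,U(1)[G])$ such that the following hold. For every symmetry $\alpha$ and every site $j$, right restrictions of $\alpha$ at $j$ exist, for some defect size. For every right restriction of $\alpha$ at any site and with any defect size, crossing operators exist, and every choice of crossing operators has uniquely determined phases $\lambda_g(k,l)$. These satisfy the twisted 2-cocycle equation $$1=\frac{\lambda_g(k,lm)\,\lambda_{\bar kgk}(l,m)}{\lambda_g(k,l)\,\lambda_g(kl,m)}\qquad(g,k,l,m\in G),$$ and $[\lambda]=\Lambda(\alpha)$. So the class $[\lambda]$ depends only on $\alpha$, and not on the site, the right restriction or the crossing operators. Moreover: 1. If $\alpha$ is decoupled, then $\Lambda(\alpha)$ is the identity element of $H^2(G,U(1)[G])$. 2. If $\alpha,\beta$ are symmetries of range at most $R$ on the same spin chain $\mathcal A$, and there is an interval $I\subset\mathbb Z$ of $12R+1$ consecutive sites with $\alpha^{(g)}|_{\mathcal A_I}=\beta^{(g)}|_{\mathcal A_I}$ for all $g\in G$, then $\Lambda(\alpha)=\Lambda(\beta)$. 3. $\Lambda(\alpha\otimes\beta)=\Lambda(\alpha)\cdot\Lambda(\beta)$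 for all symmetries $\alpha,\beta$. 4. If $\alpha\sim\beta$, then $\Lambda(\alpha)=\Lambda(\beta)$. In particular, stable equivalence is an equivalence relation on $\mathrm{Sym}_G$, stacking induces the structure of a commutative monoid on $\mathrm{Sym}_G/\!\sim$, and $\Lambda$ induces a homomorphism of monoids $\mathrm{Sym}_G/\!\sim\;\to H^2(G,U(1)[G])$. -/

import Mathlib

noncomputable section
/-- The Hilbert space `ℓ²(X)`. -/
abbrev L2 (X : Type) : Type := lp (fun _ : X => ℂ) 2

namespace L2
variable {X Y Z : Type}

theorem summable_sq (ψ : L2 X) : Summable fun x => ‖ψ x‖ ^ 2 := by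
  have h := lp.memℓp ψ
  rw [memℓp_gen_iff (by norm_num)] at h
  simpa using h

theorem mem_of_summable {f : X → ℂ} (h : Summable fun x => ‖f x‖ ^ 2) :
    Memℓp f 2 := by
  rw [memℓp_gen_iff (by norm_num)]
  simpa using h

theorem norm_sq (ψ : L2 X) : ‖ψ‖ ^ 2 = ∑' x, ‖ψ x‖ ^ 2 := by
  have := lp.norm_rpow_eq_tsum (p := 2) (by norm_num) ψ
  simpa using this

/-- The slice `x ↦ ψ (x, y)` of a vector of `ℓ²(X × Y)`. -/
def slice (e : Z ≃ X × Y) (ψ : L2 Z) (y : Y) : L2 X :=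
  ⟨fun x => ψ (e.symm (x, y)), mem_of_summable <|
    (summable_sq ψ).comp_injective (i := fun x => e.symm (x, y))
      fun a b h => by simpa using h⟩

@[simp] theorem slice_apply (e : Z ≃ X × Y) (ψ : L2 Z) (y : Y) (x : X) :
    slice e ψ y x = ψ (e.symm (x, y)) := rfl

theorem summable_slice (e : Z ≃ X × Y) (ψ : L2 Z) :
    Summable fun y => ‖slice e ψ y‖ ^ 2 := by
  have h : Summable fun p : Y × X => ‖ψ (e.symm (p.2, p.1))‖ ^ 2 :=
    (summable_sq ψ).comp_injective
      (i := fun p : Y × X => e.symm (p.2, p.1))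
      fun a b h => by
        have := e.symm.injective h
        ext <;> simp_all
  simpa [norm_sq] using h.prod

theorem norm_sq_slice (e : Z ≃ X × Y) (ψ : L2 Z) :
    ‖ψ‖ ^ 2 = ∑' y, ‖slice e ψ y‖ ^ 2 := by
  have h : Summable fun p : Y × X => ‖ψ (e.symm (p.2, p.1))‖ ^ 2 :=
    (summable_sq ψ).comp_injective
      (i := fun p : Y × X => e.symm (p.2, p.1))
      fun a b h => by
        have := e.symm.injective h
        ext <;> simp_all
  simp only [norm_sq, slice_apply]
  rw [← h.tsum_prod, ← ((Equiv.prodComm Y X).trans e.symm).tsum_eq]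
  rfl

theorem ampFun_summable (e : Z ≃ X × Y) (T : L2 X →L[ℂ] L2 X) (ψ : L2 Z) :
    Summable fun z : Z => ‖T (slice e ψ (e z).2) (e z).1‖ ^ 2 := by
  have h : Summable fun p : Y × X => ‖T (slice e ψ p.1) p.2‖ ^ 2 := by
    rw [summable_prod_of_nonneg (fun p => sq_nonneg ‖T (slice e ψ p.1) p.2‖)]
    refine ⟨fun y => summable_sq (T (slice e ψ y)), ?_⟩
    have hn : ∀ y, ∑' x, ‖T (slice e ψ y) x‖ ^ 2 = ‖T (slice e ψ y)‖ ^ 2 :=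
      fun y => (norm_sq _).symm
    simp only [hn]
    refine Summable.of_nonneg_of_le (fun y => sq_nonneg ‖T (slice e ψ y)‖) (fun y => ?_)
      ((summable_slice e ψ).mul_left (‖T‖ ^ 2))
    rw [← mul_pow]
    exact pow_le_pow_left₀ (norm_nonneg _) (T.le_opNorm (slice e ψ y)) 2
  exact h.comp_injective (i := fun z : Z => ((e z).2, (e z).1)) fun a b hab =>
    e.injective (Prod.ext (congrArg Prod.snd hab) (congrArg Prod.fst hab))

theorem slice_add (e : Z ≃ X × Y) (ψ φ : L2 Z) (y : Y) :
    slice e (ψ + φ) y = slice e ψ y + slice e φ y := rfl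

theorem slice_smul (e : Z ≃ X × Y) (c : ℂ) (ψ : L2 Z) (y : Y) :
    slice e (c • ψ) y = c • slice e ψ y := rfl

/-- The operator `T ⊗ 1` on `ℓ²(Z)`, for an identification `Z ≃ X × Y`. -/
def ampOp (e : Z ≃ X × Y) (T : L2 X →L[ℂ] L2 X) : L2 Z →L[ℂ] L2 Z :=
  LinearMap.mkContinuous
    { toFun := fun ψ => ⟨fun z => T (slice e ψ (e z).2) (e z).1,
        mem_of_summable (ampFun_summable e T ψ)⟩
      map_add' := fun ψ φ => by
        ext z
        change T (slice e (ψ + φ) (e z).2) (e z).1 = _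
        rw [slice_add, map_add]
        rfl
      map_smul' := fun c ψ => by
        ext z
        change T (slice e (c • ψ) (e z).2) (e z).1 = _
        rw [slice_smul, map_smul]
        rfl }
    ‖T‖ (fun ψ => by
      refine le_of_sq_le_sq ?_ (by positivity)
      rw [norm_sq_slice e, mul_pow, norm_sq_slice e ψ, ← tsum_mul_left]
      refine Summable.tsum_le_tsum (fun y => ?_) (summable_slice e _)
        ((summable_slice e ψ).mul_left _)
      have : slice e (⟨fun z => T (slice e ψ (e z).2) (e z).1,
          mem_of_summable (ampFun_summable e T ψ)⟩ : L2 Z) y = T (slice e ψ y) := by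
        ext x
        simp
      rw [← mul_pow]
      refine pow_le_pow_left₀ (norm_nonneg _) ?_ 2
      exact (congrArg norm this).le.trans (T.le_opNorm _))

theorem ampOp_apply (e : Z ≃ X × Y) (T : L2 X →L[ℂ] L2 X) (ψ : L2 Z) (z : Z) :
    ampOp e T ψ z = T (slice e ψ (e z).2) (e z).1 := rfl

@[simp] theorem slice_ampOp (e : Z ≃ X × Y) (T : L2 X →L[ℂ] L2 X) (ψ : L2 Z) (y : Y) :
    slice e (ampOp e T ψ) y = T (slice e ψ y) := by
  ext x
  simp [ampOp_apply]

theorem inner_slice (e : Z ≃ X × Y) (ψ φ : L2 Z) :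
    inner ℂ ψ φ = ∑' y, inner ℂ (slice e ψ y) (slice e φ y) := by
  have h : Summable fun z => inner ℂ (ψ z) (φ z) := lp.summable_inner ψ φ
  have h' : Summable fun p : Y × X => inner ℂ (ψ (e.symm (p.2, p.1))) (φ (e.symm (p.2, p.1))) :=
    h.comp_injective (i := fun p : Y × X => e.symm (p.2, p.1)) fun a b h => by
      have := e.symm.injective h
      ext <;> simp_all
  rw [lp.inner_eq_tsum]
  refine Eq.trans ?_ (h'.tsum_prod.trans (tsum_congr fun y => ?_))
  · rw [← ((Equiv.prodComm Y X).trans e.symm).tsum_eq]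
    rfl
  · rw [lp.inner_eq_tsum]
    rfl

/-- `T ↦ T ⊗ 1` is a `*`-homomorphism. -/
def ampCLM (e : Z ≃ X × Y) : (L2 X →L[ℂ] L2 X) →⋆ₐ[ℂ] (L2 Z →L[ℂ] L2 Z) where
  toFun := ampOp e
  map_one' := by
    ext ψ z
    simp [ampOp_apply]
  map_mul' S T := by
    ext ψ z
    simp [ampOp_apply]
  map_zero' := by
    ext ψ z
    simp [ampOp_apply]
  map_add' S T := by
    ext ψ z
    simp [ampOp_apply]
  commutes' c := by
    ext ψ z
    simp [ampOp_apply, Algebra.algebraMap_eq_smul_one]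
  map_star' T := by
    rw [ContinuousLinearMap.star_eq_adjoint, ContinuousLinearMap.star_eq_adjoint,
      ContinuousLinearMap.eq_adjoint_iff]
    intro ψ φ
    rw [inner_slice e, inner_slice e]
    simp [ContinuousLinearMap.adjoint_inner_left]

end L2

/-- The `C^*`-algebra of bounded operators on `ℓ²(X)`. -/
def BOp (X : Type) : Type := L2 X →L[ℂ] L2 X

namespace BOp
variable {X Y Z : Type}

instance : CStarAlgebra (BOp X) := inferInstanceAs (CStarAlgebra (L2 X →L[ℂ] L2 X))

/-- A bounded operator as a continuous linear map. -/
def clm (T : BOp X) : L2 X →L[ℂ] L2 X := T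

@[simp] theorem clm_mul (S T : BOp X) (ψ : L2 X) : (S * T).clm ψ = S.clm (T.clm ψ) := rfl

@[simp] theorem clm_add (S T : BOp X) (ψ : L2 X) : (S + T).clm ψ = S.clm ψ + T.clm ψ := rfl

@[simp] theorem clm_zero (ψ : L2 X) : (0 : BOp X).clm ψ = 0 := rfl

@[simp] theorem clm_smul (c : ℂ) (T : BOp X) (ψ : L2 X) : (c • T).clm ψ = c • T.clm ψ := rfl

open L2

/-- The `*`-homomorphism `T ↦ T ⊗ 1` from `B(ℓ²(X))` to `B(ℓ²(Z))`, for an identification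
`Z ≃ X × Y`, that is `ℓ²(Z) ≃ ℓ²(X) ⊗ ℓ²(Y)`. -/
def amp (e : Z ≃ X × Y) : BOp X →⋆ₐ[ℂ] BOp Z where
  toFun T := ampCLM e T
  map_one' := map_one (ampCLM e)
  map_mul' := map_mul (ampCLM e)
  map_zero' := map_zero (ampCLM e)
  map_add' := map_add (ampCLM e)
  commutes' := (ampCLM e).commutes'
  map_star' := map_star (ampCLM e)

theorem amp_apply (e : Z ≃ X × Y) (T : BOp X) (ψ : L2 Z) (z : Z) :
    (amp e T).clm ψ z = T.clm (slice e ψ (e z).2) (e z).1 := rfl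

theorem ext_apply {S T : BOp X} (h : ∀ ψ x, S.clm ψ x = T.clm ψ x) : S = T :=
  ContinuousLinearMap.ext fun ψ => lp.ext (funext (h ψ))

/-- Two nested amplifications agree when they act in the same way on points. -/
theorem amp_amp {X' Y' W W' I : Type} (e : Z ≃ X × Y) (f : X ≃ I × W)
    (e' : Z ≃ X' × Y') (f' : X' ≃ I × W')
    (h₁ : ∀ z, (f (e z).1).1 = (f' (e' z).1).1)
    (h₂ : ∀ z i, e.symm (f.symm (i, (f (e z).1).2), (e z).2) =
      e'.symm (f'.symm (i, (f' (e' z).1).2), (e' z).2))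
    (T : BOp I) : amp e (amp f T) = amp e' (amp f' T) := by
  refine ext_apply fun ψ z => ?_
  have : slice f (slice e ψ (e z).2) (f (e z).1).2 =
      slice f' (slice e' ψ (e' z).2) (f' (e' z).1).2 := by
    ext i
    simp [h₂]
  rw [amp_apply, amp_apply, amp_apply, amp_apply, this, h₁]

/-- A nested amplification is an amplification. -/
theorem amp_amp_eq {W V I : Type} (e : Z ≃ X × Y) (f : X ≃ I × W) (e' : Z ≃ I × V)
    (h₁ : ∀ z, (f (e z).1).1 = (e' z).1)
    (h₂ : ∀ z i, e.symm (f.symm (i, (f (e z).1).2), (e z).2) = e'.symm (i, (e' z).2))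
    (T : BOp I) : amp e (amp f T) = amp e' T := by
  refine ext_apply fun ψ z => ?_
  have : slice f (slice e ψ (e z).2) (f (e z).1).2 = slice e' ψ (e' z).2 := by
    ext i
    simp [h₂]
  rw [amp_apply, amp_apply, amp_apply, this, h₁]

end BOp

end

noncomputable section
open scoped TensorProduct
namespace L2
variable {X Y Z : Type}

open Classical in
/-- The standard basis vector of `ℓ²(X)` at `x`. -/
def basisVec (x : X) : L2 X := lp.single 2 x 1

open Classical in
theorem basisVec_apply (x x' : X) : basisVec x x' = if x' = x then 1 else 0 := by
  simp [basisVec, Pi.single_apply]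

open Classical in
theorem slice_basisVec (e : Z ≃ X × Y) (z : Z) (y : Y) :
    slice e (basisVec z) y = if y = (e z).2 then basisVec (e z).1 else 0 := by
  ext x
  rw [slice_apply, basisVec_apply]
  by_cases hy : y = (e z).2
  · simp only [hy, if_true, basisVec_apply]
    congr 1
    rw [Equiv.symm_apply_eq]
    simp [Prod.ext_iff]
  · rw [if_neg hy, if_neg]
    · rfl
    · rintro rfl
      simp at hy

end L2

/-- Separating families of functionals on the factors separate the points of a tensor product. -/
theorem tensor_eq_zero {V W I J : Type} [AddCommGroup V] [Module ℂ V] [AddCommGroup W]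
    [Module ℂ W] (φ : I → V →ₗ[ℂ] ℂ) (hφ : ∀ v, (∀ i, φ i v = 0) → v = 0)
    (ψ : J → W →ₗ[ℂ] ℂ) (hψ : ∀ w, (∀ j, ψ j w = 0) → w = 0) (t : V ⊗[ℂ] W)
    (h : ∀ i j, TensorProduct.lid ℂ ℂ (TensorProduct.map (φ i) (ψ j) t) = 0) : t = 0 := by
  classical
  let b := Module.Basis.ofVectorSpace ℂ W
  apply (TensorProduct.equivFinsuppOfBasisRight (M := V) b).injective
  rw [map_zero]
  ext1 k
  refine hφ _ fun i => ?_
  have h2 : TensorProduct.lid ℂ W (TensorProduct.map (φ i) LinearMap.id t) = 0 := by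
    refine hψ _ fun j => ?_
    rw [← h i j]
    clear h
    induction t with
    | zero => simp
    | tmul v w => simp
    | add a b ha hb => simp only [map_add, ha, hb]
  have h4 : b.repr (TensorProduct.lid ℂ W (TensorProduct.map (φ i) LinearMap.id t)) k =
      φ i (TensorProduct.equivFinsuppOfBasisRight (M := V) b t k) := by
    clear h h2
    induction t with
    | zero => simp
    | tmul v w =>
      simp [mul_comm]
    | add a b ha hb => simp only [map_add, Finsupp.add_apply, ha, hb]
  rw [h2] at h4
  simpa using h4.symm

namespace BOp
open L2
variable {X Y Z : Type}

theorem op_ext {S T : BOp X}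
    (h : ∀ x x', S.clm (basisVec x) x' = T.clm (basisVec x) x') : S = T := by
  classical
  refine lp.ext_continuousLinearMap (by norm_num) fun x => ?_
  ext x'
  simpa [basisVec] using! h x x'

theorem amp_mul_amp_basisVec (e : Z ≃ X × Y) (T : BOp X) (U : BOp Y)
    (z z' : Z) : (amp e T * amp (e.trans (Equiv.prodComm X Y)) U).clm (basisVec z) z' =
      T.clm (basisVec (e z).1) (e z').1 * U.clm (basisVec (e z).2) (e z').2 := by
  classical
  have : slice e ((amp (e.trans (Equiv.prodComm X Y)) U).clm (basisVec z)) (e z').2 =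
      U.clm (basisVec (e z).2) (e z').2 • basisVec (e z).1 := by
    ext x
    rw [slice_apply, amp_apply, slice_basisVec]
    by_cases hx : x = (e z).1 <;> simp [hx, basisVec_apply]
  rw [clm_mul, amp_apply, this, map_smul]
  simp [mul_comm]

theorem amp_commute (e : Z ≃ X × Y) (T : BOp X) (U : BOp Y) :
    Commute (amp e T) (amp (e.trans (Equiv.prodComm X Y)) U) := by
  refine op_ext fun z z' => ?_
  have := amp_mul_amp_basisVec (e.trans (Equiv.prodComm X Y)) U T z z'
  rw [amp_mul_amp_basisVec, mul_comm]
  exact this.symm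

/-- The multiplication map `B(ℓ²X) ⊗ B(ℓ²Y) → B(ℓ²Z)`, `T ⊗ U ↦ (T ⊗ 1)(1 ⊗ U)`. -/
def ampMul (e : Z ≃ X × Y) :
    BOp X ⊗[ℂ] BOp Y →ₐ[ℂ] BOp Z :=
  Algebra.TensorProduct.lift (amp e).toAlgHom (amp (e.trans (Equiv.prodComm X Y))).toAlgHom
    (amp_commute e)

theorem ampMul_tmul (e : Z ≃ X × Y) (T : BOp X) (U : BOp Y) :
    ampMul e (T ⊗ₜ U) = amp e T * amp (e.trans (Equiv.prodComm X Y)) U := rfl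

/-- The matrix coefficient functional `T ↦ ⟨x', T x⟩`. -/
def coeff (x x' : X) : BOp X →ₗ[ℂ] ℂ where
  toFun T := T.clm (basisVec x) x'
  map_add' _ _ := rfl
  map_smul' _ _ := rfl

theorem ampMul_injective (e : Z ≃ X × Y) : Function.Injective (ampMul e) := by
  rw [injective_iff_map_eq_zero]
  intro t ht
  refine tensor_eq_zero (I := X × X) (J := Y × Y) (fun p => coeff p.1 p.2)
    (fun T h => op_ext fun x x' => h (x, x')) (fun p => coeff p.1 p.2)
    (fun T h => op_ext fun x x' => h (x, x')) t ?_
  rintro ⟨x, x'⟩ ⟨y, y'⟩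
  have h : TensorProduct.lid ℂ ℂ (TensorProduct.map (coeff x x') (coeff y y') t) =
      coeff (e.symm (x, y)) (e.symm (x', y')) (ampMul e t) := by
    clear ht
    induction t with
    | zero => simp
    | tmul T U =>
      rw [ampMul_tmul, TensorProduct.map_tmul, TensorProduct.lid_tmul]
      have := amp_mul_amp_basisVec e T U (e.symm (x, y)) (e.symm (x', y'))
      rw [Equiv.apply_symm_apply, Equiv.apply_symm_apply] at this
      exact this.symm
    | add a b ha hb => simp only [map_add, ha, hb]
  refine h.trans ?_
  rw [ht, map_zero]

theorem ampMul_star (e : Z ≃ X × Y) (t : BOp X ⊗[ℂ] BOp Y) :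
    ampMul e (star t) = star (ampMul e t) := by
  induction t with
  | zero => simp
  | tmul T U =>
    rw [TensorProduct.star_tmul, ampMul_tmul, ampMul_tmul, star_mul, map_star, map_star]
    rw [← map_star, ← map_star]
    exact amp_commute e (star T) (star U)
  | add a b ha hb => simp only [star_add, map_add, ha, hb]

/-- Matrix units. -/
def unit (x x' : X) : BOp X := InnerProductSpace.rankOne ℂ (basisVec x) (basisVec x')

theorem unit_clm (x x' : X) (ψ : L2 X) :
    (unit x x').clm ψ = inner ℂ (basisVec x') ψ • basisVec x := rfl

open Classical in
theorem unit_apply (x x' y y' : X) :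
    (unit x x').clm (basisVec y) y' = if y' = x ∧ y = x' then 1 else 0 := by
  have : inner ℂ (basisVec x') (basisVec y) = if y = x' then (1 : ℂ) else 0 := by
    rw [basisVec, lp.inner_single_left, basisVec_apply]
    by_cases h : y = x'
    · simp [h]
    · simp [h, Ne.symm h]
  rw [unit_clm, this]
  by_cases h : y = x' <;> by_cases h' : y' = x <;> simp [h, h', basisVec_apply]

theorem ampMul_surjective [Finite Z] (e : Z ≃ X × Y) : Function.Surjective (ampMul e) := by
  classical
  cases nonempty_fintype Z
  intro T
  refine ⟨∑ p : Z × Z, T.clm (basisVec p.2) p.1 • (unit (e p.1).1 (e p.2).1 ⊗ₜ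
    unit (e p.1).2 (e p.2).2), op_ext fun z z' => ?_⟩
  have h : ∀ p : Z × Z, (T.clm (basisVec p.2) p.1 • (amp e (unit (e p.1).1 (e p.2).1) *
      amp (e.trans (Equiv.prodComm X Y)) (unit (e p.1).2 (e p.2).2))).clm (basisVec z) z' =
      if p = (z', z) then T.clm (basisVec z) z' else 0 := by
    rintro ⟨p, q⟩
    rw [clm_smul, lp.coeFn_smul, Pi.smul_apply, amp_mul_amp_basisVec,
      unit_apply, unit_apply]
    by_cases h1 : p = z'
    · by_cases h2 : q = z
      · simp [h1, h2]
      · have : ¬ ((e z).1 = (e q).1 ∧ (e z).2 = (e q).2) := fun hh =>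
          h2 (e.injective (Prod.ext hh.1.symm hh.2.symm))
        rw [if_neg (c := (p, q) = (z', z)) (by simp [h2])]
        simp only [h1, true_and]
        by_cases h3 : (e z).1 = (e q).1 <;> simp_all
    · have : ¬ ((e z').1 = (e p).1 ∧ (e z').2 = (e p).2) := fun hh =>
          h1 (e.injective (Prod.ext hh.1.symm hh.2.symm))
      rw [if_neg (c := (p, q) = (z', z)) (by simp [h1])]
      by_cases h3 : (e z').1 = (e p).1 <;> simp_all
  have h' : coeff z z' (ampMul e (∑ p : Z × Z, T.clm (basisVec p.2) p.1 •
      (unit (e p.1).1 (e p.2).1 ⊗ₜ unit (e p.1).2 (e p.2).2))) = T.clm (basisVec z) z' := by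
    rw [map_sum, map_sum]
    simp only [map_smul (ampMul e), ampMul_tmul]
    refine (Finset.sum_congr rfl fun p _ => h p).trans ?_
    simp
  exact h'

end BOp

end

noncomputable section
open scoped TensorProduct CStarAlgebra

/-- A spin chain. The on-site Hilbert space at `j` is `ℂ^{site j} = ℓ²(site j)`, where the finite
nonempty type `site j` labels an orthonormal basis; the dimensions are uniformly bounded. -/
structure SpinChain where
  site : ℤ → Type
  fin : ∀ j, Finite (site j)
  nonempty : ∀ j, Nonempty (site j)
  bounded : ∃ dmax : ℕ, ∀ j, Nat.card (site j) ≤ dmax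

namespace SpinChain

/-- Configurations of basis labels. -/
abbrev Config (A : SpinChain) : Type := ∀ j, A.site j

/-- The bounded operators on `ℓ²(Config)`. -/
abbrev Op (A : SpinChain) : Type := BOp A.Config

/-- Configurations of basis labels on a finite set of sites. -/
abbrev FinConfig (A : SpinChain) (S : Finset ℤ) : Type := ∀ j : {j : ℤ // j ∈ S}, A.site j

instance (A : SpinChain) (S : Finset ℤ) : Finite (A.FinConfig S) :=
  haveI := A.fin
  Pi.finite

/-- Splitting a configuration into its parts inside and outside of `S`. -/
abbrev split (A : SpinChain) (S : Finset ℤ) :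
    A.Config ≃ A.FinConfig S × ∀ j : {j : ℤ // j ∉ S}, A.site j :=
  Equiv.piEquivPiSubtypeProd (· ∈ S) A.site

/-- `𝒜_S = ⨂_{j ∈ S} End(ℂ^{site j})` for finite `S`: all operators on `⨂_{j ∈ S} ℂ^{site j}`,
which is `ℓ²(FinConfig S)`, acting as `T ⊗ 1`. -/
def finAlg (A : SpinChain) (S : Finset ℤ) : StarSubalgebra ℂ A.Op := (BOp.amp (A.split S)).range

/-- The algebra of strictly local operators supported in `X`. -/
def preAlg (A : SpinChain) (X : Set ℤ) : StarSubalgebra ℂ A.Op :=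
  ⨆ S : {S : Finset ℤ // (S : Set ℤ) ⊆ X}, A.finAlg S

/-- The quasi-local algebra of `X`, as an algebra of operators. -/
def localAlg (A : SpinChain) (X : Set ℤ) : StarSubalgebra ℂ A.Op :=
  (A.preAlg X).topologicalClosure

/-- The spin chain `C^*`-algebra `𝒜`. -/
def Alg (A : SpinChain) : Type := A.localAlg Set.univ

instance (A : SpinChain) : IsClosed ((A.localAlg Set.univ : StarSubalgebra ℂ A.Op) : Set A.Op) :=
  StarSubalgebra.isClosed_topologicalClosure _

instance (A : SpinChain) : CStarAlgebra A.Alg :=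
  inferInstanceAs (CStarAlgebra (A.localAlg Set.univ))

/-- The inclusion of `𝒜` into the bounded operators. -/
def toOp (A : SpinChain) : A.Alg →⋆ₐ[ℂ] A.Op := (A.localAlg Set.univ).subtype

/-- The subalgebra `𝒜_X ⊆ 𝒜`. -/
def sub (A : SpinChain) (X : Set ℤ) : StarSubalgebra ℂ A.Alg :=
  (A.localAlg X).comap A.toOp

theorem finAlg_mono (A : SpinChain) {S T : Finset ℤ} (h : S ⊆ T) : A.finAlg S ≤ A.finAlg T := by
  rintro _ ⟨a, rfl⟩
  let f : A.FinConfig T ≃ A.FinConfig S × ∀ j : {j : {j : ℤ // j ∈ T} // j.1 ∉ S}, A.site j :=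
    { toFun := fun σ => (fun j => σ ⟨j, h j.2⟩, fun j => σ j)
      invFun := fun p j => if hj : j.1 ∈ S then p.1 ⟨j, hj⟩ else p.2 ⟨j, hj⟩
      left_inv := fun σ => by ext j; by_cases hj : j.1 ∈ S <;> simp [hj]
      right_inv := fun p => by
        refine Prod.ext ?_ ?_ <;> ext j
        · simp
        · have := j.2
          simp [this] }
  refine ⟨BOp.amp f a, BOp.amp_amp_eq _ _ _ (fun z => rfl) (fun z i => ?_) a⟩
  ext j
  by_cases hj : j ∈ S
  · simp [f, Equiv.piEquivPiSubtypeProd, hj, h hj]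
  · by_cases hjT : j ∈ T <;> simp [f, Equiv.piEquivPiSubtypeProd, hj, hjT]

theorem directed_finAlg (A : SpinChain) (X : Set ℤ) :
    Directed (· ≤ ·) fun S : {S : Finset ℤ // (S : Set ℤ) ⊆ X} => A.finAlg S := by
  classical
  intro S T
  exact ⟨⟨S.1 ∪ T.1, by simp [S.2, T.2]⟩, A.finAlg_mono Finset.subset_union_left,
    A.finAlg_mono Finset.subset_union_right⟩

theorem mem_preAlg (A : SpinChain) {X : Set ℤ} {a : A.Op} :
    a ∈ A.preAlg X ↔ ∃ S : Finset ℤ, (S : Set ℤ) ⊆ X ∧ a ∈ A.finAlg S := by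
  have : Nonempty {S : Finset ℤ // (S : Set ℤ) ⊆ X} := ⟨⟨∅, by simp⟩⟩
  rw [← SetLike.mem_coe, preAlg, StarSubalgebra.coe_iSup_of_directed (A.directed_finAlg X)]
  simp

/-! ### Stacking -/

/-- The stack of two spin chains: the on-site Hilbert space at `j` is the tensor product
`ℂ^{A.site j} ⊗ ℂ^{B.site j} = ℂ^{A.site j × B.site j}`. -/
def stack (A B : SpinChain) : SpinChain where
  site j := A.site j × B.site j
  fin j := haveI := A.fin j; haveI := B.fin j; inferInstance
  nonempty j := haveI := A.nonempty j; haveI := B.nonempty j; inferInstance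
  bounded := by
    obtain ⟨m, hm⟩ := A.bounded
    obtain ⟨n, hn⟩ := B.bounded
    exact ⟨m * n, fun j => by rw [Nat.card_prod]; exact Nat.mul_le_mul (hm j) (hn j)⟩

variable (A B : SpinChain)

/-- A configuration of the stack is a pair of configurations. -/
def unzip : (A.stack B).Config ≃ A.Config × B.Config where
  toFun σ := (fun j => (σ j).1, fun j => (σ j).2)
  invFun p j := (p.1 j, p.2 j)
  left_inv _ := rfl
  right_inv _ := rfl

/-- A finite configuration of the stack is a pair of finite configurations. -/
def unzipFin (S : Finset ℤ) : (A.stack B).FinConfig S ≃ A.FinConfig S × B.FinConfig S where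
  toFun σ := (fun j => (σ j).1, fun j => (σ j).2)
  invFun p j := (p.1 j, p.2 j)
  left_inv _ := rfl
  right_inv _ := rfl

theorem unzip_apply (σ : (A.stack B).Config) :
    A.unzip B σ = (fun j => (σ j).1, fun j => (σ j).2) := rfl

theorem unzip_symm_apply (p : A.Config × B.Config) (j : ℤ) :
    (A.unzip B).symm p j = (p.1 j, p.2 j) := rfl

theorem unzipFin_apply (S : Finset ℤ) (σ : (A.stack B).FinConfig S) :
    A.unzipFin B S σ = (fun j => (σ j).1, fun j => (σ j).2) := rfl

theorem unzipFin_symm_apply (S : Finset ℤ) (p : A.FinConfig S × B.FinConfig S)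
    (j : {j : ℤ // j ∈ S}) : (A.unzipFin B S).symm p j = (p.1 j, p.2 j) := rfl

/-- `T ↦ T ⊗ 1` on operators. -/
def opL : A.Op →⋆ₐ[ℂ] (A.stack B).Op := BOp.amp (A.unzip B)

/-- `T ↦ 1 ⊗ T` on operators. -/
def opR : B.Op →⋆ₐ[ℂ] (A.stack B).Op := BOp.amp ((A.unzip B).trans (Equiv.prodComm _ _))

theorem opL_amp (S : Finset ℤ) (T : BOp (A.FinConfig S)) :
    A.opL B (BOp.amp (A.split S) T) =
      BOp.amp ((A.stack B).split S) (BOp.amp (A.unzipFin B S) T) := by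
  refine BOp.amp_amp (A.unzip B) (A.split S) ((A.stack B).split S)
    (A.unzipFin B S) (fun z => rfl) (fun z i => ?_) T
  funext j
  by_cases hj : j ∈ S
  · simp [unzip_symm_apply, unzip_apply, unzipFin_symm_apply, unzipFin_apply,
      Equiv.piEquivPiSubtypeProd, hj]
    rfl
  · simp [unzip_symm_apply, unzip_apply, unzipFin_apply, Equiv.piEquivPiSubtypeProd, hj]
    rfl

theorem opR_amp (S : Finset ℤ) (T : BOp (B.FinConfig S)) :
    A.opR B (BOp.amp (B.split S) T) = BOp.amp ((A.stack B).split S)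
      (BOp.amp ((A.unzipFin B S).trans (Equiv.prodComm _ _)) T) := by
  refine BOp.amp_amp ((A.unzip B).trans (Equiv.prodComm _ _)) (B.split S)
    ((A.stack B).split S) ((A.unzipFin B S).trans (Equiv.prodComm _ _)) (fun z => rfl) (fun z i => ?_) T
  funext j
  by_cases hj : j ∈ S
  · simp [unzip_symm_apply, unzip_apply, unzipFin_symm_apply, unzipFin_apply,
      Equiv.piEquivPiSubtypeProd, hj]
    rfl
  · simp [unzip_symm_apply, unzip_apply, unzipFin_apply, Equiv.piEquivPiSubtypeProd, hj]
    rfl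

theorem opL_mem {X : Set ℤ} {a : A.Op} (ha : a ∈ A.localAlg X) :
    A.opL B a ∈ (A.stack B).localAlg X := by
  have hc : Continuous (A.opL B) := map_continuous (A.opL B)
  have : A.localAlg X ≤ ((A.stack B).localAlg X).comap (A.opL B) := by
    refine StarSubalgebra.topologicalClosure_minimal ?_
      ((StarSubalgebra.isClosed_topologicalClosure _).preimage hc)
    intro a ha
    obtain ⟨S, hS, T, rfl⟩ := A.mem_preAlg.1 ha
    refine StarSubalgebra.le_topologicalClosure _ ((A.stack B).mem_preAlg.2 ⟨S, hS, ?_⟩)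
    exact ⟨_, (A.opL_amp B S T).symm⟩
  exact this ha

theorem opR_mem {X : Set ℤ} {b : B.Op} (hb : b ∈ B.localAlg X) :
    A.opR B b ∈ (A.stack B).localAlg X := by
  have hc : Continuous (A.opR B) := map_continuous (A.opR B)
  have : B.localAlg X ≤ ((A.stack B).localAlg X).comap (A.opR B) := by
    refine StarSubalgebra.topologicalClosure_minimal ?_
      ((StarSubalgebra.isClosed_topologicalClosure _).preimage hc)
    intro a ha
    obtain ⟨S, hS, T, rfl⟩ := B.mem_preAlg.1 ha
    refine StarSubalgebra.le_topologicalClosure _ ((A.stack B).mem_preAlg.2 ⟨S, hS, ?_⟩)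
    exact ⟨_, (A.opR_amp B S T).symm⟩
  exact this hb

theorem toOp_injective : Function.Injective A.toOp := Subtype.val_injective

theorem toOp_mem (a : A.Alg) : A.toOp a ∈ A.localAlg Set.univ := a.2

/-- The restriction of the codomain of a `*`-homomorphism to `𝒜`. -/
def codRestrict {A : SpinChain} {D : Type} [Semiring D] [Algebra ℂ D] [Star D]
    (f : D →⋆ₐ[ℂ] A.Op) (hf : ∀ d, f d ∈ A.localAlg Set.univ) : D →⋆ₐ[ℂ] A.Alg where
  toFun d := ⟨f d, hf d⟩
  map_one' := Subtype.ext (map_one f)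
  map_mul' a b := Subtype.ext (map_mul f a b)
  map_zero' := Subtype.ext (map_zero f)
  map_add' a b := Subtype.ext (map_add f a b)
  commutes' c := Subtype.ext (f.commutes' c)
  map_star' a := Subtype.ext (map_star f a)

theorem toOp_codRestrict {A : SpinChain} {D : Type} [Semiring D] [Algebra ℂ D] [Star D]
    (f : D →⋆ₐ[ℂ] A.Op) (hf : ∀ d, f d ∈ A.localAlg Set.univ) (d : D) :
    A.toOp (codRestrict f hf d) = f d := rfl

/-- The inclusion `a ↦ a ⊗ 1` of `𝒜` into `𝒜 ⊗ ℬ`. -/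
def inl : A.Alg →⋆ₐ[ℂ] (A.stack B).Alg :=
  codRestrict ((A.opL B).comp A.toOp) fun a => A.opL_mem B (A.toOp_mem a)

/-- The inclusion `b ↦ 1 ⊗ b` of `ℬ` into `𝒜 ⊗ ℬ`. -/
def inr : B.Alg →⋆ₐ[ℂ] (A.stack B).Alg :=
  codRestrict ((A.opR B).comp B.toOp) fun b => A.opR_mem B (B.toOp_mem b)

theorem toOp_inl (a : A.Alg) : (A.stack B).toOp (A.inl B a) = A.opL B (A.toOp a) := rfl

theorem toOp_inr (b : B.Alg) : (A.stack B).toOp (A.inr B b) = A.opR B (B.toOp b) := rfl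

theorem inl_commute_inr (a : A.Alg) (b : B.Alg) : Commute (A.inl B a) (A.inr B b) := by
  apply (A.stack B).toOp_injective
  rw [map_mul, map_mul]
  exact BOp.amp_commute (A.unzip B) (A.toOp a) (B.toOp b)

theorem inl_mem {X : Set ℤ} {a : A.Alg} (ha : a ∈ A.sub X) : A.inl B a ∈ (A.stack B).sub X :=
  A.opL_mem B ha

theorem inr_mem {X : Set ℤ} {b : B.Alg} (hb : b ∈ B.sub X) : A.inr B b ∈ (A.stack B).sub X :=
  A.opR_mem B hb

end SpinChain

end

noncomputable section
open scoped TensorProduct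
namespace SpinChain
variable (A B : SpinChain)

/-- The `*`-algebra of strictly local operators. -/
def Loc (A : SpinChain) : Type := A.preAlg Set.univ

instance : Ring A.Loc := inferInstanceAs (Ring (A.preAlg Set.univ))
instance : Algebra ℂ A.Loc := inferInstanceAs (Algebra ℂ (A.preAlg Set.univ))
instance : StarRing A.Loc := inferInstanceAs (StarRing (A.preAlg Set.univ))
instance : StarModule ℂ A.Loc := inferInstanceAs (StarModule ℂ (A.preAlg Set.univ))

/-- The inclusion of `𝒜_S`, for finite `S`, into the strictly local operators. -/
def fromFin (S : Finset ℤ) : BOp (A.FinConfig S) →⋆ₐ[ℂ] A.Loc where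
  toFun T := ⟨BOp.amp (A.split S) T, A.mem_preAlg.2 ⟨S, Set.subset_univ _, ⟨T, rfl⟩⟩⟩
  map_one' := Subtype.ext (map_one (BOp.amp (A.split S)))
  map_mul' a b := Subtype.ext (map_mul (BOp.amp (A.split S)) a b)
  map_zero' := Subtype.ext (map_zero (BOp.amp (A.split S)))
  map_add' a b := Subtype.ext (map_add (BOp.amp (A.split S)) a b)
  commutes' c := Subtype.ext ((BOp.amp (A.split S)).commutes' c)
  map_star' a := Subtype.ext (map_star (BOp.amp (A.split S)) a)

/-- The inclusion of the strictly local operators. -/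
def incl : A.Loc →⋆ₐ[ℂ] A.Alg where
  toFun a := ⟨a.1, StarSubalgebra.le_topologicalClosure _ a.2⟩
  map_one' := rfl
  map_mul' _ _ := rfl
  map_zero' := rfl
  map_add' _ _ := rfl
  commutes' _ := rfl
  map_star' _ := rfl

theorem exists_fromFin (a : A.Loc) (S₀ : Finset ℤ) :
    ∃ S, S₀ ⊆ S ∧ a ∈ (A.fromFin S).range := by
  classical
  obtain ⟨S, -, h⟩ := A.mem_preAlg.1 a.2
  obtain ⟨T, hT⟩ := A.finAlg_mono (Finset.subset_union_right (s₁ := S₀)) h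
  exact ⟨S₀ ∪ S, Finset.subset_union_left, T, Subtype.ext hT⟩

theorem fromFin_mono {S T : Finset ℤ} (h : S ⊆ T) {a : A.Loc}
    (ha : a ∈ (A.fromFin S).range) : a ∈ (A.fromFin T).range := by
  obtain ⟨x, rfl⟩ := ha
  obtain ⟨T, hT⟩ := A.finAlg_mono h ⟨x, rfl⟩
  exact ⟨T, Subtype.ext hT⟩

variable {E : Type} [CStarAlgebra E]

/-- The algebraic tensor product of the strictly local operators. -/
abbrev PreStack : Type := A.Loc ⊗[ℂ] B.Loc

variable {A B}

/-- The product of two commuting homomorphisms on the algebraic tensor product. -/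
def preLift (f : A.Alg →⋆ₐ[ℂ] E) (h : B.Alg →⋆ₐ[ℂ] E) (hc : ∀ a b, Commute (f a) (h b)) :
    A.PreStack B →ₐ[ℂ] E :=
  Algebra.TensorProduct.lift (f.comp A.incl).toAlgHom (h.comp B.incl).toAlgHom
    fun a b => hc (A.incl a) (B.incl b)

theorem preLift_tmul (f : A.Alg →⋆ₐ[ℂ] E) (h : B.Alg →⋆ₐ[ℂ] E)
    (hc : ∀ a b, Commute (f a) (h b)) (a : A.Loc) (b : B.Loc) :
    preLift f h hc (a ⊗ₜ b) = f (A.incl a) * h (B.incl b) := rfl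

theorem preLift_star (f : A.Alg →⋆ₐ[ℂ] E) (h : B.Alg →⋆ₐ[ℂ] E)
    (hc : ∀ a b, Commute (f a) (h b)) (t : A.PreStack B) :
    preLift f h hc (star t) = star (preLift f h hc t) := by
  induction t using TensorProduct.induction_on with
  | zero => simp
  | tmul a b =>
    rw [TensorProduct.star_tmul, preLift_tmul, preLift_tmul, star_mul]
    rw [map_star, map_star, map_star, map_star]
    have := hc (star (A.incl a)) (star (B.incl b))
    rw [map_star, map_star] at this
    exact this
  | add a b ha hb => simp only [star_add, map_add, ha, hb]

variable (A B)

/-- The algebraic tensor product maps into the stack. -/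
def preMul : A.PreStack B →ₐ[ℂ] (A.stack B).Alg :=
  preLift (A.inl B) (A.inr B) (A.inl_commute_inr B)

/-- The tensor product of the inclusions of `𝒜_S` and `ℬ_S`. -/
def fromFin₂ (S : Finset ℤ) :
    BOp (A.FinConfig S) ⊗[ℂ]
      BOp (B.FinConfig S) →ₐ[ℂ] A.PreStack B :=
  Algebra.TensorProduct.map (A.fromFin S).toAlgHom (B.fromFin S).toAlgHom

theorem fromFin₂_tmul (S : Finset ℤ) (T : BOp (A.FinConfig S))
    (U : BOp (B.FinConfig S)) :
    A.fromFin₂ B S (T ⊗ₜ U) = A.fromFin S T ⊗ₜ B.fromFin S U := rfl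

theorem fromFin₂_star (S : Finset ℤ) (t) :
    A.fromFin₂ B S (star t) = star (A.fromFin₂ B S t) := by
  induction t with
  | zero => simp
  | tmul a b =>
    rw [TensorProduct.star_tmul, fromFin₂_tmul, fromFin₂_tmul, TensorProduct.star_tmul,
      map_star, map_star]
  | add a b ha hb => simp only [star_add, map_add, ha, hb]

theorem fromFin₂_mono {S T : Finset ℤ} (hST : S ⊆ T) (t) :
    ∃ t', A.fromFin₂ B T t' = A.fromFin₂ B S t := by
  induction t with
  | zero => exact ⟨0, by simp⟩
  | tmul a b =>
    obtain ⟨a', ha'⟩ := A.fromFin_mono hST ⟨a, rfl⟩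
    obtain ⟨b', hb'⟩ := B.fromFin_mono hST ⟨b, rfl⟩
    exact ⟨a' ⊗ₜ b', congrArg₂ (fun x y => x ⊗ₜ[ℂ] y) ha' hb'⟩
  | add a b ha hb =>
    obtain ⟨a', ha'⟩ := ha
    obtain ⟨b', hb'⟩ := hb
    refine ⟨a' + b', ?_⟩
    rw [map_add (A.fromFin₂ B T), map_add (A.fromFin₂ B S), ha', hb']

theorem exists_fromFin₂ (t : A.PreStack B) : ∃ S t', A.fromFin₂ B S t' = t := by
  classical
  induction t using TensorProduct.induction_on with
  | zero => exact ⟨∅, 0, map_zero (A.fromFin₂ B ∅)⟩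
  | tmul a b =>
    obtain ⟨S, -, ha⟩ := A.exists_fromFin a ∅
    obtain ⟨T, hT, b', hb'⟩ := B.exists_fromFin b S
    obtain ⟨a', ha'⟩ := A.fromFin_mono hT ha
    exact ⟨T, a' ⊗ₜ b', congrArg₂ (fun x y => x ⊗ₜ[ℂ] y) ha' hb'⟩
  | add a b ha hb =>
    obtain ⟨S, s, rfl⟩ := ha
    obtain ⟨T, t, rfl⟩ := hb
    obtain ⟨s', hs⟩ := A.fromFin₂_mono B (Finset.subset_union_left (s₁ := S) (s₂ := T)) s
    obtain ⟨t', ht⟩ := A.fromFin₂_mono B (Finset.subset_union_right (s₁ := S) (s₂ := T)) t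
    refine ⟨S ∪ T, s' + t', ?_⟩
    rw [map_add (A.fromFin₂ B (S ∪ T)), hs, ht]

theorem preMul_fromFin₂ (S : Finset ℤ) (t) :
    (A.stack B).toOp (A.preMul B (A.fromFin₂ B S t)) =
      BOp.amp ((A.stack B).split S) (BOp.ampMul (A.unzipFin B S) t) := by
  induction t with
  | zero => simp
  | tmul T U =>
    rw [BOp.ampMul_tmul, map_mul, ← opL_amp, ← opR_amp]
    rfl
  | add a b ha hb => simp only [map_add, ← ha, ← hb]

end SpinChain

end

noncomputable section
open scoped TensorProduct
theorem BOp.amp_injective {X Y Z : Type} [Nonempty Y] (e : Z ≃ X × Y) :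
    Function.Injective (BOp.amp e) := by
  intro S T h
  obtain ⟨y⟩ := ‹Nonempty Y›
  refine op_ext fun x x' => ?_
  have := congrArg (fun U : BOp Z => U.clm (L2.basisVec (e.symm (x, y))) (e.symm (x', y))) h
  simpa [amp_apply, L2.slice_basisVec] using this

open scoped CStarAlgebra

namespace SpinChain

instance (A : SpinChain) (S : Finset ℤ) : Nonempty (∀ j : {j : ℤ // j ∉ S}, A.site j) :=
  ⟨fun j => (A.nonempty j).some⟩

variable {E : Type} [CStarAlgebra E] {A B : SpinChain}

theorem preLift_norm_le (f : A.Alg →⋆ₐ[ℂ] E) (h : B.Alg →⋆ₐ[ℂ] E)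
    (hc : ∀ a b, Commute (f a) (h b)) (t : A.PreStack B) :
    ‖preLift f h hc t‖ ≤ ‖A.preMul B t‖ := by
  obtain ⟨S, s, rfl⟩ := A.exists_fromFin₂ B t
  let m := AlgEquiv.ofBijective (BOp.ampMul (A.unzipFin B S))
    ⟨BOp.ampMul_injective _, BOp.ampMul_surjective _⟩
  have hm : ∀ t, m (star t) = star (m t) := BOp.ampMul_star (A.unzipFin B S)
  let Γ : BOp ((A.stack B).FinConfig S) →⋆ₐ[ℂ] E :=
    { ((preLift f h hc).comp (A.fromFin₂ B S)).comp m.symm.toAlgHom with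
      map_star' := fun T => by
        obtain ⟨t, rfl⟩ := m.surjective T
        change preLift f h hc (A.fromFin₂ B S (m.symm (star (m t)))) =
          star (preLift f h hc (A.fromFin₂ B S (m.symm (m t))))
        rw [← hm, m.symm_apply_apply, m.symm_apply_apply, fromFin₂_star, preLift_star] }
  have h1 : preLift f h hc (A.fromFin₂ B S s) = Γ (m s) := by
    change _ = preLift f h hc (A.fromFin₂ B S (m.symm (m s)))
    rw [m.symm_apply_apply]
  have h2 : ‖A.preMul B (A.fromFin₂ B S s)‖ = ‖m s‖ := by
    change ‖(A.stack B).toOp (A.preMul B (A.fromFin₂ B S s))‖ = _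
    rw [preMul_fromFin₂]
    have hinj : Function.Injective (BOp.amp ((A.stack B).split S)) := BOp.amp_injective _
    exact NonUnitalStarAlgHom.norm_map (BOp.amp ((A.stack B).split S)) hinj (m s)
  rw [h1, h2]
  exact NonUnitalStarAlgHom.norm_apply_le Γ (m s)

theorem mem_closure_preimage {R : Type} [TopologicalSpace R] (s t : Set R) (hst : s ⊆ t)
    (ht : t ⊆ closure s) (c : t) : c ∈ closure (Subtype.val ⁻¹' s : Set t) := by
  rw [closure_subtype, Subtype.image_preimage_coe, Set.inter_eq_self_of_subset_right hst]
  exact ht c.2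

theorem dense_of_forall_loc (A : SpinChain) (s : Set A.Alg) (hs : ∀ a : A.Loc, A.incl a ∈ s) :
    Dense s := by
  intro c
  have h := mem_closure_preimage (A.preAlg Set.univ : Set A.Op) (A.localAlg Set.univ : Set A.Op)
    (StarSubalgebra.le_topologicalClosure _) le_rfl c
  exact closure_mono (fun x hx => hs ⟨x.1, hx⟩) h

theorem denseRange_preMul : DenseRange (A.preMul B) := by
  refine dense_of_forall_loc _ _ fun a => ?_
  obtain ⟨S, -, T, rfl⟩ := (A.stack B).exists_fromFin a ∅
  obtain ⟨t, rfl⟩ := BOp.ampMul_surjective (A.unzipFin B S) T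
  exact ⟨A.fromFin₂ B S t, (A.stack B).toOp_injective (A.preMul_fromFin₂ B S t)⟩

/-- Two commuting `*`-homomorphisms `f` on `𝒜` and `h` on `ℬ` define a `*`-homomorphism on
`𝒜 ⊗ ℬ` with `a ⊗ b ↦ f a * h b`. -/
def lift (f : A.Alg →⋆ₐ[ℂ] E) (h : B.Alg →⋆ₐ[ℂ] E) (hc : ∀ a b, Commute (f a) (h b)) :
    (A.stack B).Alg →⋆ₐ[ℂ] E :=
  let L : (A.stack B).Alg →L[ℂ] E :=
    (preLift f h hc).toLinearMap.extendOfNorm (A.preMul B).toLinearMap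
  have hL : ∀ t, L (A.preMul B t) = preLift f h hc t :=
    LinearMap.extendOfNorm_eq denseRange_preMul
      ⟨1, fun t => by rw [one_mul]; exact preLift_norm_le f h hc t⟩
  { toFun := L
    map_zero' := map_zero L
    map_add' := map_add L
    map_one' := by
      have := hL 1
      rwa [map_one (A.preMul B), map_one (preLift f h hc)] at this
    map_mul' := fun x y => by
      refine denseRange_preMul.induction_on₂
        (p := fun x y => L (x * y) = L x * L y) ?_ ?_ x y
      · exact isClosed_eq (by fun_prop) (by fun_prop)
      · intro s t
        rw [← map_mul, hL, hL, hL, map_mul]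
    commutes' := fun c => by
      have := hL (algebraMap ℂ _ c)
      rwa [AlgHom.commutes, AlgHom.commutes] at this
    map_star' := fun x => by
      refine denseRange_preMul.induction_on
        (p := fun x => L (star x) = star (L x)) x ?_ ?_
      · exact isClosed_eq (by fun_prop) (by fun_prop)
      · intro t
        have : A.preMul B (star t) = star (A.preMul B t) := preLift_star _ _ _ t
        rw [← this, hL, hL, preLift_star] }

theorem lift_preMul (f : A.Alg →⋆ₐ[ℂ] E) (h : B.Alg →⋆ₐ[ℂ] E)
    (hc : ∀ a b, Commute (f a) (h b)) (t : A.PreStack B) :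
    lift f h hc (A.preMul B t) = preLift f h hc t :=
  LinearMap.extendOfNorm_eq denseRange_preMul
    ⟨1, fun t => by rw [one_mul]; exact preLift_norm_le f h hc t⟩ t

theorem preAlg_dense (A : SpinChain) : DenseRange A.incl :=
  A.dense_of_forall_loc _ fun a => ⟨a, rfl⟩

theorem lift_inl (f : A.Alg →⋆ₐ[ℂ] E) (h : B.Alg →⋆ₐ[ℂ] E)
    (hc : ∀ a b, Commute (f a) (h b)) (a : A.Alg) : lift f h hc (A.inl B a) = f a := by
  refine A.preAlg_dense.induction_on (p := fun a => lift f h hc (A.inl B a) = f a) a ?_ ?_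
  · exact isClosed_eq ((map_continuous (lift f h hc)).comp (map_continuous (A.inl B)))
      (map_continuous f)
  · intro a
    have := lift_preMul f h hc (a ⊗ₜ 1)
    rw [preMul, preLift_tmul, preLift_tmul] at this
    simpa using this

theorem lift_inr (f : A.Alg →⋆ₐ[ℂ] E) (h : B.Alg →⋆ₐ[ℂ] E)
    (hc : ∀ a b, Commute (f a) (h b)) (b : B.Alg) : lift f h hc (A.inr B b) = h b := by
  refine B.preAlg_dense.induction_on (p := fun b => lift f h hc (A.inr B b) = h b) b ?_ ?_
  · exact isClosed_eq ((map_continuous (lift f h hc)).comp (map_continuous (A.inr B)))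
      (map_continuous h)
  · intro b
    have := lift_preMul f h hc (1 ⊗ₜ b)
    rw [preMul, preLift_tmul, preLift_tmul] at this
    simpa using this

theorem stack_hom_ext {φ ψ : (A.stack B).Alg →⋆ₐ[ℂ] E} (hl : ∀ a, φ (A.inl B a) = ψ (A.inl B a))
    (hr : ∀ b, φ (A.inr B b) = ψ (A.inr B b)) : φ = ψ := by
  ext c
  refine denseRange_preMul.induction_on (p := fun c => φ c = ψ c) c ?_ ?_
  · exact isClosed_eq (map_continuous φ) (map_continuous ψ)
  · intro t
    induction t using TensorProduct.induction_on with
    | zero => rw [map_zero (A.preMul B), map_zero, map_zero]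
    | tmul a b => rw [preMul, preLift_tmul, map_mul, map_mul, hl, hr]
    | add a b ha hb => rw [map_add (A.preMul B), map_add, map_add, ha, hb]

end SpinChain

end

noncomputable section
open scoped TensorProduct CStarAlgebra

namespace SpinChain

variable {E : Type} [CStarAlgebra E] {A B : SpinChain}

theorem mem_closure_preimage_preAlg (A : SpinChain) {X : Set ℤ} {c : A.Alg} (hc : c ∈ A.sub X) :
    c ∈ closure (A.toOp ⁻¹' (A.preAlg X : Set A.Op)) := by
  have hsub : (A.preAlg X : Set A.Op) ⊆ (A.localAlg Set.univ : Set A.Op) := by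
    intro a ha
    obtain ⟨S, -, hS⟩ := A.mem_preAlg.1 ha
    exact StarSubalgebra.le_topologicalClosure _ (A.mem_preAlg.2 ⟨S, Set.subset_univ _, hS⟩)
  refine closure_subtype.2 ?_
  change c.1 ∈ closure (Subtype.val '' (Subtype.val ⁻¹' (A.preAlg X : Set A.Op)))
  have himg : (A.preAlg X : Set A.Op) ⊆
      Subtype.val '' {y : A.localAlg Set.univ | y.1 ∈ A.preAlg X} :=
    fun x hx => ⟨⟨x, hsub hx⟩, hx, rfl⟩
  exact closure_mono himg hc

theorem mem_of_forall_stack (f : (A.stack B).Alg →⋆ₐ[ℂ] E) (K : StarSubalgebra ℂ E)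
    (hK : IsClosed (K : Set E)) {X : Set ℤ} (hl : ∀ a ∈ A.sub X, f (A.inl B a) ∈ K)
    (hr : ∀ b ∈ B.sub X, f (A.inr B b) ∈ K) {c : (A.stack B).Alg} (hc : c ∈ (A.stack B).sub X) :
    f c ∈ K := by
  have hf : IsClosed (f ⁻¹' (K : Set E)) := hK.preimage (map_continuous f)
  refine closure_minimal ?_ hf ((A.stack B).mem_closure_preimage_preAlg hc)
  intro x hx
  obtain ⟨S, hS, T, hT⟩ := (A.stack B).mem_preAlg.1 hx
  obtain ⟨t, rfl⟩ := BOp.ampMul_surjective (A.unzipFin B S) T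
  have hx' : x = A.preMul B (A.fromFin₂ B S t) :=
    (A.stack B).toOp_injective (hT.symm.trans (A.preMul_fromFin₂ B S t).symm)
  clear hx hT
  subst hx'
  change f (A.preMul B (A.fromFin₂ B S t)) ∈ K
  induction t with
  | zero =>
    rw [map_zero (A.fromFin₂ B S), map_zero (A.preMul B), map_zero f]
    exact zero_mem K
  | tmul T U =>
    rw [fromFin₂_tmul, preMul, preLift_tmul, map_mul]
    refine mul_mem (hl _ ?_) (hr _ ?_)
    · exact StarSubalgebra.le_topologicalClosure _ (A.mem_preAlg.2 ⟨S, hS, T, rfl⟩)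
    · exact StarSubalgebra.le_topologicalClosure _ (B.mem_preAlg.2 ⟨S, hS, U, rfl⟩)
  | add a b ha hb =>
    rw [map_add (A.fromFin₂ B S), map_add (A.preMul B), map_add f]
    exact add_mem ha hb

theorem isClosed_sub (A : SpinChain) (X : Set ℤ) : IsClosed (A.sub X : Set A.Alg) :=
  (StarSubalgebra.isClosed_topologicalClosure (A.preAlg X)).preimage (map_continuous A.toOp)

theorem sub_mono (A : SpinChain) {X Y : Set ℤ} (h : X ⊆ Y) : A.sub X ≤ A.sub Y := by
  intro a ha
  refine StarSubalgebra.topologicalClosure_mono ?_ ha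
  intro x hx
  obtain ⟨S, hS, hx⟩ := A.mem_preAlg.1 hx
  exact A.mem_preAlg.2 ⟨S, hS.trans h, hx⟩

/-! ### Quantum cellular automata and symmetries -/

/-- The fattening `X^{(r)}` of a set of sites: all sites at distance at most `r` from `X`. -/
def fatten (X : Set ℤ) (r : ℕ) : Set ℤ := {j | ∃ i ∈ X, |j - i| ≤ r}

theorem fatten_mono (X : Set ℤ) {r s : ℕ} (h : r ≤ s) : fatten X r ⊆ fatten X s := by
  rintro j ⟨i, hi, hj⟩
  exact ⟨i, hi, hj.trans (by exact_mod_cast h)⟩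

/-- `α(𝒜_X) ⊆ 𝒜_{X^{(r)}}` for all `X ⊆ ℤ`: the `*`-automorphism `α` is a quantum cellular
automaton of range at most `r`. -/
def IsRangeLE (α : A.Alg ≃⋆ₐ[ℂ] A.Alg) (r : ℕ) : Prop :=
  ∀ X : Set ℤ, ∀ a ∈ A.sub X, α a ∈ A.sub (fatten X r)

/-- `α` is a quantum cellular automaton. -/
def IsQCA (α : A.Alg ≃⋆ₐ[ℂ] A.Alg) : Prop := ∃ r, IsRangeLE α r

/-- A locality preserving `G`-symmetry on the spin chain `A`: a homomorphism from `G` to the group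
of quantum cellular automata. -/
structure Symmetry (G : Type) [Group G] (A : SpinChain) where
  toHom : G →* (A.Alg ≃⋆ₐ[ℂ] A.Alg)
  isQCA : ∀ g, IsQCA (toHom g)

/-- The symmetry has range at most `R`. -/
def Symmetry.IsRangeLE {G : Type} [Group G] (α : Symmetry G A) (R : ℕ) : Prop :=
  ∀ g, SpinChain.IsRangeLE (α.toHom g) R

section StackSymmetry

variable {G : Type} [Group G]

/-- `φ ⊗ ψ` for `*`-endomorphisms `φ` and `ψ`. -/
def stackHom (φ : A.Alg →⋆ₐ[ℂ] A.Alg) (ψ : B.Alg →⋆ₐ[ℂ] B.Alg) :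
    (A.stack B).Alg →⋆ₐ[ℂ] (A.stack B).Alg :=
  lift ((A.inl B).comp φ) ((A.inr B).comp ψ) fun a b => A.inl_commute_inr B (φ a) (ψ b)

theorem stackHom_inl (φ : A.Alg →⋆ₐ[ℂ] A.Alg) (ψ : B.Alg →⋆ₐ[ℂ] B.Alg) (a : A.Alg) :
    stackHom φ ψ (A.inl B a) = A.inl B (φ a) := lift_inl _ _ _ a

theorem stackHom_inr (φ : A.Alg →⋆ₐ[ℂ] A.Alg) (ψ : B.Alg →⋆ₐ[ℂ] B.Alg) (b : B.Alg) :
    stackHom φ ψ (A.inr B b) = A.inr B (ψ b) := lift_inr _ _ _ b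

theorem stackHom_comp (φ φ' : A.Alg →⋆ₐ[ℂ] A.Alg) (ψ ψ' : B.Alg →⋆ₐ[ℂ] B.Alg) :
    (stackHom φ ψ).comp (stackHom φ' ψ') = stackHom (φ.comp φ') (ψ.comp ψ') := by
  refine stack_hom_ext (fun a => ?_) fun b => ?_
  · simp only [StarAlgHom.comp_apply, stackHom_inl]
  · simp only [StarAlgHom.comp_apply, stackHom_inr]

theorem stackHom_id :
    stackHom (StarAlgHom.id ℂ A.Alg) (StarAlgHom.id ℂ B.Alg) = StarAlgHom.id ℂ (A.stack B).Alg :=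
  stack_hom_ext (fun a => stackHom_inl _ _ a) fun b => stackHom_inr _ _ b

/-- A `*`-automorphism as a `*`-homomorphism. -/
def autHom (α : A.Alg ≃⋆ₐ[ℂ] A.Alg) : A.Alg →⋆ₐ[ℂ] A.Alg where
  toFun := α
  map_one' := map_one α
  map_mul' := map_mul α
  map_zero' := map_zero α
  map_add' := map_add α
  commutes' c := by
    rw [Algebra.algebraMap_eq_smul_one, map_smul, map_one]
  map_star' := map_star α

theorem autHom_apply (α : A.Alg ≃⋆ₐ[ℂ] A.Alg) (a : A.Alg) : autHom α a = α a := rfl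

/-- `α ⊗ β` for `*`-automorphisms `α` and `β`. -/
def stackAut (α : A.Alg ≃⋆ₐ[ℂ] A.Alg) (β : B.Alg ≃⋆ₐ[ℂ] B.Alg) :
    (A.stack B).Alg ≃⋆ₐ[ℂ] (A.stack B).Alg :=
  StarAlgEquiv.ofStarAlgHom (stackHom (autHom α) (autHom β))
    (stackHom (autHom α.symm) (autHom β.symm))
    (by
      rw [stackHom_comp, ← stackHom_id]
      congr 1 <;> ext x <;> simp [autHom_apply])
    (by
      rw [stackHom_comp, ← stackHom_id]
      congr 1 <;> ext x <;> simp [autHom_apply])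

theorem stackAut_apply (α : A.Alg ≃⋆ₐ[ℂ] A.Alg) (β : B.Alg ≃⋆ₐ[ℂ] B.Alg) (c : (A.stack B).Alg) :
    stackAut α β c = stackHom (autHom α) (autHom β) c := rfl

theorem stackAut_inl (α : A.Alg ≃⋆ₐ[ℂ] A.Alg) (β : B.Alg ≃⋆ₐ[ℂ] B.Alg) (a : A.Alg) :
    stackAut α β (A.inl B a) = A.inl B (α a) := stackHom_inl _ _ a

theorem stackAut_inr (α : A.Alg ≃⋆ₐ[ℂ] A.Alg) (β : B.Alg ≃⋆ₐ[ℂ] B.Alg) (b : B.Alg) :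
    stackAut α β (A.inr B b) = A.inr B (β b) := stackHom_inr _ _ b

theorem stackAut_mul (α α' : A.Alg ≃⋆ₐ[ℂ] A.Alg) (β β' : B.Alg ≃⋆ₐ[ℂ] B.Alg) :
    stackAut (α * α') (β * β') = stackAut α β * stackAut α' β' := by
  ext c
  exact (DFunLike.congr_fun (stackHom_comp (autHom α) (autHom α') (autHom β) (autHom β')) c).symm

theorem stackAut_one : stackAut (1 : A.Alg ≃⋆ₐ[ℂ] A.Alg) (1 : B.Alg ≃⋆ₐ[ℂ] B.Alg) = 1 := by
  ext c
  exact DFunLike.congr_fun (stackHom_id (A := A) (B := B)) c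

theorem IsQCA.stackAut {α : A.Alg ≃⋆ₐ[ℂ] A.Alg} {β : B.Alg ≃⋆ₐ[ℂ] B.Alg} (hα : IsQCA α)
    (hβ : IsQCA β) : IsQCA (stackAut α β) := by
  obtain ⟨r, hr⟩ := hα
  obtain ⟨s, hs⟩ := hβ
  refine ⟨max r s, fun X c hc => ?_⟩
  rw [stackAut_apply]
  refine mem_of_forall_stack _ _ ((A.stack B).isClosed_sub _) (fun a ha => ?_) (fun b hb => ?_) hc
  · rw [stackHom_inl]
    exact A.inl_mem B (A.sub_mono (fatten_mono X (le_max_left r s)) (hr X a ha))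
  · rw [stackHom_inr]
    exact A.inr_mem B (B.sub_mono (fatten_mono X (le_max_right r s)) (hs X b hb))

/-- The stack `α ⊗ β` of two symmetries. -/
def Symmetry.stack (α : Symmetry G A) (β : Symmetry G B) : Symmetry G (A.stack B) where
  toHom :=
    { toFun := fun g => stackAut (α.toHom g) (β.toHom g)
      map_one' := by rw [map_one, map_one, stackAut_one]
      map_mul' := fun g h => by rw [map_mul, map_mul, stackAut_mul] }
  isQCA g := (α.isQCA g).stackAut (β.isQCA g)

end StackSymmetry

/-! ### Block-partitioned automorphisms and circuits -/

/-- A partition of `ℤ` into intervals of bounded size. -/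
structure IsBlockPartition (I : ℤ → Set ℤ) : Prop where
  ordConnected : ∀ a, (I a).OrdConnected
  existsUnique : ∀ j, ∃! a, j ∈ I a
  bounded : ∃ N : ℕ, ∀ a, (I a).encard ≤ N

/-- `β = ⨂_a Ad(U_a)` for unitaries `U_a ∈ 𝒜_{I_a}`. -/
def IsBlockProduct (I : ℤ → Set ℤ) (β : A.Alg ≃⋆ₐ[ℂ] A.Alg) : Prop :=
  ∃ U : ℤ → unitary A.Alg, ∀ a, (U a : A.Alg) ∈ A.sub (I a) ∧
    ∀ x ∈ A.sub (I a), β x = Unitary.conjStarAlgAut ℂ A.Alg (U a) x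

/-- `β` is a block-partitioned quantum cellular automaton. -/
def IsBlockPartitioned (β : A.Alg ≃⋆ₐ[ℂ] A.Alg) : Prop :=
  ∃ I, IsBlockPartition I ∧ IsBlockProduct I β

/-- A finite depth quantum circuit: a composition of finitely many block-partitioned quantum
cellular automata. -/
def IsFDQC (γ : A.Alg ≃⋆ₐ[ℂ] A.Alg) : Prop :=
  γ ∈ Submonoid.closure {β : A.Alg ≃⋆ₐ[ℂ] A.Alg | IsBlockPartitioned β}

/-- A symmetry is decoupled if all its components are block-partitioned, with blocks that do not
depend on the group element. -/
def Symmetry.IsDecoupled {G : Type} [Group G] (α : Symmetry G A) : Prop :=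
  ∃ I, IsBlockPartition I ∧ ∀ g, IsBlockProduct I (α.toHom g)

/-- An identification of two spin chains: a `*`-isomorphism which maps the on-site algebras onto the
on-site algebras. -/
def IsSitewise (φ : A.Alg ≃⋆ₐ[ℂ] B.Alg) : Prop :=
  ∀ j : ℤ, ∀ a : A.Alg, φ a ∈ B.sub {j} ↔ a ∈ A.sub {j}


variable {G : Type} [Group G]

/-- Two symmetries are equivalent if, after an identification `φ` of their spin chains, one is the
conjugate of the other by a finite depth quantum circuit. -/
def Symmetry.Equivalent (α' : Symmetry G A) (α : Symmetry G B) : Prop :=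
  ∃ φ : A.Alg ≃⋆ₐ[ℂ] B.Alg, IsSitewise φ ∧ ∃ γ : B.Alg ≃⋆ₐ[ℂ] B.Alg, IsFDQC γ ∧
    ∀ g a, φ (α'.toHom g a) = (γ⁻¹ * α.toHom g * γ) (φ a)

/-- Two symmetries are stably equivalent if they become equivalent after stacking with symmetries
of range `0`. -/
def Symmetry.StablyEquivalent (α : Symmetry G A) (α' : Symmetry G B) : Prop :=
  ∃ (C C' : SpinChain) (β : Symmetry G C) (β' : Symmetry G C'), β.IsRangeLE 0 ∧ β'.IsRangeLE 0 ∧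
    (α.stack β).Equivalent (α'.stack β')

/-! ### Right restrictions and crossing operators -/

/-- The family `ρ` is a right restriction of `α` at the site `j` with defect size `L`. -/
structure IsRightRestriction (α : Symmetry G A) (j : ℤ) (L : ℕ)
    (ρ : G → (A.Alg ≃⋆ₐ[ℂ] A.Alg)) : Prop where
  right : ∀ g, ∀ a ∈ A.sub (Set.Ici (j + L)), ρ g a = α.toHom g a
  left : ∀ g, ∀ a ∈ A.sub (Set.Iio (j - L)), ρ g a = a

/-- The local unitaries `C g k` are crossing operators for the family `ρ`. -/
structure IsCrossing (α : Symmetry G A) (ρ : G → (A.Alg ≃⋆ₐ[ℂ] A.Alg))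
    (C : G → G → unitary A.Alg) : Prop where
  isLocal : ∀ g k, ∃ S : Finset ℤ, (C g k : A.Alg) ∈ A.sub S
  conj : ∀ g k, α.toHom k * ρ (k⁻¹ * g * k) * α.toHom k⁻¹ * (ρ g)⁻¹ =
    Unitary.conjStarAlgAut ℂ A.Alg (C g k)

end SpinChain

/-! ### Cohomology with coefficients in `U(1)[G]` -/

/-- The `G`-module `U(1)[G]`: the group of maps `G → U(1)`, with the action
`(k • f) g = f (k⁻¹ * g * k)`. -/
def TwistedCircle (G : Type) : Type := G → Circle

namespace TwistedCircle

variable {G : Type}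

instance : CommGroup (TwistedCircle G) := inferInstanceAs (CommGroup (G → Circle))

instance [Group G] : MulDistribMulAction G (TwistedCircle G) where
  smul k f := fun g => f (k⁻¹ * g * k)
  one_smul f := funext fun g => congrArg f (by group)
  mul_smul k l f := funext fun g => congrArg f (by group)
  smul_mul _ _ _ := rfl
  smul_one _ := rfl

theorem smul_apply [Group G] (k : G) (f : TwistedCircle G) (g : G) :
    (k • f) g = f (k⁻¹ * g * k) := rfl

/-- The second cohomology group `H²(G, U(1)[G])`, written additively. -/
abbrev H2 (G : Type) [Group G] : Type :=
  groupCohomology.H2 (Rep.ofMulDistribMulAction G (TwistedCircle G))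

/-- The cohomology class of a `2`-cocycle. -/
def mk [Group G] (c : G × G → TwistedCircle G) (hc : groupCohomology.IsMulCocycle₂ c) : H2 G :=
  groupCohomology.H2π (Rep.ofMulDistribMulAction G (TwistedCircle G))
    (groupCohomology.cocyclesOfIsMulCocycle₂ hc)

end TwistedCircle

namespace SpinChain

variable {A : SpinChain} {G : Type} [Group G]

/-- The phases `c (k, l) g = λ_g(k, l)` of a family of crossing operators. -/
def IsPhases (α : Symmetry G A) (C : G → G → unitary A.Alg) (c : G × G → TwistedCircle G) : Prop :=
  ∀ g k l, α.toHom k (C (k⁻¹ * g * k) l : A.Alg) * (C g k : A.Alg) =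
    ((c (k, l) g : Circle) : ℂ) • (C g (k * l) : A.Alg)

end SpinChain

/-- The `G`-symmetries on arbitrary spin chains. -/
structure SymG (G : Type) [Group G] : Type 1 where
  chain : SpinChain
  sym : SpinChain.Symmetry G chain

namespace SymG

variable {G : Type} [Group G]

/-- Stacking of symmetries. -/
def stack (α β : SymG G) : SymG G := ⟨α.chain.stack β.chain, α.sym.stack β.sym⟩

/-- Stable equivalence of symmetries. -/
def StablyEquivalent (α β : SymG G) : Prop := α.sym.StablyEquivalent β.sym

end SymG
end

/-! The only real obstacle is the existence of right restrictions. Let α^(g) have range at most R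
and cut the chain at m. The algebra α^(g)(𝒜_{≥m}) lies between 𝒜_{≥m+R} and 𝒜_{≥m-R}, so it is
generated by 𝒜_{≥m+R} and its part in the window [m-R, m+R). By Haag duality (`mem_sub_diff`) this
boundary algebra is a finite dimensional factor, so it is a full matrix algebra of some size n(g)
(`exists_boundary_units`). Let D be the dimension of the Hilbert space of the R sites [m, m+R).
Counting dimensions shows that n(g)/D, the index of the automaton, is multiplicative in g. A
homomorphism from a finite group to the positive rationals is trivial, so n(g) = D
(`exists_boundary_units_card`). Two systems of matrix units of the same size in the window are
conjugate by a unitary u_g of the window, and Ad[u_g] ∘ α^(g) then preserves 𝒜_{≥m}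
(`exists_unitary_preserving`). Gluing it with the identity on 𝒜_{<m} gives a restriction
(`exists_glue`, `IsCut.exists_restriction`).

The rest follows from two facts. An automorphism which is trivial outside of a finite set is
conjugation by a local unitary (`exists_conj_of_eq_id`), which gives crossing operators. Two
unitaries with the same conjugation differ by a phase, because the centre of 𝒜 is trivial
(`exists_phase`), which gives the phases λ. The cocycle equation comes from evaluating a threefold
product of crossing operators in two ways (`IsPhases.cocycle`). Other crossing operators change λ by
a coboundary (`IsCrossing.mk_eq`). Another restriction differs by local unitaries V_g, and these can
be absorbed into the crossing operators without any change of λ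
(`IsRightRestriction.exists_phases_eq`). Hence the class is an invariant of α, called `anomaly`.

The numbered properties use convenient choices of the data. For a decoupled symmetry, a cut between
blocks admits trivial crossing operators. If α and β agree on a long interval, one decoupling
unitary serves both, and the crossing operators and phases coincide. For stacks, tensor products of
all data work. Equivalences are locality preserving isomorphisms and transport the data; symmetries
of range 0 are decoupled, so stable equivalence does not change the class. The monoid structure
needs only that stacking is commutative and associative up to sitewise isomorphisms, and that
circuits are stable under inverses, stacking and such isomorphisms. -/

set_option linter.unusedSectionVars false

/-! ### Matrix units in a `*`-algebra and the expansion over their commutant. -/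

noncomputable section

/-- A system of matrix units, indexed by `X`, in a `*`-algebra. -/
structure IsMatrixUnits {X A : Type} [Fintype X] [Ring A] [StarRing A] (e : X → X → A) : Prop where
  mul_same : ∀ x y z, e x y * e y z = e x z
  mul_ne : ∀ x y z w, y ≠ z → e x y * e z w = 0
  protected star : ∀ x y, star (e x y) = e y x
  sum : ∑ x, e x x = 1

namespace IsMatrixUnits

section Algebra

variable {X A A' : Type} [Fintype X] [Ring A] [StarRing A] [Algebra ℂ A]
  [Ring A'] [StarRing A'] [Algebra ℂ A'] {e : X → X → A}

theorem map (he : IsMatrixUnits e) {F : Type} [FunLike F A A'] [AlgHomClass F ℂ A A']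
    [StarHomClass F A A'] (f : F) : IsMatrixUnits fun x y => f (e x y) where
  mul_same x y z := by rw [← map_mul, he.mul_same]
  mul_ne x y z w h := by rw [← map_mul, he.mul_ne x y z w h, map_zero]
  star x y := by rw [← map_star, he.star]
  sum := by rw [← map_sum, he.sum, map_one]

theorem of_map (f : A →⋆ₐ[ℂ] A') (hf : Function.Injective f)
    (he : IsMatrixUnits fun x y => f (e x y)) : IsMatrixUnits e where
  mul_same x y z := hf (by rw [map_mul]; exact he.mul_same x y z)
  mul_ne x y z w h := hf (by rw [map_mul, map_zero]; exact he.mul_ne x y z w h)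
  star x y := hf (by rw [map_star]; exact he.star x y)
  sum := hf (by rw [map_sum, map_one]; exact he.sum)

/-- The coefficient `∑_z e_{zx} r e_{yz}` of `r` at `e_{xy}`, an element of the commutant of the
matrix units. -/
def coeff (e : X → X → A) (x y : X) : A →ₗ[ℂ] A where
  toFun r := ∑ z, e z x * r * e y z
  map_add' r s := by simp only [mul_add, add_mul, Finset.sum_add_distrib]
  map_smul' c r := by
    simp only [mul_smul_comm, smul_mul_assoc, Finset.smul_sum, RingHom.id_apply]

theorem coeff_apply (x y : X) (r : A) : coeff e x y r = ∑ z, e z x * r * e y z := rfl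

/-- Only the summand z = v survives. In `coeff_mul` only z = u does, and the same expression
results; this is why coefficients lie in the commutant. -/
theorem mul_coeff (he : IsMatrixUnits e) (x y u v : X) (r : A) :
    e u v * coeff e x y r = e u x * r * e y v := by
  classical
  rw [coeff_apply, Finset.mul_sum, Finset.sum_eq_single v]
  · rw [← mul_assoc, ← mul_assoc, he.mul_same]
  · intro z _ hz
    rw [← mul_assoc, ← mul_assoc, he.mul_ne _ _ _ _ hz.symm, zero_mul, zero_mul]
  · simp

theorem coeff_mul (he : IsMatrixUnits e) (x y u v : X) (r : A) :
    coeff e x y r * e u v = e u x * r * e y v := by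
  classical
  rw [coeff_apply, Finset.sum_mul, Finset.sum_eq_single u]
  · rw [mul_assoc, mul_assoc, mul_assoc, he.mul_same]
  · intro z _ hz
    rw [mul_assoc, he.mul_ne _ _ _ _ hz, mul_zero]
  · simp

theorem commute_coeff (he : IsMatrixUnits e) (x y u v : X) (r : A) :
    Commute (e u v) (coeff e x y r) :=
  (he.mul_coeff x y u v r).trans (he.coeff_mul x y u v r).symm

/-- By `mul_coeff` the summands are e_{xx} r e_{yy}, and the diagonal units sum to 1 on either side.
-/
theorem sum_mul_coeff (he : IsMatrixUnits e) (r : A) :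
    ∑ x, ∑ y, e x y * coeff e x y r = r := by
  simp only [he.mul_coeff, ← Finset.mul_sum, mul_assoc, he.sum, mul_one]
  rw [← Finset.sum_mul, he.sum, one_mul]

theorem coeff_mul_of_commute (x y : X) (r c : A) (hc : ∀ x y, Commute (e x y) c) :
    coeff e x y (r * c) = coeff e x y r * c := by
  rw [coeff_apply, coeff_apply, Finset.sum_mul]
  refine Finset.sum_congr rfl fun z _ => ?_
  rw [← mul_assoc, mul_assoc _ c, ← (hc y z).eq, ← mul_assoc]

theorem coeff_self (he : IsMatrixUnits e) (x y : X) : coeff e x y (e x y) = 1 := by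
  simp only [coeff_apply, he.mul_same, he.sum]

theorem coeff_ne (he : IsMatrixUnits e) (x y u v : X) (h : (u, v) ≠ (x, y)) :
    coeff e x y (e u v) = 0 := by
  rw [coeff_apply]
  refine Finset.sum_eq_zero fun z _ => ?_
  by_cases hu : x = u
  · have hv : v ≠ y := fun hv => h (by rw [hu, hv])
    rw [mul_assoc, he.mul_ne _ _ _ _ hv, mul_zero]
  · rw [he.mul_ne _ _ _ _ hu, zero_mul]

/-- Uniqueness of the expansion: the coefficient maps are linear over the commutant and dual to the
matrix units. -/
theorem coeff_sum (he : IsMatrixUnits e) (c : X → X → A)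
    (hc : ∀ x y u v, Commute (e u v) (c x y)) (x y : X) :
    coeff e x y (∑ u, ∑ v, e u v * c u v) = c x y := by
  classical
  rw [← Fintype.sum_prod_type' (f := fun u v => e u v * c u v), map_sum,
    Finset.sum_eq_single (x, y)]
  · rw [coeff_mul_of_commute _ _ _ _ (hc x y), he.coeff_self, one_mul]
  · intro p _ hp
    rw [coeff_mul_of_commute _ _ _ _ (hc p.1 p.2), he.coeff_ne x y p.1 p.2 hp, zero_mul]
  · simp

theorem coeff_of_commute (he : IsMatrixUnits e) (x : X) (r : A)
    (hr : ∀ x y, Commute (e x y) r) : coeff e x x r = r := by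
  have : coeff e x x 1 = 1 := by simp only [coeff_apply, mul_one, he.mul_same, he.sum]
  rw [← one_mul r, coeff_mul_of_commute _ _ _ _ hr, this]

variable [StarModule ℂ A]

theorem coeff_mem {R : StarSubalgebra ℂ A} (hR : ∀ x y, e x y ∈ R) (x y : X) {r : A} (hr : r ∈ R) :
    coeff e x y r ∈ R :=
  sum_mem fun z _ => mul_mem (mul_mem (hR z x) hr) (hR y z)

/-- If `R` contains the matrix units, then `R ≃ M_X(C)` for the relative commutant `C`. -/
def decomp (he : IsMatrixUnits e) {R C : StarSubalgebra ℂ A} (hR : ∀ x y, e x y ∈ R)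
    (hC : ∀ a, a ∈ C ↔ a ∈ R ∧ ∀ x y, Commute (e x y) a) : R ≃ₗ[ℂ] (X × X → C) where
  toFun r p := ⟨coeff e p.1 p.2 r, (hC _).2 ⟨coeff_mem hR _ _ r.2,
    fun _ _ => he.commute_coeff _ _ _ _ _⟩⟩
  map_add' r s := funext fun p => Subtype.ext (map_add (coeff e p.1 p.2) r.1 s.1)
  map_smul' c r := funext fun p => Subtype.ext (map_smul (coeff e p.1 p.2) c r.1)
  invFun c := ⟨∑ x, ∑ y, e x y * (c (x, y)).1, sum_mem fun x _ => sum_mem fun y _ =>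
    mul_mem (hR x y) ((hC _).1 (c (x, y)).2).1⟩
  left_inv r := Subtype.ext (he.sum_mul_coeff r.1)
  right_inv c := funext fun p => Subtype.ext
    (he.coeff_sum (fun x y => (c (x, y)).1) (fun x y => ((hC _).1 (c (x, y)).2).2) p.1 p.2)

/-- The counting formula behind the index: one algebra is measured with respect to different systems
of matrix units, and the results are compared. -/
theorem finrank_eq (he : IsMatrixUnits e) {R C : StarSubalgebra ℂ A} (hR : ∀ x y, e x y ∈ R)
    (hC : ∀ a, a ∈ C ↔ a ∈ R ∧ ∀ x y, Commute (e x y) a) [FiniteDimensional ℂ C] :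
    Module.finrank ℂ R = Fintype.card X ^ 2 * Module.finrank ℂ C := by
  rw [(he.decomp hR hC).finrank_eq, Module.finrank_pi_fintype]
  simp [sq]

/-- The star subalgebra spanned by matrix units. -/
def Spans (e : X → X → A) (B : StarSubalgebra ℂ A) : Prop :=
  ∀ b, b ∈ B ↔ ∃ c : X → X → ℂ, b = ∑ x, ∑ y, c x y • e x y

theorem Spans.mem {B : StarSubalgebra ℂ A} (hB : Spans e B) (x y : X) : e x y ∈ B := by
  classical
  refine (hB _).2 ⟨fun u v => if u = x ∧ v = y then 1 else 0, ?_⟩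
  rw [Finset.sum_eq_single x, Finset.sum_eq_single y]
  · simp
  · intro b _ hb
    simp [hb]
  · simp
  · intro b _ hb
    simp [hb]
  · simp

theorem Spans.commute {B : StarSubalgebra ℂ A} (hB : Spans e B) {a : A}
    (ha : ∀ x y, Commute (e x y) a) {b : A} (hb : b ∈ B) : Commute b a := by
  obtain ⟨c, rfl⟩ := (hB b).1 hb
  exact Commute.sum_left _ _ _ fun x _ => Commute.sum_left _ _ _ fun y _ =>
    (ha x y).smul_left (c x y)

/-- The diagonal coefficient of an element of the commutant is the element itself, while for an
element of the span it is a scalar. -/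
theorem Spans.exists_scalar [Nonempty X] (he : IsMatrixUnits e) {B : StarSubalgebra ℂ A}
    (hB : Spans e B) {b : A} (hb : b ∈ B) (hc : ∀ x y, Commute (e x y) b) :
    ∃ c : ℂ, b = c • (1 : A) := by
  obtain ⟨c, h⟩ := (hB b).1 hb
  obtain ⟨x⟩ := ‹Nonempty X›
  refine ⟨c x x, ?_⟩
  have h1 := he.coeff_of_commute x b hc
  have h2 := he.coeff_sum (fun x y => c x y • 1) (fun x y u v => (Commute.one_right _).smul_right _)
    x x
  simp only [mul_smul_comm, mul_one] at h2
  rw [← h1, ← h2, ← h]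

theorem Spans.finrank [Nonempty X] [Nontrivial A] (he : IsMatrixUnits e) {B : StarSubalgebra ℂ A}
    (hB : Spans e B) : Module.finrank ℂ B = Fintype.card X ^ 2 := by
  have hC : ∀ a, a ∈ (⊥ : StarSubalgebra ℂ A) ↔ a ∈ B ∧ ∀ x y, Commute (e x y) a := by
    intro a
    rw [StarSubalgebra.mem_bot]
    constructor
    · rintro ⟨c, rfl⟩
      exact ⟨algebraMap_mem B c, fun x y => (Algebra.commutes c (e x y)).symm⟩
    · rintro ⟨h1, h2⟩
      obtain ⟨c, rfl⟩ := hB.exists_scalar he h1 h2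
      exact ⟨c, Algebra.algebraMap_eq_smul_one c⟩
  let φ : ℂ ≃ₗ[ℂ] (⊥ : StarSubalgebra ℂ A) := LinearEquiv.ofBijective
    (Algebra.linearMap ℂ (⊥ : StarSubalgebra ℂ A)) ⟨fun a b hab => by
      have := congrArg Subtype.val hab
      exact (algebraMap ℂ A).injective this, fun a => by
      obtain ⟨c, hc⟩ := StarSubalgebra.mem_bot.1 a.2
      exact ⟨c, Subtype.ext hc⟩⟩
  have : FiniteDimensional ℂ (⊥ : StarSubalgebra ℂ A) := φ.finiteDimensional
  rw [he.finrank_eq (fun x y => hB.mem x y) hC, ← φ.finrank_eq]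
  simp

theorem Spans.map {B : StarSubalgebra ℂ A} (hB : Spans e B) [StarModule ℂ A'] (f : A →⋆ₐ[ℂ] A') :
    Spans (fun x y => f (e x y)) (B.map f) := by
  intro b
  rw [StarSubalgebra.mem_map]
  constructor
  · rintro ⟨a, ha, rfl⟩
    obtain ⟨c, rfl⟩ := (hB a).1 ha
    exact ⟨c, by simp⟩
  · rintro ⟨c, rfl⟩
    exact ⟨∑ x, ∑ y, c x y • e x y, (hB _).2 ⟨c, rfl⟩, by simp⟩

theorem Spans.finiteDimensional {B : StarSubalgebra ℂ A} (hB : Spans e B) :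
    FiniteDimensional ℂ B := by
  let f : (X × X → ℂ) →ₗ[ℂ] B := Fintype.linearCombination ℂ
    fun p : X × X => (⟨e p.1 p.2, hB.mem p.1 p.2⟩ : B)
  refine Module.Finite.of_surjective f fun b => ?_
  obtain ⟨c, hc⟩ := (hB b.1).1 b.2
  refine ⟨fun p => c p.1 p.2, Subtype.ext ?_⟩
  rw [hc, ← Fintype.sum_prod_type' (f := fun u v => c u v • e u v)]
  simp [f, Fintype.linearCombination_apply]

end Algebra

section CStar

variable {X A : Type} [Fintype X] [CStarAlgebra A] {e : X → X → A}

/-- Compression by a minimal projection is isometric on the commutant of matrix units. -/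
theorem norm_mul_of_commute (he : IsMatrixUnits e) (x : X) {c : A}
    (hc : ∀ x y, Commute (e x y) c) : ‖c * e x x‖ = ‖c‖ := by
  let S : Set A := Set.range fun p : X × X => e p.1 p.2
  let C : StarSubalgebra ℂ A := StarSubalgebra.centralizer ℂ S
  have hS : ∀ {a : A}, a ∈ C ↔ ∀ x y, Commute (e x y) a := by
    intro a
    rw [StarSubalgebra.mem_centralizer_iff]
    constructor
    · intro h x y
      exact (h _ ⟨(x, y), rfl⟩).1
    · rintro h _ ⟨⟨x, y⟩, rfl⟩
      exact ⟨h x y, by rw [he.star]; exact h y x⟩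
  -- Closedness makes the commutant a C*-algebra, as needed for the isometry of injective
  -- `*`-homomorphisms.
  have : IsClosed (C : Set A) := by
    have : (C : Set A) = ⋂ x, ⋂ y, {a | e x y * a = a * e x y} := by
      ext a
      rw [SetLike.mem_coe, hS]
      simp only [Set.mem_iInter]
      rfl
    rw [this]
    exact isClosed_iInter fun x => isClosed_iInter fun y =>
      isClosed_eq (by fun_prop) (by fun_prop)
  let f : C →⋆ₙₐ[ℂ] A :=
    { toFun := fun a => a.1 * e x x
      map_smul' := fun k a => smul_mul_assoc k a.1 (e x x)
      map_zero' := zero_mul _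
      map_add' := fun a b => add_mul a.1 b.1 (e x x)
      map_mul' := fun a b => by
        change a.1 * b.1 * e x x = a.1 * e x x * (b.1 * e x x)
        rw [mul_assoc a.1 (e x x), ← mul_assoc (e x x) b.1, (hS.1 b.2 x x).eq, mul_assoc b.1,
          he.mul_same, mul_assoc]
      map_star' := fun a => by
        change star a.1 * e x x = star (a.1 * e x x)
        rw [star_mul, he.star]
        exact ((hS.1 (star_mem a.2)) x x).eq.symm }
  -- If a e_{xx} = 0, then a e_{zz} = e_{zx} (a e_{xx}) e_{xz} = 0 for all z, and these sum to a.
  have hf : Function.Injective f := by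
    rw [injective_iff_map_eq_zero]
    intro a ha
    replace ha : a.1 * e x x = 0 := ha
    refine Subtype.ext ?_
    rw [← mul_one a.1, ← he.sum, Finset.mul_sum]
    refine Finset.sum_eq_zero fun z _ => ?_
    rw [← he.mul_same z x z, ← mul_assoc, ← he.mul_same z x x, ← mul_assoc,
      ← (hS.1 a.2 z x).eq, mul_assoc (e z x), ha, mul_zero, zero_mul]
  exact NonUnitalStarAlgHom.norm_map f hf ⟨c, hS.2 hc⟩

theorem norm_unit_le (he : IsMatrixUnits e) (x : X) : ‖e x x‖ ≤ 1 := by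
  have h : IsStarProjection (e x x) := ⟨he.mul_same x x x, he.star x x⟩
  have h2 : ‖e x x‖ = ‖e x x‖ * ‖e x x‖ := by
    conv_lhs => rw [← he.mul_same x x x]
    conv_lhs => rw [← he.star x x]
    rw [← CStarRing.norm_star_mul_self, he.star]
  nlinarith [norm_nonneg (e x x)]

/-- Together with `coeff_of_commute` this makes a diagonal coefficient a norm one projection onto
the commutant, by which approximations are pushed into the commutant. -/
theorem norm_coeff_le (he : IsMatrixUnits e) (x : X) (a : A) : ‖coeff e x x a‖ ≤ ‖a‖ := by
  rw [← he.norm_mul_of_commute x fun u v => he.commute_coeff x x u v a, he.coeff_mul]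
  calc ‖e x x * a * e x x‖ ≤ ‖e x x‖ * ‖a‖ * ‖e x x‖ :=
        (norm_mul_le _ _).trans (mul_le_mul_of_nonneg_right (norm_mul_le _ _) (norm_nonneg _))
    _ ≤ 1 * ‖a‖ * 1 := by
        gcongr <;> exact he.norm_unit_le x
    _ = ‖a‖ := by ring

end CStar

end IsMatrixUnits

end

/-! ### Matrix units and factors on a finite dimensional Hilbert space. -/

noncomputable section

namespace IsMatrixUnits

variable {H : Type} [NormedAddCommGroup H] [InnerProductSpace ℂ H] [CompleteSpace H]

theorem isStarProjection {X A : Type} [Fintype X] [Ring A] [StarRing A] {e : X → X → A}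
    (he : IsMatrixUnits e) (x : X) : IsStarProjection (e x x) :=
  ⟨he.mul_same x x x, he.star x x⟩

theorem exists_partialIsometry [FiniteDimensional ℂ H] {p q : H →L[ℂ] H} (hp : IsStarProjection p)
    (hq : IsStarProjection q)
    (h : Module.finrank ℂ p.range = Module.finrank ℂ q.range) :
    ∃ w : H →L[ℂ] H, star w * w = p ∧ w * star w = q := by
  obtain ⟨_, hp'⟩ := isStarProjection_iff_eq_starProjection_range.1 hp
  obtain ⟨_, hq'⟩ := isStarProjection_iff_eq_starProjection_range.1 hq
  let i : p.range ≃ₗᵢ[ℂ] q.range :=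
    (stdOrthonormalBasis ℂ p.range).equiv (stdOrthonormalBasis ℂ q.range) (finCongr h)
  let j : p.range →L[ℂ] q.range := i.toContinuousLinearEquiv
  let j' : q.range →L[ℂ] p.range := i.symm.toContinuousLinearEquiv
  have hj : ContinuousLinearMap.adjoint j = j' := by
    symm
    rw [ContinuousLinearMap.eq_adjoint_iff]
    intro x y
    change inner ℂ (i.symm x) y = inner ℂ x (i y)
    rw [← i.inner_map_map, i.apply_symm_apply]
  let w : H →L[ℂ] H := q.range.subtypeL ∘L j ∘L p.range.orthogonalProjectionOnto
  have hw : star w = p.range.subtypeL ∘L j' ∘L q.range.orthogonalProjectionOnto := by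
    rw [ContinuousLinearMap.star_eq_adjoint]
    simp only [w, ContinuousLinearMap.adjoint_comp, Submodule.adjoint_subtypeL,
      Submodule.adjoint_orthogonalProjectionOnto, hj]
    rfl
  refine ⟨w, ?_, ?_⟩
  · refine Eq.trans ?_ hp'.symm
    rw [hw]
    ext x
    simp [w, j, j']
  · refine Eq.trans ?_ hq'.symm
    rw [hw]
    ext x
    simp [w, j, j']

theorem trace_eq {X : Type} [Fintype X] {e : X → X → H →L[ℂ] H} (he : IsMatrixUnits e) (x y : X) :
    LinearMap.trace ℂ H (e x x).toLinearMap = LinearMap.trace ℂ H (e y y).toLinearMap := by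
  rw [← he.mul_same x y x, ← he.mul_same y x y]
  exact LinearMap.trace_mul_comm ℂ (e x y).toLinearMap (e y x).toLinearMap

/-- All diagonal projections have the same trace, since e_{xy} e_{yx} and e_{yx} e_{xy} do, and
their traces add up to dim H. So the rank depends only on the number of units. -/
theorem card_mul_finrank [FiniteDimensional ℂ H] {X : Type} [Fintype X] {e : X → X → H →L[ℂ] H}
    (he : IsMatrixUnits e) (x : X) :
    Fintype.card X * Module.finrank ℂ (e x x).range = Module.finrank ℂ H := by
  have h1 : ∀ y, LinearMap.trace ℂ H (e y y).toLinearMap = Module.finrank ℂ (e x x).range := by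
    intro y
    rw [he.trace_eq y x]
    refine (LinearMap.IsIdempotentElem.isProj_range _ ?_).trace
    exact congrArg ContinuousLinearMap.toLinearMap (he.mul_same x x x)
  have h2 : ∑ y, LinearMap.trace ℂ H (e y y).toLinearMap = Module.finrank ℂ H := by
    rw [← map_sum, ← LinearMap.trace_one ℂ H]
    congr 1
    ext v
    have := congrArg (fun T : H →L[ℂ] H => T v) he.sum
    simpa using this
  simp only [h1, Finset.sum_const, Finset.card_univ, nsmul_eq_mul] at h2
  exact_mod_cast h2

/-- Two systems of matrix units of the same size in a finite dimensional full operator algebra are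
unitarily equivalent. -/
theorem exists_unitary [FiniteDimensional ℂ H] {X : Type} [Fintype X] [Nonempty X]
    {e f : X → X → H →L[ℂ] H} (he : IsMatrixUnits e) (hf : IsMatrixUnits f) :
    ∃ u ∈ unitary (H →L[ℂ] H), ∀ x y, u * e x y = f x y * u := by
  classical
  obtain ⟨o⟩ := ‹Nonempty X›
  have hr : Module.finrank ℂ (e o o).range = Module.finrank ℂ (f o o).range := by
    have h1 := he.card_mul_finrank o
    rw [← hf.card_mul_finrank o] at h1
    exact Nat.eq_of_mul_eq_mul_left (Fintype.card_pos_iff.2 ⟨o⟩) h1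
  obtain ⟨w, hw, hw'⟩ := exists_partialIsometry (he.isStarProjection o) (hf.isStarProjection o) hr
  -- The intertwiner is u = ∑ f_{xo} w e_{ox}, where w identifies the two corners at o. This is star
  -- u * u = 1; exchanging e with f and w with star w turns it into u * star u = 1.
  have key : ∀ {e f : X → X → H →L[ℂ] H} {w : H →L[ℂ] H}, IsMatrixUnits e → IsMatrixUnits f →
      star w * w = e o o → w * star w = f o o →
      (∑ x, e x o * star w * f o x) * (∑ x, f x o * w * e o x) = 1 := by
    intro e f w he hf hw hw'
    rw [Finset.sum_mul_sum, ← he.sum]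
    refine Finset.sum_congr rfl fun x _ => ?_
    rw [Finset.sum_eq_single x]
    · calc e x o * star w * f o x * (f x o * w * e o x)
          = e x o * star w * (f o x * f x o) * w * e o x := by noncomm_ring
        _ = e x o * (star w * w) * (star w * w) * e o x := by
          rw [hf.mul_same, ← hw']; noncomm_ring
        _ = e x x := by rw [hw, he.mul_same, he.mul_same, he.mul_same]
    · intro y _ hy
      calc e x o * star w * f o x * (f y o * w * e o y)
          = e x o * star w * (f o x * f y o) * w * e o y := by noncomm_ring
        _ = 0 := by rw [hf.mul_ne _ _ _ _ hy.symm]; noncomm_ring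
    · simp
  have hs : star (∑ x, f x o * w * e o x) = ∑ x, e x o * star w * f o x := by
    rw [star_sum]
    refine Finset.sum_congr rfl fun x _ => ?_
    rw [star_mul, star_mul, he.star, hf.star, mul_assoc]
  refine ⟨∑ x, f x o * w * e o x, ⟨?_, ?_⟩, fun x y => ?_⟩
  · rw [hs]
    exact key he hf hw hw'
  · rw [hs]
    have := key hf he (w := star w) (by rw [star_star, hw']) (by rw [star_star, hw])
    rwa [star_star] at this
  · rw [Finset.sum_mul, Finset.mul_sum, Finset.sum_eq_single x, Finset.sum_eq_single y]
    · rw [mul_assoc, he.mul_same, mul_assoc (f y o), ← mul_assoc, hf.mul_same, mul_assoc]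
    · intro z _ hz
      rw [← mul_assoc, ← mul_assoc, hf.mul_ne _ _ _ _ hz.symm, zero_mul, zero_mul]
    · simp
    · intro z _ hz
      rw [mul_assoc, he.mul_ne _ _ _ _ hz, mul_zero]
    · simp

end IsMatrixUnits

section Factor

variable {H : Type} [NormedAddCommGroup H] [InnerProductSpace ℂ H] [CompleteSpace H]
  [FiniteDimensional ℂ H]

/-- With P the projection onto W, invariance under b means P b P = b P. This holds for a and star a;
the adjoint of the second equation is P a P = P a. -/
theorem commute_starProjection (W : Submodule ℂ H) {a : H →L[ℂ] H} (h : ∀ x ∈ W, a x ∈ W)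
    (h' : ∀ x ∈ W, star a x ∈ W) : Commute a W.starProjection := by
  have key : ∀ b : H →L[ℂ] H, (∀ x ∈ W, b x ∈ W) →
      W.starProjection * b * W.starProjection = b * W.starProjection := by
    intro b hb
    ext x
    exact Submodule.starProjection_eq_self_iff.2 (hb _ (Submodule.starProjection_apply_mem W x))
  have h1 := congrArg star (key _ h')
  simp only [star_mul, star_star, isStarProjection_starProjection.isSelfAdjoint.star_eq] at h1
  calc a * W.starProjection = W.starProjection * a * W.starProjection := (key a h).symm
    _ = W.starProjection * a := by rw [mul_assoc, h1]

/-- Every operator on an irreducible subspace is induced by an element of the algebra. -/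
theorem exists_irreducible [Nontrivial H] (B : StarSubalgebra ℂ (H →L[ℂ] H)) :
    ∃ V : Submodule ℂ H, V ≠ ⊥ ∧ (∀ b ∈ B, ∀ v ∈ V, b v ∈ V) ∧
      ∀ f : V →ₗ[ℂ] V, ∃ b ∈ B, ∀ v : V, b v = f v := by
  let R := B.toSubalgebra
  have : IsScalarTower ℂ R H := ⟨fun c r h => rfl⟩
  have : IsArtinian R H := isArtinian_of_tower ℂ inferInstance
  obtain ⟨V, hV⟩ := IsAtomic.exists_atom (Submodule R H)
  have : IsSimpleModule R V := isSimpleModule_iff_isAtom.2 hV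
  refine ⟨V.restrictScalars ℂ, fun h => hV.1 ?_, fun b hb v hv => V.smul_mem (⟨b, hb⟩ : R) hv,
    fun f => ?_⟩
  · exact (Submodule.restrictScalars_eq_bot_iff _ _ _).1 h
  · have : FiniteDimensional ℂ V := inferInstanceAs (FiniteDimensional ℂ (V.restrictScalars ℂ))
    -- By Schur's lemma the module endomorphisms of V are scalars, so every ℂ-linear map of V
    -- commutes with them, and the density theorem realises it by an element of B.
    have hs := (IsSimpleModule.algebraMap_end_bijective_of_isAlgClosed (A := R) (V := V) ℂ).2
    let f' : V →ₗ[ℂ] V := f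
    let F : Module.End (Module.End R V) V :=
      { toFun := f'
        map_add' := map_add f'
        map_smul' := fun t v => by
          obtain ⟨c, rfl⟩ := hs t
          exact map_smul f' c v }
    have : Module.Finite (Module.End R V) V :=
      Module.Finite.of_restrictScalars_finite ℂ (Module.End R V) V
    obtain ⟨r, hr⟩ := Module.Finite.toModuleEnd_moduleEnd_surjective (R := R) (M := V) F
    exact ⟨r.1, r.2, fun v => congrArg (fun g : Module.End (Module.End R V) V => (g v : H)) hr⟩

/-- A factor on a finite dimensional Hilbert space which is its own bicommutant is spanned by
matrix units. -/
theorem exists_matrixUnits [Nontrivial H] (B : StarSubalgebra ℂ (H →L[ℂ] H))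
    (hBB : ∀ a, (∀ c, (∀ b ∈ B, Commute b c) → Commute a c) → a ∈ B)
    (hB : ∀ a ∈ B, (∀ b ∈ B, Commute b a) → ∃ c : ℂ, a = c • (1 : H →L[ℂ] H)) :
    ∃ (n : ℕ) (e : Fin n → Fin n → H →L[ℂ] H), 0 < n ∧ IsMatrixUnits e ∧
      IsMatrixUnits.Spans e B := by
  obtain ⟨V, hV0, hV, hirr⟩ := exists_irreducible B
  -- B acts faithfully on V. The span W of the translates of V under the commutant is invariant
  -- under B and under its commutant, so the projection onto W is central in B. It is therefore a
  -- scalar, and equals 1 because V is nonzero. An element of B that kills V kills W, which is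
  -- everything.
  have hinj : ∀ b ∈ B, (∀ v ∈ V, b v = 0) → b = 0 := by
    intro b hb hbV
    let W : Submodule ℂ H :=
      Submodule.span ℂ {x | ∃ t : H →L[ℂ] H, (∀ c ∈ B, Commute c t) ∧ ∃ v ∈ V, x = t v}
    have hind : ∀ a : H →L[ℂ] H, (∀ t : H →L[ℂ] H, (∀ c ∈ B, Commute c t) → ∀ v ∈ V,
        a (t v) ∈ W) → ∀ x ∈ W, a x ∈ W := by
      intro a ha x hx
      induction hx using Submodule.span_induction with
      | mem x hx =>
        obtain ⟨t, ht, v, hv, rfl⟩ := hx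
        exact ha t ht v hv
      | zero => simp
      | add x y _ _ hx hy => rw [map_add]; exact W.add_mem hx hy
      | smul k x _ hx => rw [map_smul]; exact W.smul_mem k hx
    have hW1 : ∀ a ∈ B, ∀ x ∈ W, a x ∈ W := by
      intro a ha
      refine hind a fun t ht v hv => ?_
      rw [← mul_apply_eq_comp, (ht a ha).eq]
      exact Submodule.subset_span ⟨t, ht, a v, hV a ha v hv, rfl⟩
    have hW2 : ∀ a : H →L[ℂ] H, (∀ c ∈ B, Commute c a) → ∀ x ∈ W, a x ∈ W := by
      intro a ha
      refine hind a fun t ht v hv => Submodule.subset_span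
        ⟨a * t, fun c hc => (ha c hc).mul_right (ht c hc), v, hv, rfl⟩
    have hc1 : ∀ c ∈ B, Commute c W.starProjection := fun c hc =>
      commute_starProjection W (hW1 c hc) (hW1 _ (star_mem hc))
    have hc2 : W.starProjection ∈ B := by
      refine hBB _ fun c hc => (commute_starProjection W (hW2 c hc) (hW2 _ fun d hd => ?_)).symm
      have := (hc _ (star_mem hd)).star_star
      rwa [star_star] at this
    obtain ⟨k, hk⟩ := hB _ hc2 hc1
    obtain ⟨v, hv, hv0⟩ := (Submodule.ne_bot_iff V).1 hV0
    have hVW : v ∈ W := Submodule.subset_span ⟨1, fun c _ => Commute.one_right c, v, hv, rfl⟩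
    have hk1 : k = 1 := by
      have h1 : W.starProjection v = v := Submodule.starProjection_eq_self_iff.2 hVW
      rw [hk] at h1
      have h2 : (k - 1) • v = 0 := by
        rw [sub_smul, one_smul, sub_eq_zero]
        exact h1
      exact sub_eq_zero.1 ((smul_eq_zero.1 h2).resolve_right hv0)
    ext x
    have hx : x ∈ W := by
      rw [← Submodule.starProjection_eq_self_iff, hk, hk1]
      simp
    induction hx using Submodule.span_induction with
    | mem x hx =>
      obtain ⟨t, ht, v, hv, rfl⟩ := hx
      rw [← mul_apply_eq_comp, (ht b hb).eq, mul_apply_eq_comp, hbV v hv]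
      simp
    | zero => simp
    | add x y _ _ hx hy => rw [map_add, hx, hy]; simp
    | smul k x _ hx => rw [map_smul, hx]; simp
  let n := Module.finrank ℂ V
  let β : OrthonormalBasis (Fin n) ℂ V := stdOrthonormalBasis ℂ V
  have hext : ∀ b ∈ B, ∀ c ∈ B, (∀ z, b (β z) = c (β z)) → b = c := by
    intro b hb c hc h
    refine sub_eq_zero.1 (hinj _ (sub_mem hb hc) fun v hv => ?_)
    have : (b - c).toLinearMap ∘ₗ V.subtype = 0 := by
      refine β.toBasis.ext fun z => ?_
      simp [h z]
    exact congrArg (fun f : V →ₗ[ℂ] H => f ⟨v, hv⟩) this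
  -- By irreducibility the matrix units of an orthonormal basis of V are induced by elements of B.
  -- By `hext` all relations between them can be checked on that basis.
  have hex : ∀ x y, ∃ b ∈ B, ∀ z, b (β z) = if y = z then (β x : H) else 0 := by
    intro x y
    obtain ⟨b, hb, hbf⟩ := hirr (β.toBasis.constr ℂ fun z => if y = z then β x else 0)
    refine ⟨b, hb, fun z => ?_⟩
    have h1 := β.toBasis.constr_basis ℂ (fun z => if y = z then β x else 0) z
    rw [OrthonormalBasis.coe_toBasis] at h1
    rw [hbf, h1]
    split_ifs <;> rfl
  choose e heB he using hex
  have hunits : IsMatrixUnits e := by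
    refine ⟨fun x y z => ?_, fun x y z w h => ?_, fun x y => ?_, ?_⟩
    · refine hext _ (mul_mem (heB _ _) (heB _ _)) _ (heB _ _) fun t => ?_
      rw [mul_apply_eq_comp, he, he]
      split_ifs
      · simp [he]
      · simp
    · refine hext _ (mul_mem (heB _ _) (heB _ _)) _ (zero_mem _) fun t => ?_
      rw [mul_apply_eq_comp, he]
      split_ifs
      · simp [he, h]
      · simp
    · refine hext _ (star_mem (heB _ _)) _ (heB _ _) fun t => ?_
      have h1 : star (e x y) (β t) ∈ V := hV _ (star_mem (heB _ _)) _ (β t).2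
      have h2 : e y x (β t) ∈ V := hV _ (heB _ _) _ (β t).2
      suffices (⟨_, h1⟩ : V) = ⟨_, h2⟩ from congrArg Subtype.val this
      refine InnerProductSpace.ext_inner_left_basis β.toBasis fun s => ?_
      rw [OrthonormalBasis.coe_toBasis, Submodule.coe_inner, Submodule.coe_inner]
      change inner ℂ (β s : H) (ContinuousLinearMap.adjoint (e x y) (β t)) =
        inner ℂ (β s : H) (e y x (β t))
      rw [ContinuousLinearMap.adjoint_inner_right, he, he]
      have ho : ∀ i j, inner ℂ (β i : H) (β j) = if i = j then (1 : ℂ) else 0 := by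
        intro i j
        have := orthonormal_iff_ite.1 β.orthonormal i j
        rwa [Submodule.coe_inner] at this
      have ho' : ∀ i j, ¬ i = j → inner ℂ (β i : H) (β j) = 0 := fun i j h => by
        rw [ho, if_neg h]
      split_ifs with h3 h4 h4
      · rw [ho, ho, if_pos h4, if_pos h3.symm]
      · rw [ho' _ _ h4, inner_zero_right]
      · rw [ho' _ _ (Ne.symm h3), inner_zero_left]
      · rw [inner_zero_left, inner_zero_right]
    · refine hext _ (sum_mem fun x _ => heB x x) _ (one_mem _) fun t => ?_
      simp [he]
  refine ⟨n, e, ?_, hunits, fun b => ⟨fun hb => ?_, ?_⟩⟩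
  · have : Nontrivial V := Submodule.nontrivial_iff_ne_bot.2 hV0
    exact Module.finrank_pos
  · refine ⟨fun x y => β.repr ⟨b (β y), hV b hb _ (β y).2⟩ x, hext _ hb _
      (sum_mem fun x _ => sum_mem fun y _ => B.smul_mem (heB x y) _) fun z => ?_⟩
    have h1 := congrArg Subtype.val (β.sum_repr ⟨b (β z), hV b hb _ (β z).2⟩)
    simp only [Submodule.coe_sum, Submodule.coe_smul] at h1
    rw [← h1]
    simp [he]
  · rintro ⟨c, rfl⟩
    exact sum_mem fun x _ => sum_mem fun y _ => B.smul_mem (heB x y) _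

end Factor

end

/-! ### Local algebras as matrix algebras, Haag duality and the trivial centre. -/

noncomputable section
open scoped TensorProduct CStarAlgebra

instance {X : Type} [Finite X] : FiniteDimensional ℂ (L2 X) := by
  classical
  cases nonempty_fintype X
  let f : L2 X →ₗ[ℂ] (X → ℂ) :=
    { toFun := fun ψ => ψ
      map_add' := fun _ _ => rfl
      map_smul' := fun _ _ => rfl }
  exact FiniteDimensional.of_injective f fun a b h => lp.ext h

instance {X : Type} [Nonempty X] : Nontrivial (L2 X) := by
  classical
  obtain ⟨x⟩ := ‹Nonempty X›
  refine ⟨L2.basisVec x, 0, fun h => ?_⟩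
  have := congrArg (fun ψ : L2 X => ψ x) h
  simp [L2.basisVec_apply] at this

namespace BOp

variable {X : Type}

instance [Nonempty X] : Nontrivial (BOp X) :=
  inferInstanceAs (Nontrivial (L2 X →L[ℂ] L2 X))

theorem isMatrixUnits_unit [Fintype X] : IsMatrixUnits (unit : X → X → BOp X) := by
  classical
  have hmul : ∀ x y z w : X, unit x y * unit z w = if y = z then unit x w else 0 := by
    intro x y z w
    refine op_ext fun a b => ?_
    rw [clm_mul, unit_clm z w, map_smul, lp.coeFn_smul, Pi.smul_apply, unit_apply]
    have h : inner ℂ (L2.basisVec w) (L2.basisVec a) = if a = w then (1 : ℂ) else 0 := by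
      rw [L2.basisVec, lp.inner_single_left, L2.basisVec_apply]
      by_cases h : a = w
      · simp [h]
      · simp [h, Ne.symm h]
    rw [h]
    by_cases h1 : y = z
    · rw [if_pos h1, unit_apply]
      by_cases h2 : a = w <;> by_cases h3 : b = x <;> simp [h1, h2, h3]
    · rw [if_neg h1, if_neg (c := b = x ∧ z = y) (fun hh => h1 hh.2.symm)]
      simp
  refine ⟨fun x y z => by simp [hmul], fun x y z w h => by simp [hmul, h], fun x y => ?_,
    op_ext fun a b => ?_⟩
  · change ContinuousLinearMap.adjoint (InnerProductSpace.rankOne ℂ (L2.basisVec x)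
      (L2.basisVec y)) = _
    rw [InnerProductSpace.adjoint_rankOne]
    rfl
  · have h : ∀ s : Finset X, (∑ x ∈ s, unit x x : BOp X).clm (L2.basisVec a) b =
        ∑ x ∈ s, (unit x x).clm (L2.basisVec a) b := by
      intro s
      exact map_sum (coeff a b) _ _
    rw [h]
    simp only [unit_apply]
    change _ = L2.basisVec a b
    rw [L2.basisVec_apply]
    by_cases hab : b = a
    · subst hab
      simp
    · rw [if_neg hab]
      exact Finset.sum_eq_zero fun x _ => if_neg fun h => hab (h.1.trans h.2.symm)

theorem eq_sum_unit [Fintype X] (T : BOp X) :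
    T = ∑ x, ∑ y, T.clm (L2.basisVec y) x • unit x y := by
  classical
  refine op_ext fun a b => ?_
  have h : (∑ x, ∑ y, T.clm (L2.basisVec y) x • unit x y).clm (L2.basisVec a) b =
      ∑ x, ∑ y, T.clm (L2.basisVec y) x * (unit x y).clm (L2.basisVec a) b := by
    change coeff a b _ = _
    rw [map_sum]
    refine Finset.sum_congr rfl fun x _ => ?_
    rw [map_sum]
    exact Finset.sum_congr rfl fun y _ => map_smul (coeff a b) _ _
  rw [h, Finset.sum_eq_single b, Finset.sum_eq_single a]
  · simp [unit_apply]
  · intro y _ hy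
    simp [unit_apply, hy.symm]
  · simp
  · intro x _ hx
    simp [unit_apply, hx.symm]
  · simp

theorem exists_unitary_conj {X Y : Type} [Fintype X] [Nonempty X] [Finite Y] {e f : X → X → BOp Y}
    (he : IsMatrixUnits e) (hf : IsMatrixUnits f) :
    ∃ u ∈ unitary (BOp Y), ∀ x y, u * e x y = f x y * u :=
  IsMatrixUnits.exists_unitary (H := L2 Y) (e := e) (f := f) he hf

theorem exists_matrixUnits_of_factor {Y : Type} [Finite Y] [Nonempty Y]
    (B : StarSubalgebra ℂ (BOp Y))
    (hBB : ∀ a, (∀ c, (∀ b ∈ B, Commute b c) → Commute a c) → a ∈ B)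
    (hB : ∀ a ∈ B, (∀ b ∈ B, Commute b a) → ∃ c : ℂ, a = c • (1 : BOp Y)) :
    ∃ (n : ℕ) (e : Fin n → Fin n → BOp Y), 0 < n ∧ IsMatrixUnits e ∧ IsMatrixUnits.Spans e B :=
  exists_matrixUnits (H := L2 Y) B hBB hB

end BOp

namespace SpinChain

variable (A : SpinChain)

instance (S : Finset ℤ) : Fintype (A.FinConfig S) := Fintype.ofFinite _

instance (S : Finset ℤ) : Nonempty (A.FinConfig S) := ⟨fun j => (A.nonempty j).some⟩

/-- The inclusion of `𝒜_S` into `𝒜`. -/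
def emb (S : Finset ℤ) : BOp (A.FinConfig S) →⋆ₐ[ℂ] A.Alg := A.incl.comp (A.fromFin S)

theorem emb_injective (S : Finset ℤ) : Function.Injective (A.emb S) := fun _ _ h =>
  BOp.amp_injective (A.split S) (congrArg A.toOp h)

instance : Nontrivial A.Alg := (A.emb_injective ∅).nontrivial

/-- The matrix units of `𝒜_S`. -/
def units (S : Finset ℤ) (x y : A.FinConfig S) : A.Alg := A.emb S (BOp.unit x y)

theorem isMatrixUnits_units (S : Finset ℤ) : IsMatrixUnits (A.units S) :=
  BOp.isMatrixUnits_unit.map (A.emb S)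

theorem spans_range_emb (S : Finset ℤ) : IsMatrixUnits.Spans (A.units S) (A.emb S).range := by
  intro b
  constructor
  · rintro ⟨T, rfl⟩
    refine ⟨fun x y => T.clm (L2.basisVec y) x, ?_⟩
    conv_lhs => rw [BOp.eq_sum_unit T]
    change A.emb S _ = _
    simp only [map_sum, map_smul]
    rfl
  · rintro ⟨c, rfl⟩
    exact sum_mem fun x _ => sum_mem fun y _ => (A.emb S).range.smul_mem ⟨_, rfl⟩ _

/-- The norm closure adds nothing for a finite set of sites, since a finite dimensional subspace is
closed. -/
theorem sub_coe_eq_range (S : Finset ℤ) : A.sub S = (A.emb S).range := by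
  refine le_antisymm (fun a ha => ?_) ?_
  · have hc : IsClosed ((A.emb S).range : Set A.Alg) := by
      have := (A.spans_range_emb S).finiteDimensional
      exact Submodule.closed_of_finiteDimensional
        (Subalgebra.toSubmodule (A.emb S).range.toSubalgebra)
    refine closure_minimal ?_ hc (A.mem_closure_preimage_preAlg ha)
    intro x hx
    obtain ⟨T, hT, hx⟩ := A.mem_preAlg.1 hx
    obtain ⟨t, ht⟩ := A.finAlg_mono (Finset.coe_subset.1 hT) hx
    exact ⟨t, A.toOp_injective ht⟩
  · rintro _ ⟨T, rfl⟩
    exact StarSubalgebra.le_topologicalClosure _ (A.mem_preAlg.2 ⟨S, le_rfl, T, rfl⟩)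

theorem spans_units (S : Finset ℤ) : IsMatrixUnits.Spans (A.units S) (A.sub S) := by
  rw [sub_coe_eq_range]
  exact A.spans_range_emb S

theorem units_mem (S : Finset ℤ) (x y : A.FinConfig S) : A.units S x y ∈ A.sub S :=
  (A.spans_units S).mem x y

variable {A}

/-- Strictly local elements supported in `X` are dense in `𝒜_X`. -/
theorem sub_le_of_finset {X : Set ℤ} {K : Set A.Alg} (hK : IsClosed K)
    (h : ∀ S : Finset ℤ, (S : Set ℤ) ⊆ X → (A.sub S : Set A.Alg) ⊆ K) :
    (A.sub X : Set A.Alg) ⊆ K := by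
  intro a ha
  refine closure_minimal ?_ hK (A.mem_closure_preimage_preAlg ha)
  intro x hx
  obtain ⟨S, hS, T, hT⟩ := A.mem_preAlg.1 hx
  refine h S hS ?_
  rw [sub_coe_eq_range]
  exact ⟨T, A.toOp_injective hT⟩

theorem exists_finset_dist_lt {X : Set ℤ} {a : A.Alg} (ha : a ∈ A.sub X) {ε : ℝ} (hε : 0 < ε) :
    ∃ S : Finset ℤ, (S : Set ℤ) ⊆ X ∧ ∃ b ∈ A.sub S, ‖a - b‖ < ε := by
  have := sub_le_of_finset (A := A) (X := X)
    (K := closure {b | ∃ S : Finset ℤ, (S : Set ℤ) ⊆ X ∧ b ∈ A.sub S}) isClosed_closure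
    (fun S hS b hb => subset_closure ⟨S, hS, hb⟩) ha
  obtain ⟨b, ⟨S, hS, hb⟩, h⟩ := Metric.mem_closure_iff.1 this ε hε
  exact ⟨S, hS, b, hb, by rwa [← dist_eq_norm]⟩

theorem mem_sub_univ (a : A.Alg) : a ∈ A.sub Set.univ := A.toOp_mem a

/-- The splitting of configurations outside of `S` with respect to a disjoint set `T`. -/
def splitCompl (A : SpinChain) {S T : Finset ℤ} (h : Disjoint S T) :
    (∀ j : {j : ℤ // j ∉ S}, A.site j) ≃
      A.FinConfig T × ∀ j : {j : {j : ℤ // j ∉ S} // j.1 ∉ T}, A.site j where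
  toFun σ := (fun j => σ ⟨j, fun hj => Finset.disjoint_left.1 h hj j.2⟩, fun j => σ j)
  invFun p j := if hj : j.1 ∈ T then p.1 ⟨j, hj⟩ else p.2 ⟨j, hj⟩
  left_inv σ := by ext j; by_cases hj : j.1 ∈ T <;> simp [hj]
  right_inv p := by
    refine Prod.ext ?_ ?_ <;> ext j
    · simp
    · have := j.2
      simp [this]

/-- An operator on T is an amplification of an operator on the complement of S, so the two operators
act on different tensor factors. -/
theorem commute_of_disjoint_finset {S T : Finset ℤ} (h : Disjoint S T) {a b : A.Alg}
    (ha : a ∈ A.sub S) (hb : b ∈ A.sub T) : Commute a b := by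
  rw [sub_coe_eq_range] at ha hb
  obtain ⟨a, rfl⟩ := ha
  obtain ⟨b, rfl⟩ := hb
  apply A.toOp_injective
  change BOp.amp (A.split S) a * BOp.amp (A.split T) b =
    BOp.amp (A.split T) b * BOp.amp (A.split S) a
  have : BOp.amp (A.split T) b = BOp.amp ((A.split S).trans (Equiv.prodComm _ _))
      (BOp.amp (A.splitCompl h) b) := by
    symm
    refine BOp.amp_amp_eq _ _ _ (fun z => rfl) (fun z i => ?_) b
    ext j
    by_cases hj : j ∈ S
    · have hjT : j ∉ T := Finset.disjoint_left.1 h hj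
      simp [splitCompl, Equiv.piEquivPiSubtypeProd, hj, hjT]
    · by_cases hjT : j ∈ T <;> simp [splitCompl, Equiv.piEquivPiSubtypeProd, hj, hjT]
  rw [this]
  exact BOp.amp_commute (A.split S) a _

theorem isClosed_commute (b : A.Alg) : IsClosed {a : A.Alg | Commute a b} :=
  isClosed_eq (by fun_prop) (by fun_prop)

theorem commute_of_disjoint {X Y : Set ℤ} (h : Disjoint X Y) {a b : A.Alg}
    (ha : a ∈ A.sub X) (hb : b ∈ A.sub Y) : Commute a b := by
  refine sub_le_of_finset (isClosed_commute b) (fun S hS a ha => ?_) ha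
  refine (sub_le_of_finset (isClosed_commute a) (fun T hT b hb => ?_) hb : Commute b a).symm
  exact (commute_of_disjoint_finset (Finset.disjoint_coe.1 (h.mono hS hT)) ha hb).symm

/-- Splitting of finite configurations. -/
def splitUnion (A : SpinChain) {S T : Finset ℤ} (h : Disjoint S T) :
    A.FinConfig (S ∪ T) ≃ A.FinConfig S × A.FinConfig T where
  toFun σ := (fun j => σ ⟨j, Finset.mem_union_left T j.2⟩,
    fun j => σ ⟨j, Finset.mem_union_right S j.2⟩)
  invFun p j := if hj : j.1 ∈ S then p.1 ⟨j, hj⟩ else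
    p.2 ⟨j, (Finset.mem_union.1 j.2).resolve_left hj⟩
  left_inv σ := by ext j; by_cases hj : j.1 ∈ S <;> simp [hj]
  right_inv p := by
    refine Prod.ext ?_ ?_ <;> ext j
    · simp
    · have : j.1 ∉ S := Finset.disjoint_right.1 h j.2
      simp [this]

theorem emb_amp_left {S T : Finset ℤ} (h : Disjoint S T) (a : BOp (A.FinConfig S)) :
    A.emb (S ∪ T) (BOp.amp (A.splitUnion h) a) = A.emb S a := by
  apply A.toOp_injective
  refine BOp.amp_amp_eq _ _ _ (fun z => rfl) (fun z i => ?_) a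
  ext j
  by_cases hj : j ∈ S
  · simp [splitUnion, Equiv.piEquivPiSubtypeProd, hj]
  · by_cases hjT : j ∈ T <;> simp [splitUnion, Equiv.piEquivPiSubtypeProd, hj, hjT]

theorem emb_amp_right {S T : Finset ℤ} (h : Disjoint S T) (b : BOp (A.FinConfig T)) :
    A.emb (S ∪ T) (BOp.amp ((A.splitUnion h).trans (Equiv.prodComm _ _)) b) = A.emb T b := by
  apply A.toOp_injective
  refine BOp.amp_amp_eq _ _ _ (fun z => rfl) (fun z i => ?_) b
  ext j
  by_cases hj : j ∈ S
  · have hjT : j ∉ T := Finset.disjoint_left.1 h hj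
    simp [splitUnion, Equiv.piEquivPiSubtypeProd, hj, hjT]
  · by_cases hjT : j ∈ T <;> simp [splitUnion, Equiv.piEquivPiSubtypeProd, hj, hjT]

/-- `𝒜_{S ∪ T}` is spanned by the products of elements of `𝒜_S` and of `𝒜_T`. -/
theorem sub_union_finset_induction {S T : Finset ℤ} (h : Disjoint S T) {p : A.Alg → Prop}
    (zero : p 0) (add : ∀ a b, p a → p b → p (a + b))
    (mul : ∀ a ∈ A.sub S, ∀ b ∈ A.sub T, p (a * b)) {a : A.Alg}
    (ha : a ∈ A.sub ((S ∪ T : Finset ℤ) : Set ℤ)) : p a := by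
  rw [sub_coe_eq_range] at ha
  obtain ⟨a, rfl⟩ := ha
  obtain ⟨t, rfl⟩ := BOp.ampMul_surjective (A.splitUnion h) a
  change p (A.emb (S ∪ T) (BOp.ampMul (A.splitUnion h) t))
  induction t using TensorProduct.induction_on with
  | zero => rwa [map_zero (BOp.ampMul (A.splitUnion h)), map_zero]
  | tmul a b =>
    rw [BOp.ampMul_tmul, map_mul, emb_amp_left, emb_amp_right]
    refine mul _ ?_ _ ?_ <;> rw [sub_coe_eq_range]
    exacts [⟨a, rfl⟩, ⟨b, rfl⟩]
  | add a b ha hb =>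
    rw [map_add (BOp.ampMul (A.splitUnion h)), map_add]
    exact add _ _ ha hb

open Classical in
theorem filter_union_filter_not (S : Finset ℤ) (X : Set ℤ) :
    (S.filter (· ∈ X)) ∪ (S.filter (· ∉ X)) = S := Finset.filter_union_filter_not_eq _ S

/-- The sets may overlap: a finite S is split into its part in X and the rest, which lies in Y. The
target need not be closed under `star`, so that centralizers of single elements are allowed. -/
theorem sub_union_le {X Y : Set ℤ} {K : Subalgebra ℂ A.Alg} (hK : IsClosed (K : Set A.Alg))
    (hX : (A.sub X).toSubalgebra ≤ K) (hY : (A.sub Y).toSubalgebra ≤ K) :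
    (A.sub (X ∪ Y)).toSubalgebra ≤ K := by
  classical
  refine sub_le_of_finset hK fun S hS a ha => ?_
  rw [← filter_union_filter_not S X] at ha
  refine sub_union_finset_induction (p := fun a => a ∈ K) (Finset.disjoint_filter_filter_not S S _)
    (zero_mem K) (fun _ _ => add_mem) (fun a ha b hb => mul_mem (hX ?_) (hY ?_)) ha
  · exact A.sub_mono (by intro j; simp) ha
  · refine A.sub_mono ?_ hb
    intro j hj
    simp only [Finset.coe_filter, Set.mem_ofPred_eq] at hj
    exact (hS hj.1).resolve_left hj.2

/-- Relative Haag duality: the commutant of `𝒜_X` in `𝒜_Y` is `𝒜_{Y \ X}`. -/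
theorem mem_sub_diff {X Y : Set ℤ} {a : A.Alg} (ha : a ∈ A.sub Y)
    (hc : ∀ b ∈ A.sub X, Commute b a) : a ∈ A.sub (Y \ X) := by
  classical
  rw [← SetLike.mem_coe, ← (A.isClosed_sub (Y \ X)).closure_eq, Metric.mem_closure_iff]
  intro ε hε
  obtain ⟨T, hT, b, hb, hab⟩ := exists_finset_dist_lt ha hε
  let U := T.filter (· ∈ X)
  have he := A.isMatrixUnits_units U
  have hUX : (U : Set ℤ) ⊆ X := by
    intro j hj
    exact (Finset.mem_filter.1 hj).2
  obtain ⟨o⟩ : Nonempty (A.FinConfig U) := inferInstance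
  -- The element a is approximated by b, supported in T ⊆ Y, and the part of b in U = T ∩ X is
  -- removed by a diagonal coefficient. This map is contractive and fixes a, so the approximation is
  -- kept.
  refine ⟨IsMatrixUnits.coeff (A.units U) o o b, ?_, ?_⟩
  · rw [← filter_union_filter_not T X] at hb
    refine sub_union_finset_induction
      (p := fun b => IsMatrixUnits.coeff (A.units U) o o b ∈ A.sub (Y \ X))
      (Finset.disjoint_filter_filter_not T T _) ?_ ?_ ?_ hb
    · rw [map_zero]
      exact zero_mem _
    · intro c d hc hd
      rw [map_add]
      exact add_mem hc hd
    · intro c hc d hd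
      have hd' : ∀ x y, Commute (A.units U x y) d := fun x y =>
        commute_of_disjoint_finset (Finset.disjoint_filter_filter_not T T _) (A.units_mem U x y) hd
      rw [IsMatrixUnits.coeff_mul_of_commute _ _ _ _ hd']
      -- The coefficient of c ∈ 𝒜_U lies both in 𝒜_U and in its commutant, hence is a scalar; only
      -- the factor d outside of X remains.
      obtain ⟨k, hk⟩ := (A.spans_units U).exists_scalar he
        (IsMatrixUnits.coeff_mem (A.units_mem U) o o hc) fun x y => he.commute_coeff o o x y c
      rw [hk, smul_mul_assoc, one_mul]
      refine StarSubalgebra.smul_mem _ (A.sub_mono ?_ hd) k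
      intro j hj
      simp only [Finset.coe_filter, Set.mem_ofPred_eq] at hj
      exact ⟨hT hj.1, hj.2⟩
  · rw [dist_eq_norm]
    have h := he.coeff_of_commute o a fun x y => hc _ (A.sub_mono hUX (A.units_mem U x y))
    nth_rewrite 1 [← h]
    rw [← map_sub]
    exact (he.norm_coeff_le o _).trans_lt hab

theorem mem_sub_compl {X : Set ℤ} {a : A.Alg} (hc : ∀ b ∈ A.sub X, Commute b a) :
    a ∈ A.sub Xᶜ := by
  rw [Set.compl_eq_univ_sdiff]
  exact mem_sub_diff (mem_sub_univ a) hc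

/-- Membership in 𝒜_Y implies commutation with 𝒜_{Yᶜ}, and Haag duality within X leaves X \ Yᶜ = X ∩
Y. -/
theorem mem_sub_inter {X Y : Set ℤ} {a : A.Alg} (hX : a ∈ A.sub X) (hY : a ∈ A.sub Y) :
    a ∈ A.sub (X ∩ Y) := by
  have := mem_sub_diff (X := Yᶜ) hX fun b hb =>
    commute_of_disjoint disjoint_compl_left hb hY
  rwa [Set.sdiff_compl] at this

theorem exists_scalar_of_mem_sub_empty {a : A.Alg} (ha : a ∈ A.sub ∅) :
    ∃ c : ℂ, a = c • (1 : A.Alg) := by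
  have ha' : a ∈ A.sub ((∅ : Finset ℤ) : Set ℤ) := by rwa [Finset.coe_empty]
  refine (A.spans_units ∅).exists_scalar (A.isMatrixUnits_units ∅) ha' fun x y => ?_
  exact commute_of_disjoint_finset (Finset.disjoint_empty_left ∅) (A.units_mem ∅ x y) ha'

/-- Haag duality for the commutant of the whole chain. The trivial centre is what makes phases
appear. -/
theorem exists_scalar_of_central {a : A.Alg} (hc : ∀ b, Commute b a) :
    ∃ c : ℂ, a = c • (1 : A.Alg) := by
  have := mem_sub_compl (X := Set.univ) (a := a) fun b _ => hc b
  rw [Set.compl_univ] at this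
  exact exists_scalar_of_mem_sub_empty this

variable {E : Type} [CStarAlgebra E]

theorem isClosed_equalizer (f g : A.Alg →⋆ₐ[ℂ] E) :
    IsClosed (StarAlgHom.equalizer f g : Set A.Alg) :=
  isClosed_eq (map_continuous f) (map_continuous g)

theorem eqOn_sub_union {X Y : Set ℤ} (f g : A.Alg →⋆ₐ[ℂ] E) (hX : ∀ a ∈ A.sub X, f a = g a)
    (hY : ∀ a ∈ A.sub Y, f a = g a) {a : A.Alg} (ha : a ∈ A.sub (X ∪ Y)) : f a = g a :=
  sub_union_le (K := (StarAlgHom.equalizer f g).toSubalgebra) (isClosed_equalizer f g) hX hY ha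

/-- The source of all local unitaries below. Within 𝒜_S, a full matrix algebra, systems of matrix
units of equal size are conjugate, and the unitary stays in 𝒜_S. -/
theorem exists_unitary_mem_sub {S : Finset ℤ} {X : Type} [Fintype X] [Nonempty X]
    {e f : X → X → A.Alg} (he : IsMatrixUnits e) (hf : IsMatrixUnits f)
    (heS : ∀ x y, e x y ∈ A.sub S) (hfS : ∀ x y, f x y ∈ A.sub S) :
    ∃ u : unitary A.Alg, (u : A.Alg) ∈ A.sub S ∧ ∀ x y, u * e x y = f x y * u := by
  rw [sub_coe_eq_range] at heS hfS ⊢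
  choose e' he' using heS
  choose f' hf' using hfS
  have h1 : IsMatrixUnits e' := .of_map (A.emb S) (A.emb_injective S) (by
    convert! he with x y
    exact he' x y)
  have h2 : IsMatrixUnits f' := .of_map (A.emb S) (A.emb_injective S) (by
    convert! hf with x y
    exact hf' x y)
  obtain ⟨u, hu, h⟩ := BOp.exists_unitary_conj h1 h2
  refine ⟨⟨A.emb S u, Unitary.map_mem (A.emb S) hu⟩, ⟨u, rfl⟩, fun x y => ?_⟩
  have := congrArg (A.emb S) (h x y)
  rw [map_mul, map_mul] at this
  change A.emb S u * e x y = f x y * A.emb S u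
  rw [← he' x y, ← hf' x y]
  exact this

/-- A factor in `𝒜_S` which is its own relative bicommutant is spanned by matrix units. -/
theorem exists_matrixUnits_of_factor {S : Finset ℤ} {B : StarSubalgebra ℂ A.Alg} (hBS : B ≤ A.sub S)
    (hBB : ∀ a ∈ A.sub S, (∀ c ∈ A.sub S, (∀ b ∈ B, Commute b c) → Commute a c) → a ∈ B)
    (hB : ∀ a ∈ B, (∀ b ∈ B, Commute b a) → ∃ c : ℂ, a = c • (1 : A.Alg)) :
    ∃ (n : ℕ) (e : Fin n → Fin n → A.Alg), 0 < n ∧ IsMatrixUnits e ∧ IsMatrixUnits.Spans e B := by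
  have hS := A.sub_coe_eq_range S
  have hcomm : ∀ a b : BOp (A.FinConfig S), Commute a b ↔ Commute (A.emb S a) (A.emb S b) :=
    fun a b => ⟨fun h => h.map (A.emb S), fun h => A.emb_injective S (by
      rw [map_mul, map_mul]; exact h)⟩
  obtain ⟨n, e, hn, he, hs⟩ := BOp.exists_matrixUnits_of_factor (B.comap (A.emb S))
    (fun a ha => hBB _ (by rw [hS]; exact ⟨a, rfl⟩) fun c hc hbc => by
      rw [hS] at hc
      obtain ⟨c, rfl⟩ := hc
      exact (hcomm _ _).1 (ha c fun b hb => (hcomm _ _).2 (hbc _ hb)))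
    (fun a ha h => by
      obtain ⟨k, hk⟩ := hB _ ha fun b hb => by
        have hb' := hBS hb
        rw [hS] at hb'
        obtain ⟨b, rfl⟩ := hb'
        exact (hcomm _ _).1 (h b hb)
      exact ⟨k, A.emb_injective S (by
        rw [map_smul, map_one]; exact hk)⟩)
  refine ⟨n, fun x y => A.emb S (e x y), hn, he.map (A.emb S), ?_⟩
  have hmap : (B.comap (A.emb S)).map (A.emb S) = B := by
    refine le_antisymm (fun b hb => ?_) fun b hb => ?_
    · obtain ⟨a, ha, rfl⟩ := StarSubalgebra.mem_map.1 hb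
      exact ha
    · have hb' := hBS hb
      rw [hS] at hb'
      obtain ⟨b, rfl⟩ := hb'
      exact StarSubalgebra.mem_map.2 ⟨b, hb, rfl⟩
  have := hs.map (A.emb S)
  rwa [hmap] at this

end SpinChain

end

/-! ### Inner automorphisms and gluing of automorphisms along a set of sites. -/

noncomputable section
open scoped TensorProduct CStarAlgebra

namespace SpinChain

variable {A B : SpinChain} {E : Type} [CStarAlgebra E]

theorem eqOn_sub {X : Set ℤ} (f g : A.Alg →⋆ₐ[ℂ] E)
    (h : ∀ S : Finset ℤ, (S : Set ℤ) ⊆ X → ∀ a ∈ A.sub S, f a = g a) {a : A.Alg}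
    (ha : a ∈ A.sub X) : f a = g a :=
  sub_le_of_finset (isClosed_equalizer f g) (fun S hS a ha => h S hS a ha) ha

theorem commute_of_spans {S : Finset ℤ} {a b : A.Alg} (h : ∀ x y, Commute (A.units S x y) a)
    (hb : b ∈ A.sub S) : Commute b a := (A.spans_units S).commute h hb

/-- A `*`-automorphism which is trivial outside of a finite set is inner. -/
theorem exists_conj_of_eq_id {S : Finset ℤ} (K : A.Alg ≃⋆ₐ[ℂ] A.Alg)
    (hK : ∀ a ∈ A.sub (S : Set ℤ)ᶜ, K a = a) :
    ∃ u : unitary A.Alg, (u : A.Alg) ∈ A.sub S ∧ K = Unitary.conjStarAlgAut ℂ A.Alg u := by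
  -- The image commutes with 𝒜_{Sᶜ}, which K fixes, so Haag duality applies. Then K moves the matrix
  -- units of 𝒜_S to another system in 𝒜_S, and the intertwining unitary implements K.
  have hS : ∀ a ∈ A.sub S, K a ∈ A.sub S := by
    intro a ha
    rw [← compl_compl (S : Set ℤ)]
    refine mem_sub_compl fun b hb => ?_
    rw [← hK b hb]
    exact (commute_of_disjoint disjoint_compl_left hb ha).map K
  obtain ⟨u, hu, h⟩ := exists_unitary_mem_sub (A.isMatrixUnits_units S)
    ((A.isMatrixUnits_units S).map (autHom K)) (A.units_mem S)
    fun x y => hS _ (A.units_mem S x y)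
  refine ⟨u, hu, StarAlgEquiv.ext fun a => ?_⟩
  refine eqOn_sub_union (X := S) (Y := (S : Set ℤ)ᶜ) (autHom K)
    (autHom (Unitary.conjStarAlgAut ℂ A.Alg u)) (fun a ha => ?_) (fun a ha => ?_)
    (by rw [Set.union_compl_self]; exact mem_sub_univ a)
  · obtain ⟨c, rfl⟩ := (A.spans_units S a).1 ha
    simp only [map_sum, map_smul]
    refine Finset.sum_congr rfl fun x _ => Finset.sum_congr rfl fun y _ => ?_
    rw [autHom_apply (Unitary.conjStarAlgAut ℂ A.Alg u), Unitary.conjStarAlgAut_apply, h,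
      mul_assoc, Unitary.mul_star_self_of_mem u.2, mul_one]
  · rw [autHom_apply, autHom_apply, hK a ha, Unitary.conjStarAlgAut_apply,
      (commute_of_disjoint disjoint_compl_right hu ha).eq, mul_assoc,
      Unitary.mul_star_self_of_mem u.2, mul_one]

/-- A compatible family of `*`-homomorphisms has a limit. -/
theorem exists_limit (θ : Finset ℤ → A.Alg →⋆ₐ[ℂ] E)
    (h : ∀ S : Finset ℤ, ∀ a ∈ A.sub S, ∀ T : Finset ℤ, S ⊆ T → θ T a = θ S a) :
    ∃ f : A.Alg →⋆ₐ[ℂ] E, ∀ S : Finset ℤ, ∀ a ∈ A.sub S, f a = θ S a := by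
  have hθ : ∀ S a, ‖θ S a‖ ≤ ‖a‖ := fun S a => NonUnitalStarAlgHom.norm_apply_le (θ S) a
  have hlim : ∀ a, ∃ b, Filter.Tendsto (fun S => θ S a) Filter.atTop (nhds b) := by
    intro a
    -- The maps are contractive, and on the dense set of strictly local elements the net is
    -- eventually constant.
    refine cauchySeq_tendsto_of_complete (Metric.cauchySeq_iff'.2 fun ε hε => ?_)
    obtain ⟨S, -, b, hb, hab⟩ := exists_finset_dist_lt (mem_sub_univ a) (half_pos hε)
    refine ⟨S, fun T hT => ?_⟩
    have h1 : ‖θ T (a - b)‖ < ε / 2 := (hθ T _).trans_lt hab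
    have h2 : ‖θ S (a - b)‖ < ε / 2 := (hθ S _).trans_lt hab
    rw [dist_eq_norm]
    calc ‖θ T a - θ S a‖ = ‖θ T (a - b) - θ S (a - b)‖ := by
          rw [map_sub, map_sub, h S b hb T hT, sub_sub_sub_cancel_right]
      _ ≤ ‖θ T (a - b)‖ + ‖θ S (a - b)‖ := norm_sub_le _ _
      _ < ε := by linarith
  choose L hL using hlim
  have huniq : ∀ {a : A.Alg} {b : E}, Filter.Tendsto (fun S => θ S a) Filter.atTop (nhds b) →
      L a = b := fun hb => tendsto_nhds_unique (hL _) hb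
  have hconst : ∀ (a : A.Alg) (b : E), (∀ S, θ S a = b) → L a = b := fun a b hb =>
    huniq (by simp only [hb]; exact tendsto_const_nhds)
  refine ⟨{ toFun := L
            map_one' := hconst _ _ fun S => map_one _
            map_zero' := hconst _ _ fun S => map_zero _
            map_mul' := fun a b => huniq (by simpa only [map_mul] using (hL a).mul (hL b))
            map_add' := fun a b => huniq (by simpa only [map_add] using (hL a).add (hL b))
            commutes' := fun c => hconst _ _ fun S => AlgHomClass.commutes (θ S) c
            map_star' := fun a => huniq (by simpa only [map_star] using (hL a).star) },
    fun S a ha => huniq ?_⟩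
  refine tendsto_const_nhds.congr' ?_
  filter_upwards [Filter.eventually_ge_atTop S] with T hT
  exact (h S a ha T hT).symm

/-- `f` maps strictly local operators to strictly local operators. -/
def PreservesLocal (f : A.Alg → B.Alg) : Prop :=
  ∀ S : Finset ℤ, ∃ T : Finset ℤ, ∀ a ∈ A.sub S, f a ∈ B.sub T

/-- For each finite S, a unitary of 𝒜_X carries the matrix units of 𝒜_{S ∩ X} to their images under
f. Its conjugation acts as f on 𝒜_{S ∩ X} and trivially on 𝒜_{Xᶜ}. These conjugations are
compatible, so they have a limit, which in general is no longer inner. -/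
theorem exists_glue_hom {X : Set ℤ} (f : A.Alg →⋆ₐ[ℂ] A.Alg) (hf : PreservesLocal f)
    (hX : ∀ a ∈ A.sub X, f a ∈ A.sub X) :
    ∃ h : A.Alg →⋆ₐ[ℂ] A.Alg, (∀ a ∈ A.sub X, h a = f a) ∧ ∀ a ∈ A.sub Xᶜ, h a = a := by
  classical
  have hex : ∀ S : Finset ℤ, ∃ θ : A.Alg →⋆ₐ[ℂ] A.Alg,
      (∀ a ∈ A.sub ((S.filter (· ∈ X) : Finset ℤ) : Set ℤ), θ a = f a) ∧
      ∀ a ∈ A.sub Xᶜ, θ a = a := by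
    intro S
    let S' := S.filter (· ∈ X)
    have hS' : (S' : Set ℤ) ⊆ X := fun j hj => (Finset.mem_filter.1 hj).2
    obtain ⟨T, hT⟩ := hf S'
    -- Large enough to contain both the matrix units of S' and their images, and still inside X.
    let T' := T.filter (· ∈ X) ∪ S'
    have hT' : (T' : Set ℤ) ⊆ X := by
      intro j hj
      rcases Finset.mem_union.1 hj with hj | hj
      · exact (Finset.mem_filter.1 hj).2
      · exact hS' hj
    obtain ⟨u, hu, h⟩ := exists_unitary_mem_sub (S := T') (A.isMatrixUnits_units S')
      ((A.isMatrixUnits_units S').map f)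
      (fun x y => A.sub_mono (Finset.coe_subset.2 Finset.subset_union_right) (A.units_mem S' x y))
      (fun x y => by
        refine A.sub_mono ?_ (mem_sub_inter (hT _ (A.units_mem S' x y))
          (hX _ (A.sub_mono hS' (A.units_mem S' x y))))
        intro j hj
        exact Finset.mem_union_left _ (Finset.mem_filter.2 hj))
    refine ⟨autHom (Unitary.conjStarAlgAut ℂ A.Alg u), fun a ha => ?_, fun a ha => ?_⟩
    · obtain ⟨c, rfl⟩ := (A.spans_units S' a).1 ha
      simp only [map_sum, map_smul]
      refine Finset.sum_congr rfl fun x _ => Finset.sum_congr rfl fun y _ => ?_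
      rw [autHom_apply (Unitary.conjStarAlgAut ℂ A.Alg u), Unitary.conjStarAlgAut_apply, h,
        mul_assoc, Unitary.mul_star_self_of_mem u.2, mul_one]
    · rw [autHom_apply, Unitary.conjStarAlgAut_apply,
        (commute_of_disjoint (disjoint_compl_right.mono_left hT') hu ha).eq, mul_assoc,
        Unitary.mul_star_self_of_mem u.2, mul_one]
  choose θ hθ hθ' using hex
  obtain ⟨h, hh⟩ := exists_limit θ fun S a ha T hST => by
    rw [← filter_union_filter_not S X, Finset.coe_union] at ha
    refine eqOn_sub_union (θ T) (θ S) (fun a ha => ?_) (fun a ha => ?_) ha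
    · rw [hθ S a ha]
      exact hθ T a (A.sub_mono (Finset.coe_subset.2 (Finset.filter_subset_filter _ hST)) ha)
    · have hsub : a ∈ A.sub Xᶜ := A.sub_mono (fun j hj => (Finset.mem_filter.1 hj).2) ha
      rw [hθ' S a hsub, hθ' T a hsub]
  refine ⟨h, fun a ha => ?_, fun a ha => ?_⟩
  · refine eqOn_sub h f (fun S hS a ha => ?_) ha
    rw [hh S a ha]
    refine hθ S a (A.sub_mono ?_ ha)
    intro j hj
    exact Finset.mem_filter.2 ⟨hj, hS hj⟩
  · refine eqOn_sub h (StarAlgHom.id ℂ A.Alg) (fun S hS a ha => ?_) ha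
    rw [hh S a ha]
    exact hθ' S a (A.sub_mono hS ha)

theorem hom_ext_compl {X : Set ℤ} (f g : A.Alg →⋆ₐ[ℂ] E) (hX : ∀ a ∈ A.sub X, f a = g a)
    (hY : ∀ a ∈ A.sub Xᶜ, f a = g a) : f = g :=
  StarAlgHom.ext fun a => eqOn_sub_union f g hX hY
    (by rw [Set.union_compl_self]; exact mem_sub_univ a)

theorem aut_ext_compl {X : Set ℤ} {α β : A.Alg ≃⋆ₐ[ℂ] A.Alg} (hX : ∀ a ∈ A.sub X, α a = β a)
    (hY : ∀ a ∈ A.sub Xᶜ, α a = β a) : α = β :=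
  StarAlgEquiv.ext fun a => DFunLike.congr_fun (hom_ext_compl (autHom α) (autHom β) hX hY) a

/-- An automorphism which preserves `𝒜_X` can be replaced by the identity outside of `X`. -/
theorem exists_glue {X : Set ℤ} (γ : A.Alg ≃⋆ₐ[ℂ] A.Alg) (hγ : PreservesLocal γ)
    (hγ' : PreservesLocal γ.symm) (hX : ∀ a ∈ A.sub X, γ a ∈ A.sub X)
    (hX' : ∀ a ∈ A.sub X, γ.symm a ∈ A.sub X) :
    ∃ ρ : A.Alg ≃⋆ₐ[ℂ] A.Alg, (∀ a ∈ A.sub X, ρ a = γ a) ∧ ∀ a ∈ A.sub Xᶜ, ρ a = a := by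
  obtain ⟨f, hf, hf'⟩ := exists_glue_hom (autHom γ) hγ hX
  obtain ⟨h, hh, hh'⟩ := exists_glue_hom (autHom γ.symm) hγ' hX'
  refine ⟨StarAlgEquiv.ofStarAlgHom f h ?_ ?_, hf, hf'⟩
  · refine hom_ext_compl (X := X) _ _ (fun a ha => ?_) fun a ha => ?_
    · change h (f a) = a
      rw [hf a ha, autHom_apply, hh _ (hX a ha), autHom_apply, StarAlgEquiv.symm_apply_apply]
    · change h (f a) = a
      rw [hf' a ha, hh' a ha]
  · refine hom_ext_compl (X := X) _ _ (fun a ha => ?_) fun a ha => ?_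
    · change f (h a) = a
      rw [hh a ha, autHom_apply, hf _ (hX' a ha), autHom_apply, StarAlgEquiv.apply_symm_apply]
    · change f (h a) = a
      rw [hh' a ha, hf' a ha]

theorem fatten_finite {X : Set ℤ} (hX : X.Finite) (r : ℕ) : (fatten X r).Finite := by
  have : fatten X r = ⋃ i ∈ X, Set.Icc (i - r) (i + r) := by
    ext j
    simp only [fatten, Set.mem_ofPred_eq, Set.mem_iUnion, Set.mem_Icc, exists_prop, abs_le]
    refine exists_congr fun i => and_congr_right fun _ => ?_
    constructor <;> rintro ⟨h1, h2⟩ <;> constructor <;> linarith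
  rw [this]
  exact hX.biUnion fun i _ => Set.finite_Icc _ _

theorem IsQCA.preservesLocal {α : A.Alg ≃⋆ₐ[ℂ] A.Alg} (hα : IsQCA α) : PreservesLocal α := by
  obtain ⟨r, hr⟩ := hα
  intro S
  refine ⟨(fatten_finite S.finite_toSet r).toFinset, fun a ha => ?_⟩
  rw [Set.Finite.coe_toFinset]
  exact hr _ a ha

theorem PreservesLocal.comp {C : SpinChain} {f : A.Alg → B.Alg} {h : B.Alg → C.Alg}
    (hh : PreservesLocal h) (hf : PreservesLocal f) : PreservesLocal fun a => h (f a) := by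
  intro S
  obtain ⟨T, hT⟩ := hf S
  obtain ⟨U, hU⟩ := hh T
  exact ⟨U, fun a ha => hU _ (hT a ha)⟩

theorem preservesLocal_conj {S : Finset ℤ} {u : unitary A.Alg} (hu : (u : A.Alg) ∈ A.sub S) :
    PreservesLocal (Unitary.conjStarAlgAut ℂ A.Alg u) := by
  classical
  intro T
  refine ⟨S ∪ T, fun a ha => ?_⟩
  have hu' := A.sub_mono (Finset.coe_subset.2 (Finset.subset_union_left (s₂ := T))) hu
  exact mul_mem (mul_mem hu' (A.sub_mono (Finset.coe_subset.2 Finset.subset_union_right) ha))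
    (star_mem hu')

end SpinChain

end

/-! ### The boundary algebra of a quantum cellular automaton at a cut. -/

noncomputable section
open scoped TensorProduct CStarAlgebra

namespace SpinChain

variable {A : SpinChain}

theorem fatten_Ici (m : ℤ) (r : ℕ) : fatten (Set.Ici m) r = Set.Ici (m - r) := by
  ext j
  simp only [fatten, Set.mem_ofPred_eq, Set.mem_Ici, abs_le]
  constructor
  · rintro ⟨i, hi, h1, h2⟩
    linarith
  · intro h
    exact ⟨max j m, le_max_right _ _, by rcases max_cases j m with h' | h' <;> omega,
      by rcases max_cases j m with h' | h' <;> omega⟩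

theorem fatten_Iio (m : ℤ) (r : ℕ) : fatten (Set.Iio m) r = Set.Iio (m + r) := by
  ext j
  simp only [fatten, Set.mem_ofPred_eq, Set.mem_Iio, abs_le]
  constructor
  · rintro ⟨i, hi, h1, h2⟩
    linarith
  · intro h
    -- The last site of the open half line is m - 1.
    exact ⟨min j (m - 1), by rcases min_cases j (m - 1) with h' | h' <;> omega,
      by rcases min_cases j (m - 1) with h' | h' <;> omega,
      by rcases min_cases j (m - 1) with h' | h' <;> omega⟩

/-- The image of `𝒜_X` under an automorphism. -/
def img (α : A.Alg ≃⋆ₐ[ℂ] A.Alg) (X : Set ℤ) : StarSubalgebra ℂ A.Alg :=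
  (A.sub X).comap (autHom α.symm)

theorem mem_img {α : A.Alg ≃⋆ₐ[ℂ] A.Alg} {X : Set ℤ} {a : A.Alg} :
    a ∈ img α X ↔ α.symm a ∈ A.sub X := Iff.rfl

theorem apply_mem_img {α : A.Alg ≃⋆ₐ[ℂ] A.Alg} {X : Set ℤ} {a : A.Alg} :
    α a ∈ img α X ↔ a ∈ A.sub X := by
  rw [mem_img, StarAlgEquiv.symm_apply_apply]

theorem img_mono (α : A.Alg ≃⋆ₐ[ℂ] A.Alg) {X Y : Set ℤ} (h : X ⊆ Y) : img α X ≤ img α Y :=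
  fun _ ha => A.sub_mono h ha

theorem commute_img {α : A.Alg ≃⋆ₐ[ℂ] A.Alg} {X Y : Set ℤ} (h : Disjoint X Y) {a b : A.Alg}
    (ha : a ∈ img α X) (hb : b ∈ img α Y) : Commute a b := by
  have := (commute_of_disjoint h (mem_img.1 ha) (mem_img.1 hb)).map α
  rwa [StarAlgEquiv.apply_symm_apply, StarAlgEquiv.apply_symm_apply] at this

/-- Haag duality, transported by α. -/
theorem mem_img_compl {α : A.Alg ≃⋆ₐ[ℂ] A.Alg} {X : Set ℤ} {a : A.Alg}
    (h : ∀ b ∈ img α X, Commute b a) : a ∈ img α Xᶜ := by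
  rw [mem_img]
  refine mem_sub_compl fun b hb => ?_
  have := (h _ (apply_mem_img.2 hb)).map α.symm
  rwa [StarAlgEquiv.symm_apply_apply] at this

theorem exists_scalar_of_mem_img {α : A.Alg ≃⋆ₐ[ℂ] A.Alg} {X Y : Set ℤ} (h : Disjoint X Y)
    {a : A.Alg} (hX : a ∈ img α X) (hY : a ∈ img α Y) : ∃ c : ℂ, a = c • (1 : A.Alg) := by
  have := mem_sub_inter (mem_img.1 hX) (mem_img.1 hY)
  rw [Set.disjoint_iff_inter_eq_empty.1 h] at this
  obtain ⟨c, hc⟩ := exists_scalar_of_mem_sub_empty this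
  have h1 := congrArg α (hc)
  rw [map_smul, map_one, StarAlgEquiv.apply_symm_apply] at h1
  exact ⟨c, h1⟩

/-- The image of `𝒜_X` is generated by `𝒜_Z` and its part in `𝒜_M`, if `𝒜_Z ⊆ α(𝒜_X) ⊆ 𝒜_{Z ∪ M}`. -/
theorem img_le {α : A.Alg ≃⋆ₐ[ℂ] A.Alg} (hα : PreservesLocal α) {X Z M : Set ℤ}
    (h1 : A.sub Z ≤ img α X) (h2 : img α X ≤ A.sub (Z ∪ M)) {K : Subalgebra ℂ A.Alg}
    (hK : IsClosed (K : Set A.Alg)) (hZ : ∀ a ∈ A.sub Z, a ∈ K)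
    (hM : ∀ a ∈ img α X, a ∈ A.sub M → a ∈ K) {a : A.Alg} (ha : a ∈ img α X) : a ∈ K := by
  classical
  suffices h : (A.sub X : Set A.Alg) ⊆ α ⁻¹' K by
    have := h (mem_img.1 ha)
    rwa [Set.mem_preimage, StarAlgEquiv.apply_symm_apply] at this
  have hc : Continuous α := map_continuous (autHom α)
  refine sub_le_of_finset (hK.preimage hc) fun S hS a ha => ?_
  obtain ⟨T, hT⟩ := hα S
  let U := T.filter (· ∈ Z)
  have hUZ : (U : Set ℤ) ⊆ Z := fun j hj => (Finset.mem_filter.1 hj).2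
  have haX : α a ∈ img α X := apply_mem_img.2 (A.sub_mono hS ha)
  have haT : α a ∈ A.sub ((Z ∪ M) ∩ T) := mem_sub_inter (h2 haX) (hT a ha)
  have he := A.isMatrixUnits_units U
  rw [Set.mem_preimage, SetLike.mem_coe, ← he.sum_mul_coeff (α a)]
  have heU : ∀ x y, A.units U x y ∈ A.sub Z := fun x y => A.sub_mono hUZ (A.units_mem U x y)
  -- Here U is the part in Z of a finite support of α a. The coefficients stay in α(𝒜_X), which
  -- contains the units; they commute with 𝒜_U, so Haag duality confines them to M.
  refine sum_mem fun x _ => sum_mem fun y _ => mul_mem (hZ _ (heU x y)) (hM _ ?_ ?_)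
  · exact IsMatrixUnits.coeff_mem (fun x y => h1 (heU x y)) x y haX
  · have h3 : IsMatrixUnits.coeff (A.units U) x y (α a) ∈ A.sub ((Z ∪ M) ∩ T) := by
      refine IsMatrixUnits.coeff_mem (fun x y => A.sub_mono ?_ (A.units_mem U x y)) x y haT
      intro j hj
      exact ⟨Or.inl (hUZ hj), (Finset.mem_filter.1 hj).1⟩
    refine A.sub_mono ?_ (mem_sub_diff (X := U) h3 fun b hb =>
      commute_of_spans (fun u v => he.commute_coeff x y u v (α a)) hb)
    rintro j ⟨⟨hj | hj, hjT⟩, hjU⟩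
    · exact absurd (Finset.mem_filter.2 ⟨hjT, hj⟩) hjU
    · exact hj

theorem isClosed_centralizer (a : A.Alg) :
    IsClosed (Subalgebra.centralizer ℂ {a} : Set A.Alg) := by
  have : (Subalgebra.centralizer ℂ {a} : Set A.Alg) = {b | a * b = b * a} := by
    ext b
    rw [SetLike.mem_coe, Subalgebra.mem_centralizer_iff]
    simp
  rw [this]
  exact isClosed_eq (by fun_prop) (by fun_prop)

theorem mem_centralizer_singleton {a b : A.Alg} :
    b ∈ Subalgebra.centralizer ℂ {a} ↔ Commute b a := by
  simp only [Subalgebra.mem_centralizer_iff, Set.mem_singleton_iff, forall_eq]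
  exact eq_comm

section Boundary

variable {α : A.Alg ≃⋆ₐ[ℂ] A.Alg} {R : ℕ}

theorem sub_Ici_le_img (hα' : IsRangeLE α.symm R) (m : ℤ) :
    A.sub (Set.Ici (m + R)) ≤ img α (Set.Ici m) := by
  intro a ha
  have := hα' _ a ha
  rwa [fatten_Ici, add_sub_cancel_right] at this

theorem img_Ici_le (hα : IsRangeLE α R) (m : ℤ) :
    img α (Set.Ici m) ≤ A.sub (Set.Ici (m - R)) := by
  intro a ha
  have := hα _ _ (mem_img.1 ha)
  rwa [fatten_Ici, StarAlgEquiv.apply_symm_apply] at this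

theorem sub_Iio_le_img (hα' : IsRangeLE α.symm R) (m : ℤ) :
    A.sub (Set.Iio (m - R)) ≤ img α (Set.Iio m) := by
  intro a ha
  have := hα' _ a ha
  rwa [fatten_Iio, sub_add_cancel] at this

theorem img_Iio_le (hα : IsRangeLE α R) (m : ℤ) :
    img α (Set.Iio m) ≤ A.sub (Set.Iio (m + R)) := by
  intro a ha
  have := hα _ _ (mem_img.1 ha)
  rwa [fatten_Iio, StarAlgEquiv.apply_symm_apply] at this

/-- By `img_le`, α(𝒜_{≥m}) is generated by 𝒜_{≥m+R} and the boundary algebra, so commutation with a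
need only be tested on these two; the closed subalgebra is the centralizer of a. -/
theorem commute_img_Ici (hα : IsRangeLE α R) (hα' : IsRangeLE α.symm R) (m : ℤ)
    {a : A.Alg} (h1 : ∀ b ∈ A.sub (Set.Ici (m + R)), Commute b a)
    (h2 : ∀ b ∈ img α (Set.Ici m), b ∈ A.sub (Set.Ico (m - R) (m + R)) → Commute b a)
    {b : A.Alg} (hb : b ∈ img α (Set.Ici m)) : Commute b a := by
  rw [← mem_centralizer_singleton]
  have hs : Set.Ici (m - R : ℤ) ⊆ Set.Ici (m + R : ℤ) ∪ Set.Ico (m - R : ℤ) (m + R) := by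
    intro j hj
    rcases lt_or_ge j (m + R) with h | h
    · exact Or.inr ⟨hj, h⟩
    · exact Or.inl h
  have h3 := (img_Ici_le hα m).trans (A.sub_mono hs)
  have h4 : PreservesLocal α := IsQCA.preservesLocal ⟨R, hα⟩
  have h5 := img_le h4 (sub_Ici_le_img hα' m) h3 (isClosed_centralizer a)
  refine h5 (fun b hb => ?_) (fun b hb hb' => ?_) hb
  · exact mem_centralizer_singleton.2 (h1 b hb)
  · exact mem_centralizer_singleton.2 (h2 b hb hb')

theorem commute_img_Iio (hα : IsRangeLE α R) (hα' : IsRangeLE α.symm R) (m : ℤ)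
    {a : A.Alg} (h1 : ∀ b ∈ A.sub (Set.Iio (m - R)), Commute b a)
    (h2 : ∀ b ∈ img α (Set.Iio m), b ∈ A.sub (Set.Ico (m - R) (m + R)) → Commute b a)
    {b : A.Alg} (hb : b ∈ img α (Set.Iio m)) : Commute b a := by
  rw [← mem_centralizer_singleton]
  have hs : Set.Iio (m + R : ℤ) ⊆ Set.Iio (m - R : ℤ) ∪ Set.Ico (m - R : ℤ) (m + R) := by
    intro j hj
    rcases lt_or_ge j (m - R) with h | h
    · exact Or.inl h
    · exact Or.inr ⟨h, hj⟩
  have h3 := (img_Iio_le hα m).trans (A.sub_mono hs)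
  have h4 : PreservesLocal α := IsQCA.preservesLocal ⟨R, hα⟩
  have h5 := img_le h4 (sub_Iio_le_img hα' m) h3 (isClosed_centralizer a)
  refine h5 (fun b hb => ?_) (fun b hb hb' => ?_) hb
  · exact mem_centralizer_singleton.2 (h1 b hb)
  · exact mem_centralizer_singleton.2 (h2 b hb hb')

/-- The boundary algebra `α(𝒜_{≥ m}) ∩ 𝒜_{[m - R, m + R)}` is spanned by matrix units, and its
commutant in `α(𝒜_{≥ m})` is `𝒜_{≥ m + R}`. -/
theorem exists_boundary_units (hα : IsRangeLE α R) (hα' : IsRangeLE α.symm R) (m : ℤ)  :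
    ∃ (n : ℕ) (e : Fin n → Fin n → A.Alg), 0 < n ∧ IsMatrixUnits e ∧
    (∀ x y, e x y ∈ img α (Set.Ici m)) ∧ (∀ x y, e x y ∈ A.sub (Set.Ico (m - R) (m + R))) ∧
    ∀ a ∈ img α (Set.Ici m), (∀ x y, Commute (e x y) a) → a ∈ A.sub (Set.Ici (m + R)) := by
  let M : Finset ℤ := Finset.Ico (m - R) (m + R)
  have hM : (M : Set ℤ) = Set.Ico (m - R) (m + R) := Finset.coe_Ico _ _
  have hdisj : Disjoint (Set.Ici m) (Set.Iio m) := (Set.Iio_disjoint_Ici le_rfl).symm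
  have hd1 : Disjoint (Set.Ici (m + R)) (Set.Ico (m - R) (m + R)) := by
    rw [Set.disjoint_left]
    intro j h1 h2
    exact absurd h2.2 (not_lt.2 h1)
  have hd2 : Disjoint (Set.Iio (m - R)) (Set.Ico (m - R) (m + R)) := by
    rw [Set.disjoint_left]
    intro j h1 h2
    exact absurd h1 (not_lt.2 h2.1)
  let B : StarSubalgebra ℂ A.Alg := img α (Set.Ici m) ⊓ A.sub M
  have hB : ∀ {b}, b ∈ B ↔ b ∈ img α (Set.Ici m) ∧ b ∈ A.sub (Set.Ico (m - R) (m + R)) := by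
    intro b
    rw [← hM]
    exact Iff.rfl
  -- The commutant of B within the window lies in α(𝒜_{<m}): its elements also commute with
  -- 𝒜_{≥m+R}, hence with all of α(𝒜_{≥m}).
  have hcomm : ∀ a ∈ A.sub (Set.Ico (m - R) (m + R)), (∀ b ∈ B, Commute b a) →
      a ∈ img α (Set.Iio m) := by
    intro a ha hab
    rw [← Set.compl_Ici]
    refine mem_img_compl fun b hb => commute_img_Ici hα hα' m
      (fun b hb => commute_of_disjoint hd1 hb ha) (fun b hb hb' => hab b (hB.2 ⟨hb, hb'⟩)) hb
  -- Bicommutant property: the part of α(𝒜_{<m}) in the window commutes with B, so an element a of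
  -- the relative bicommutant commutes with α(𝒜_{<m}). Factor property: a central element of B lies
  -- in α(𝒜_{≥m}) ∩ α(𝒜_{<m}), which is ℂ.
  obtain ⟨n, e, hn, he, hs⟩ := exists_matrixUnits_of_factor (S := M) (B := B) inf_le_right
    (fun a ha hac => by
      rw [hM] at ha hac
      refine hB.2 ⟨?_, ha⟩
      rw [← Set.compl_Iio]
      refine mem_img_compl fun b hb => commute_img_Iio hα hα' m
        (fun b hb => commute_of_disjoint hd2 hb ha)
        (fun b hb hb' => (hac b hb' fun c hc => commute_img hdisj (hB.1 hc).1 hb).symm) hb)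
    (fun a ha hab => exists_scalar_of_mem_img hdisj (hB.1 ha).1 (hcomm a (hB.1 ha).2 hab))
  have heB := fun x y => hB.1 (hs.mem x y)
  refine ⟨n, e, hn, he, fun x y => (heB x y).1, fun x y => (heB x y).2, fun a ha hea => ?_⟩
  rw [← Set.compl_Iio]
  refine mem_sub_compl fun b hb => ?_
  have hun : Set.Iio (m - R : ℤ) ∪ Set.Ico (m - R : ℤ) (m + R) = Set.Iio (m + R : ℤ) := by
    ext j
    simp only [Set.mem_union, Set.mem_Iio, Set.mem_Ico]
    omega
  rw [← hun] at hb
  rw [← mem_centralizer_singleton]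
  have h1 := sub_union_le (X := Set.Iio (m - R : ℤ)) (Y := Set.Ico (m - R : ℤ) (m + R))
    (isClosed_centralizer a)
  refine h1 (fun b hb => ?_) (fun b hb => ?_) hb <;> rw [mem_centralizer_singleton]
  · refine commute_of_disjoint ?_ hb (img_Ici_le hα m ha)
    exact Set.Iio_disjoint_Ici le_rfl
  -- An element b of the window is expanded in the units of B. Its coefficients lie in the commutant
  -- of B, hence in α(𝒜_{<m}), and so commute with a.
  · rw [← he.sum_mul_coeff b]
    refine Commute.sum_left _ _ _ fun x _ => Commute.sum_left _ _ _ fun y _ =>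
      (hea x y).mul_left ?_
    refine (commute_img hdisj ha (hcomm _ ?_ fun c hc => ?_)).symm
    · exact IsMatrixUnits.coeff_mem (fun x y => (heB x y).2) x y hb
    · exact hs.commute (fun u v => he.commute_coeff x y u v b) hc

end Boundary

end SpinChain

end

/-! ### Triviality of the index for finite groups, and decoupling at a cut. -/

noncomputable section
open scoped TensorProduct CStarAlgebra

namespace SpinChain

variable {A : SpinChain} {G : Type} [Group G]

theorem Symmetry.symm_apply (α : Symmetry G A) (g : G) (a : A.Alg) :
    (α.toHom g).symm a = α.toHom g⁻¹ a := by
  rw [map_inv]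
  rfl

theorem Symmetry.mul_apply (α : Symmetry G A) (g h : G) (a : A.Alg) :
    α.toHom (g * h) a = α.toHom g (α.toHom h a) := by
  rw [map_mul]
  rfl

theorem Symmetry.inv_apply_self (α : Symmetry G A) (g : G) (a : A.Alg) :
    α.toHom g⁻¹ (α.toHom g a) = a := by
  rw [← α.mul_apply, inv_mul_cancel, map_one]
  rfl

theorem Symmetry.apply_inv_self (α : Symmetry G A) (g : G) (a : A.Alg) :
    α.toHom g (α.toHom g⁻¹ a) = a := by
  rw [← α.mul_apply, mul_inv_cancel, map_one]
  rfl

theorem Symmetry.IsRangeLE.symm {α : Symmetry G A} {R : ℕ} (hR : α.IsRangeLE R) (g : G) :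
    SpinChain.IsRangeLE (α.toHom g).symm R := by
  intro X a ha
  rw [α.symm_apply]
  exact hR g⁻¹ X a ha

theorem Symmetry.mem_img_mul {α : Symmetry G A} {g h : G} {X : Set ℤ} {a : A.Alg} :
    a ∈ img (α.toHom (h * g)) X ↔ α.toHom h⁻¹ a ∈ img (α.toHom g) X := by
  rw [mem_img, mem_img, α.symm_apply, α.symm_apply, mul_inv_rev, α.mul_apply]

theorem finiteDimensional_of_le_sub {S : Finset ℤ} {C : StarSubalgebra ℂ A.Alg} (h : C ≤ A.sub S) :
    FiniteDimensional ℂ C := by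
  have := (A.spans_units S).finiteDimensional
  exact Submodule.finiteDimensional_of_le
    (S₁ := Subalgebra.toSubmodule C.toSubalgebra)
    (S₂ := Subalgebra.toSubmodule (A.sub S).toSubalgebra) h

theorem Ici_diff_Ico (m k : ℤ) : Set.Ici m \ Set.Ico m k ⊆ Set.Ici k := by
  rintro j ⟨h1, h2⟩
  exact not_lt.1 fun h => h2 ⟨h1, h⟩

theorem disjoint_Ici_Ico (m k : ℤ) : Disjoint (Set.Ici k) (Set.Ico m k) := by
  rw [Set.disjoint_left]
  intro j h1 h2
  exact absurd h2.2 (not_lt.2 h1)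

/-- A positive function on a finite group which is multiplicative up to a constant is constant. -/
theorem eq_of_mul_eq_mul [Finite G] (n : G → ℕ) (D : ℕ) (hD : 0 < D) (hn : ∀ g, 0 < n g)
    (h : ∀ g k, n (k * g) * D = n g * n k) (g : G) : n g = D := by
  have hD' : (D : ℚ) ≠ 0 := by positivity
  have hmul : ∀ g k, (n (k * g) : ℚ) / D = n k / D * (n g / D) := by
    intro g k
    have : (n (k * g) : ℚ) * D = n g * n k := by exact_mod_cast h g k
    field_simp
    linarith
  have h1 : (n 1 : ℚ) / D = 1 := by
    have h2 := hmul 1 1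
    rw [one_mul] at h2
    have h3 : (n 1 : ℚ) / D ≠ 0 := by
      have := hn 1
      positivity
    exact (mul_eq_left₀ h3).1 h2.symm
  -- The quotient n/D is a homomorphism to the positive rationals, and an element of finite order
  -- there is 1.
  have hpow : ∀ k : ℕ, (n (g ^ k) : ℚ) / D = (n g / D) ^ k := by
    intro k
    induction k with
    | zero => rw [pow_zero, pow_zero, h1]
    | succ k ih => rw [pow_succ, pow_succ, hmul, ih]
  have h2 := hpow (Nat.card G)
  rw [pow_card_eq_one', h1] at h2
  have h3 : (n g : ℚ) / D = 1 :=
    (pow_eq_one_iff_of_nonneg (by positivity) Nat.card_pos.ne').1 h2.symm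
  rw [div_eq_one_iff_eq hD'] at h3
  exact_mod_cast h3

/-- The boundary algebras of a finite group of quantum cellular automata have the dimension of the
algebra of `R` sites. -/
theorem exists_boundary_units_card [Finite G] (α : Symmetry G A) {R : ℕ} (hR : α.IsRangeLE R)
    (m : ℤ) (g : G) :
    ∃ e : A.FinConfig (Finset.Ico m (m + R)) → A.FinConfig (Finset.Ico m (m + R)) → A.Alg,
      IsMatrixUnits e ∧ (∀ x y, e x y ∈ img (α.toHom g) (Set.Ici m)) ∧
      (∀ x y, e x y ∈ A.sub (Set.Ico (m - R) (m + R))) ∧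
      ∀ a ∈ img (α.toHom g) (Set.Ici m), (∀ x y, Commute (e x y) a) →
        a ∈ A.sub (Set.Ici (m + R)) := by
  have hex := fun g => exists_boundary_units (hR g) (hR.symm g) m
  choose n e hn he heI heM heC using hex
  let P := Finset.Ico m (m + R)
  have hP : (P : Set ℤ) = Set.Ico m (m + R) := Finset.coe_Ico _ _
  let D := Fintype.card (A.FinConfig P)
  have hD : 0 < D := Fintype.card_pos
  -- The windows end at m + R, and a further automaton of range R moves their content by at most R
  -- more.
  let N : ℤ := m + R + R
  let Q := Finset.Ico (m + R) N
  have hQ : (Q : Set ℤ) = Set.Ico (m + R) N := Finset.coe_Ico _ _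
  let w := Module.finrank ℂ (A.sub Q)
  have hw : 0 < w := by
    have := (A.spans_units Q).finrank (A.isMatrixUnits_units Q)
    have h2 : 0 < Fintype.card (A.FinConfig Q) := Fintype.card_pos
    change 0 < Module.finrank ℂ (A.sub Q)
    rw [this]
    positivity
  -- Three expressions for the dimension of F. The boundary units of g have relative commutant 𝒜_Q,
  -- of dimension w. The α^(g)-images of the units of P have relative commutant C g. The
  -- α^(k)-images of the boundary units of g have relative commutant C k in F (k * g). Eliminating
  -- dim C k gives n(kg) D = n(g) n(k).
  let F : G → StarSubalgebra ℂ A.Alg := fun g => img (α.toHom g) (Set.Ici m) ⊓ A.sub (Set.Iio N)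
  let C : G → StarSubalgebra ℂ A.Alg :=
    fun g => img (α.toHom g) (Set.Ici (m + R)) ⊓ A.sub (Set.Iio N)
  have hF1 : ∀ g, Module.finrank ℂ (F g) = n g ^ 2 * w := by
    intro g
    have := (A.spans_units Q).finiteDimensional
    rw [(he g).finrank_eq (R := F g) (C := A.sub Q), Fintype.card_fin]
    · refine fun x y => ⟨heI g x y, A.sub_mono ?_ (heM g x y)⟩
      intro j hj
      have := hj.2
      simp only [Set.mem_Iio, N]
      omega
    · intro a
      rw [hQ]
      constructor
      · intro ha
        have h1 : a ∈ A.sub (Set.Ici (m + R)) := A.sub_mono Set.Ico_subset_Ici_self ha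
        exact ⟨⟨sub_Ici_le_img (hR.symm g) m h1, A.sub_mono Set.Ico_subset_Iio_self ha⟩,
          fun x y => (commute_of_disjoint (disjoint_Ici_Ico _ _) h1 (heM g x y)).symm⟩
      · rintro ⟨⟨h1, h2⟩, h3⟩
        have := mem_sub_inter (heC g a h1 h3) h2
        rwa [Set.Ici_inter_Iio] at this
  have hC : ∀ g, FiniteDimensional ℂ (C g) := by
    intro g
    refine finiteDimensional_of_le_sub (S := Finset.Ico m N) fun a ha => ?_
    have h1 := img_Ici_le (hR g) (m + R) ha.1
    rw [add_sub_cancel_right] at h1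
    have := mem_sub_inter h1 ha.2
    rwa [Set.Ici_inter_Iio, ← Finset.coe_Ico] at this
  have hIco : ∀ k (b : A.Alg), b ∈ A.sub (Set.Iio (m + R : ℤ)) →
      α.toHom k b ∈ A.sub (Set.Iio N) := by
    intro k b hb
    have := hR k _ b hb
    rwa [fatten_Iio] at this
  have hF2 : ∀ g, Module.finrank ℂ (F g) = D ^ 2 * Module.finrank ℂ (C g) := by
    intro g
    rw [((A.isMatrixUnits_units P).map (autHom (α.toHom g))).finrank_eq (R := F g) (C := C g)]
    · intro x y
      have h1 := A.units_mem P x y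
      rw [hP] at h1
      exact ⟨apply_mem_img.2 (A.sub_mono Set.Ico_subset_Ici_self h1),
        hIco g _ (A.sub_mono Set.Ico_subset_Iio_self h1)⟩
    · intro a
      constructor
      · rintro ⟨h1, h2⟩
        refine ⟨⟨img_mono _ (Set.Ici_subset_Ici.2 (by omega)) h1, h2⟩, fun x y => ?_⟩
        have h3 := A.units_mem P x y
        rw [hP] at h3
        exact (commute_img (disjoint_Ici_Ico m (m + R)) h1 (apply_mem_img.2 h3)).symm
      · rintro ⟨⟨h1, h2⟩, h3⟩
        refine ⟨mem_img.2 ?_, h2⟩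
        refine A.sub_mono (Ici_diff_Ico m (m + R)) ?_
        refine mem_sub_diff (mem_img.1 h1) fun b hb => ?_
        rw [← hP] at hb
        refine commute_of_spans (fun x y => ?_) hb
        have := (h3 x y).map (α.toHom g).symm
        rwa [autHom_apply, StarAlgEquiv.symm_apply_apply] at this
  -- Within α^(g)(𝒜_{≥m}) the boundary units have commutant 𝒜_{≥m+R}; applying α^(k) to the pair
  -- gives α^(k)(𝒜_{≥m+R}) inside α^(kg)(𝒜_{≥m}).
  have hF3 : ∀ g k, Module.finrank ℂ (F (k * g)) = n g ^ 2 * Module.finrank ℂ (C k) := by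
    intro g k
    rw [((he g).map (autHom (α.toHom k))).finrank_eq (R := F (k * g)) (C := C k),
      Fintype.card_fin]
    · intro x y
      refine ⟨Symmetry.mem_img_mul.2 ?_, hIco k _ (A.sub_mono Set.Ico_subset_Iio_self (heM g x y))⟩
      rw [autHom_apply, α.inv_apply_self]
      exact heI g x y
    · intro a
      constructor
      · rintro ⟨h1, h2⟩
        have h1' := mem_img.1 h1
        rw [α.symm_apply] at h1'
        refine ⟨⟨?_, h2⟩, fun x y => ?_⟩
        · refine Symmetry.mem_img_mul.2 ?_
          exact sub_Ici_le_img (hR.symm g) m h1'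
        · have := (commute_of_disjoint (disjoint_Ici_Ico _ _) h1' (heM g x y)).symm.map (α.toHom k)
          rwa [α.apply_inv_self] at this
      · rintro ⟨⟨h1, h2⟩, h3⟩
        refine ⟨mem_img.2 ?_, h2⟩
        rw [α.symm_apply]
        refine heC g _ (Symmetry.mem_img_mul.1 h1) fun x y => ?_
        have := (h3 x y).map (α.toHom k⁻¹)
        rwa [autHom_apply, α.inv_apply_self] at this
  have hng : n g = D := by
    refine eq_of_mul_eq_mul n D hD hn (fun g k => ?_) g
    have h1 := hF1 (k * g)
    have h2 := hF1 k
    rw [hF3 g k] at h1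
    rw [hF2 k] at h2
    have h3 : (n (k * g) * D) ^ 2 * w = (n g * n k) ^ 2 * w := by
      calc (n (k * g) * D) ^ 2 * w = n (k * g) ^ 2 * w * D ^ 2 := by ring
        _ = n g ^ 2 * (D ^ 2 * Module.finrank ℂ (C k)) := by rw [← h1]; ring
        _ = (n g * n k) ^ 2 * w := by rw [h2]; ring
    exact Nat.pow_left_injective (n := 2) (by norm_num) (Nat.eq_of_mul_eq_mul_right hw h3)
  let φ : A.FinConfig P ≃ Fin (n g) := Fintype.equivFinOfCardEq hng.symm
  refine ⟨fun x y => e g (φ x) (φ y), ⟨fun x y z => (he g).mul_same _ _ _,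
    fun x y z w h => (he g).mul_ne _ _ _ _ fun hh => h (φ.injective hh),
    fun x y => (he g).star _ _, ?_⟩, fun x y => heI g _ _, fun x y => heM g _ _,
    fun a ha h => heC g a ha fun x y => ?_⟩
  · rw [← (he g).sum]
    exact φ.sum_comp fun x => e g x x
  · simpa using h (φ.symm x) (φ.symm y)

/-- A finite group of quantum cellular automata can be decoupled at a cut by local unitaries. -/
theorem exists_unitary_preserving [Finite G] (α : Symmetry G A) {R : ℕ} (hR : α.IsRangeLE R)
    (m : ℤ) (g : G) : ∃ u : unitary A.Alg, (u : A.Alg) ∈ A.sub (Set.Ico (m - R) (m + R)) ∧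
      (∀ a ∈ A.sub (Set.Ici m), (u : A.Alg) * α.toHom g a * star (u : A.Alg) ∈ A.sub (Set.Ici m)) ∧
      ∀ a ∈ A.sub (Set.Ici m),
        α.toHom g⁻¹ (star (u : A.Alg) * a * (u : A.Alg)) ∈ A.sub (Set.Ici m) := by
  obtain ⟨e, he, heI, heM, heC⟩ := exists_boundary_units_card α hR m g
  let P := Finset.Ico m (m + R)
  have hP : (P : Set ℤ) = Set.Ico m (m + R) := Finset.coe_Ico _ _
  have hf := A.isMatrixUnits_units P
  have hPM : Set.Ico m (m + R) ⊆ Set.Ico (m - R) (m + R) :=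
    Set.Ico_subset_Ico_left (by omega)
  have hfP : ∀ x y, A.units P x y ∈ A.sub (Set.Ico m (m + R)) := by
    intro x y
    rw [← hP]
    exact A.units_mem P x y
  -- The equality of sizes permits a unitary of the window that carries the boundary units to the
  -- units of the sites [m, m+R).
  obtain ⟨u, hu, h⟩ := exists_unitary_mem_sub (S := Finset.Ico (m - R) (m + R)) he hf
    (by rw [Finset.coe_Ico]; exact heM)
    (by rw [Finset.coe_Ico]; exact fun x y => A.sub_mono hPM (hfP x y))
  rw [Finset.coe_Ico] at hu
  have huu : (u : A.Alg) * star (u : A.Alg) = 1 := Unitary.mul_star_self_of_mem u.2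
  have huu' : star (u : A.Alg) * (u : A.Alg) = 1 := Unitary.star_mul_self_of_mem u.2
  have hcomm : ∀ c ∈ A.sub (Set.Ici (m + R)), Commute c (u : A.Alg) := fun c hc =>
    commute_of_disjoint (disjoint_Ici_Ico _ _) hc hu
  have hmono : A.sub (Set.Ici (m + R)) ≤ A.sub (Set.Ici m) :=
    A.sub_mono (Set.Ici_subset_Ici.2 (by omega))
  refine ⟨u, hu, fun a ha => ?_, fun a ha => ?_⟩
  · have ha' : α.toHom g a ∈ img (α.toHom g) (Set.Ici m) := apply_mem_img.2 ha
    rw [← he.sum_mul_coeff (α.toHom g a)]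
    simp only [Finset.mul_sum, Finset.sum_mul]
    refine sum_mem fun x _ => sum_mem fun y _ => ?_
    have hc := heC _ (IsMatrixUnits.coeff_mem heI x y ha') fun u v => he.commute_coeff x y u v _
    set c := IsMatrixUnits.coeff e x y (α.toHom g a)
    -- Conjugation by u turns the boundary unit into a unit of P and fixes the coefficient, which
    -- lies in 𝒜_{≥m+R}, out of reach of u.
    have : (u : A.Alg) * (e x y * c) * star (u : A.Alg) = A.units P x y * c := by
      calc (u : A.Alg) * (e x y * c) * star (u : A.Alg)
          = (u * e x y) * c * star (u : A.Alg) := by noncomm_ring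
        _ = A.units P x y * ((u : A.Alg) * c) * star (u : A.Alg) := by rw [h]; noncomm_ring
        _ = A.units P x y * c * (u * star (u : A.Alg)) := by
          rw [← (hcomm c hc).eq]; noncomm_ring
        _ = A.units P x y * c := by rw [huu, mul_one]
    rw [this]
    exact mul_mem (A.sub_mono Set.Ico_subset_Ici_self (hfP x y)) (hmono hc)
  · rw [← α.symm_apply, ← mem_img, ← hf.sum_mul_coeff a]
    simp only [Finset.mul_sum, Finset.sum_mul]
    refine sum_mem fun x _ => sum_mem fun y _ => ?_
    set c := IsMatrixUnits.coeff (A.units P) x y a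
    have hc : c ∈ A.sub (Set.Ici (m + R)) := by
      refine A.sub_mono (Ici_diff_Ico m (m + R)) (mem_sub_diff ?_ fun b hb => ?_)
      · exact IsMatrixUnits.coeff_mem (fun x y => A.sub_mono Set.Ico_subset_Ici_self (hfP x y))
          x y ha
      · rw [← hP] at hb
        exact commute_of_spans (fun u v => hf.commute_coeff x y u v a) hb
    have : star (u : A.Alg) * (A.units P x y * c) * (u : A.Alg) = e x y * c := by
      calc star (u : A.Alg) * (A.units P x y * c) * (u : A.Alg)
          = star (u : A.Alg) * A.units P x y * (c * (u : A.Alg)) := by noncomm_ring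
        _ = star (u : A.Alg) * (A.units P x y * (u : A.Alg)) * c := by
          rw [(hcomm c hc).eq]; noncomm_ring
        _ = (star (u : A.Alg) * u) * (e x y * c) := by rw [← h]; noncomm_ring
        _ = e x y * c := by rw [huu', one_mul]
    rw [this]
    exact mul_mem (heI x y) (sub_Ici_le_img (hR.symm g) m hc)

end SpinChain

end

/-! ### Restrictions, crossing operators, phases and the definition of the anomaly. -/

noncomputable section
open scoped TensorProduct CStarAlgebra

namespace TwistedCircle

variable {G : Type} [Group G]

theorem isMulCocycle₂_iff {c : G × G → TwistedCircle G} : groupCohomology.IsMulCocycle₂ c ↔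
    ∀ g k l m, c (k * l, m) g * c (k, l) g = c (l, m) (k⁻¹ * g * k) * c (k, l * m) g :=
  ⟨fun h g k l m => congrFun (h k l m) g, fun h k l m => funext fun g => h g k l m⟩

/-- The hypothesis says, without division, that c/d is the coboundary of x. -/
theorem mk_eq_mk {c d : G × G → TwistedCircle G} (hc : groupCohomology.IsMulCocycle₂ c)
    (hd : groupCohomology.IsMulCocycle₂ d) (x : G → TwistedCircle G)
    (h : ∀ k l, c (k, l) * x (k * l) = k • x l * x k * d (k, l)) : mk c hc = mk d hd := by
  rw [mk, mk, groupCohomology.H2π_eq_iff]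
  have hb : groupCohomology.IsMulCoboundary₂ (c / d) := by
    refine ⟨x, fun k l => ?_⟩
    rw [Pi.div_apply, eq_div_iff_mul_eq', div_mul_eq_mul_div, div_mul_eq_mul_div,
      div_eq_iff_eq_mul, h]
  exact (groupCohomology.coboundariesOfIsMulCoboundary₂ hb).2

theorem mk_mul {c d : G × G → TwistedCircle G} (hc : groupCohomology.IsMulCocycle₂ c)
    (hd : groupCohomology.IsMulCocycle₂ d) (hcd : groupCohomology.IsMulCocycle₂ (c * d)) :
    mk (c * d) hcd = mk c hc + mk d hd := by
  rw [mk, mk, mk, ← map_add]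
  rfl

theorem mk_one (h : groupCohomology.IsMulCocycle₂ (1 : G × G → TwistedCircle G)) :
    mk 1 h = 0 := by
  rw [mk, groupCohomology.H2π_eq_zero_iff]
  exact (groupCohomology.coboundaries₂ _).zero_mem

end TwistedCircle

namespace SpinChain

variable {A B : SpinChain}

/-- The image of a unitary under a `*`-isomorphism. -/
def mapUnitary (φ : A.Alg ≃⋆ₐ[ℂ] B.Alg) (u : unitary A.Alg) : unitary B.Alg :=
  ⟨φ u, Unitary.map_mem φ u.2⟩

theorem conj_mapUnitary (φ : A.Alg ≃⋆ₐ[ℂ] B.Alg) (u : unitary A.Alg) (a : A.Alg) :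
    Unitary.conjStarAlgAut ℂ B.Alg (mapUnitary φ u) (φ a) =
      φ (Unitary.conjStarAlgAut ℂ A.Alg u a) := by
  rw [Unitary.conjStarAlgAut_apply, Unitary.conjStarAlgAut_apply, map_mul, map_mul, map_star]
  rfl

theorem conj_mapUnitary_eq (α : A.Alg ≃⋆ₐ[ℂ] A.Alg) (u : unitary A.Alg) :
    Unitary.conjStarAlgAut ℂ A.Alg (mapUnitary α u) =
      α * Unitary.conjStarAlgAut ℂ A.Alg u * α⁻¹ := by
  rw [eq_mul_inv_iff_mul_eq]
  exact StarAlgEquiv.ext fun a => conj_mapUnitary α u a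

theorem smul_injective {v : unitary A.Alg} {c d : ℂ} (h : c • (v : A.Alg) = d • (v : A.Alg)) :
    c = d := by
  have h1 := congrArg (fun x => x * star (v : A.Alg)) h
  simp only [smul_mul_assoc, Unitary.mul_star_self_of_mem v.2] at h1
  have h2 : (c - d) • (1 : A.Alg) = 0 := by rw [sub_smul, h1, sub_self]
  exact sub_eq_zero.1 ((smul_eq_zero.1 h2).resolve_right one_ne_zero)

/-- If u and v induce the same conjugation, star v * u is central and hence a scalar, of modulus 1
because both norms are 1. -/
theorem exists_phase {u v : unitary A.Alg}
    (h : Unitary.conjStarAlgAut ℂ A.Alg u = Unitary.conjStarAlgAut ℂ A.Alg v) :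
    ∃ c : Circle, (u : A.Alg) = (c : ℂ) • (v : A.Alg) := by
  have huu := Unitary.star_mul_self_of_mem u.2
  have hvv := Unitary.star_mul_self_of_mem v.2
  have hvv' := Unitary.mul_star_self_of_mem v.2
  obtain ⟨c, hc⟩ := exists_scalar_of_central (a := star (v : A.Alg) * (u : A.Alg)) fun b => by
    have h1 := DFunLike.congr_fun h b
    rw [Unitary.conjStarAlgAut_apply, Unitary.conjStarAlgAut_apply] at h1
    calc b * (star (v : A.Alg) * (u : A.Alg))
        = star (v : A.Alg) * (v : A.Alg) * b * star (v : A.Alg) * (u : A.Alg) := by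
          rw [hvv]; noncomm_ring
      _ = star (v : A.Alg) * ((v : A.Alg) * b * star (v : A.Alg)) * (u : A.Alg) := by noncomm_ring
      _ = star (v : A.Alg) * (u : A.Alg) * b * (star (u : A.Alg) * (u : A.Alg)) := by
          rw [← h1]; noncomm_ring
      _ = star (v : A.Alg) * (u : A.Alg) * b := by rw [huu, mul_one]
  have hu : (u : A.Alg) = c • (v : A.Alg) := by
    calc (u : A.Alg) = (v : A.Alg) * (star (v : A.Alg) * (u : A.Alg)) := by
          rw [← mul_assoc, hvv', one_mul]
      _ = c • (v : A.Alg) := by rw [hc, mul_smul_comm, mul_one]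
  have hn : ‖c‖ = 1 := by
    have h1 := CStarRing.norm_coe_unitary u
    have h2 := CStarRing.norm_coe_unitary v
    rw [hu, norm_smul, h2, mul_one] at h1
    exact h1
  exact ⟨⟨c, mem_sphere_zero_iff_norm.2 hn⟩, hu⟩

variable {G : Type} [Group G]

section Restriction

variable {α : Symmetry G A} {R : ℕ} {j : ℤ} {L : ℕ} {ρ : G → (A.Alg ≃⋆ₐ[ℂ] A.Alg)}

theorem Symmetry.exists_isRangeLE [Finite G] (α : Symmetry G A) : ∃ R, α.IsRangeLE R := by
  have := Fintype.ofFinite G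
  choose r hr using α.isQCA
  refine ⟨Finset.univ.sup r, fun g X a ha => A.sub_mono (fatten_mono X ?_) (hr g X a ha)⟩
  exact Finset.le_sup (Finset.mem_univ g)

theorem IsRightRestriction.inv_left (h : IsRightRestriction α j L ρ) (g : G) {a : A.Alg}
    (ha : a ∈ A.sub (Set.Iio (j - L))) : (ρ g)⁻¹ a = a := by
  have := congrArg (ρ g).symm (h.left g a ha)
  rw [StarAlgEquiv.symm_apply_apply] at this
  exact this.symm

/-- The margin R ensures that α^(g⁻¹) a still lies where ρ agrees with α, so that ρ sends it back to
a. -/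
theorem IsRightRestriction.inv_right (h : IsRightRestriction α j L ρ) (hR : α.IsRangeLE R) (g : G)
    {a : A.Alg} (ha : a ∈ A.sub (Set.Ici (j + L + R))) : (ρ g)⁻¹ a = α.toHom g⁻¹ a := by
  have h1 := hR g⁻¹ _ a ha
  rw [fatten_Ici, add_sub_cancel_right] at h1
  have := congrArg (ρ g).symm (h.right g _ h1)
  rw [StarAlgEquiv.symm_apply_apply, α.apply_inv_self] at this
  exact this.symm

theorem Ico_compl_subset (m n : ℤ) : (Set.Ico m n)ᶜ ⊆ Set.Iio m ∪ Set.Ici n := by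
  intro j hj
  rcases lt_or_ge j m with h | h
  · exact Or.inl h
  · exact Or.inr (not_lt.1 fun h' => hj ⟨h, h'⟩)

theorem aut_apply_eq_self {K : A.Alg ≃⋆ₐ[ℂ] A.Alg} {m n : ℤ}
    (h1 : ∀ a ∈ A.sub (Set.Iio m), K a = a) (h2 : ∀ a ∈ A.sub (Set.Ici n), K a = a) {a : A.Alg}
    (ha : a ∈ A.sub (Set.Ico m n)ᶜ) : K a = a :=
  eqOn_sub_union (autHom K) (StarAlgHom.id ℂ A.Alg) h1 h2 (A.sub_mono (Ico_compl_subset m n) ha)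

/-- Far to the left the restrictions act trivially and the two outer factors cancel. Far to the
right they coincide with α, and the product is the action of k (k⁻¹gk) k⁻¹ g⁻¹ = 1. -/
theorem IsRightRestriction.crossing_apply (h : IsRightRestriction α j L ρ) (hR : α.IsRangeLE R)
    (g k : G) {a : A.Alg} (ha : a ∈ A.sub (Set.Ico (j - L - R) (j + L + R + R))ᶜ) :
    (α.toHom k * ρ (k⁻¹ * g * k) * α.toHom k⁻¹ * (ρ g)⁻¹) a = a := by
  refine aut_apply_eq_self (fun a ha => ?_) (fun a ha => ?_) ha
  · change α.toHom k (ρ (k⁻¹ * g * k) (α.toHom k⁻¹ ((ρ g)⁻¹ a))) = a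
    have h1 := hR k⁻¹ _ a ha
    rw [fatten_Iio, sub_add_cancel] at h1
    rw [h.inv_left g (A.sub_mono (Set.Iio_subset_Iio (by omega)) ha), h.left _ _ h1,
      α.apply_inv_self]
  · change α.toHom k (ρ (k⁻¹ * g * k) (α.toHom k⁻¹ ((ρ g)⁻¹ a))) = a
    rw [h.inv_right hR g (A.sub_mono (Set.Ici_subset_Ici.2 (by omega)) ha), ← α.mul_apply,
      h.right, ← α.mul_apply, ← α.mul_apply]
    · rw [show k * (k⁻¹ * g * k) * (k⁻¹ * g⁻¹) = 1 by group, map_one]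
      rfl
    · have h1 := hR (k⁻¹ * g⁻¹) _ a ha
      rw [fatten_Ici, add_sub_cancel_right] at h1
      exact A.sub_mono (Set.Ici_subset_Ici.2 (by omega)) h1

/-- The explicit support is needed when symmetries are compared on an interval. -/
theorem IsRightRestriction.exists_crossing (h : IsRightRestriction α j L ρ) (hR : α.IsRangeLE R) :
    ∃ C, IsCrossing α ρ C ∧
      ∀ g k, (C g k : A.Alg) ∈ A.sub (Set.Ico (j - L - R) (j + L + R + R)) := by
  have hex : ∀ g k, ∃ u : unitary A.Alg,
      (u : A.Alg) ∈ A.sub ((Finset.Ico (j - L - R) (j + L + R + R) : Finset ℤ) : Set ℤ) ∧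
      α.toHom k * ρ (k⁻¹ * g * k) * α.toHom k⁻¹ * (ρ g)⁻¹ =
        Unitary.conjStarAlgAut ℂ A.Alg u := fun g k =>
    exists_conj_of_eq_id _ (by rw [Finset.coe_Ico]; exact fun a ha => h.crossing_apply hR g k ha)
  choose C hC hC' using hex
  exact ⟨C, ⟨fun g k => ⟨_, hC g k⟩, hC'⟩, by simpa only [Finset.coe_Ico] using hC⟩

theorem conj_index (g k l : G) : l⁻¹ * (k⁻¹ * g * k) * l = (k * l)⁻¹ * g * (k * l) := by group

/-- Once the defining relations are inserted, the factors `ρ (k⁻¹ * g * k)` and its inverse cancel,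
together with the adjacent α's. What is left is the automorphism implemented by `C g (k * l)`. -/
theorem IsCrossing.conj_mul {C : G → G → unitary A.Alg} (hC : IsCrossing α ρ C) (g k l : G) :
    Unitary.conjStarAlgAut ℂ A.Alg (mapUnitary (α.toHom k) (C (k⁻¹ * g * k) l) * C g k) =
      Unitary.conjStarAlgAut ℂ A.Alg (C g (k * l)) := by
  rw [map_mul, conj_mapUnitary_eq, ← hC.conj, ← hC.conj, ← hC.conj, conj_index, map_mul,
    map_inv, map_inv, map_inv, map_mul]
  group

theorem IsCrossing.existsUnique_phases {C : G → G → unitary A.Alg} (hC : IsCrossing α ρ C) :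
    ∃! c, IsPhases α C c := by
  choose c hc using fun g k l => exists_phase (hC.conj_mul g k l)
  refine ⟨fun p g => c g p.1 p.2, fun g k l => hc g k l, fun d hd => ?_⟩
  funext p g
  refine Circle.ext (smul_injective (v := C g (p.1 * p.2)) ?_)
  rw [← hd g p.1 p.2]
  exact hc g p.1 p.2

/-- The product α^(k)(α^(l)(C(m)) C(l)) C(k), with the conjugated first indices omitted, is a
multiple of `C g (k * l * m)`. Contracting the left or the right pair first gives the two sides. -/
theorem IsPhases.cocycle {C : G → G → unitary A.Alg} {c : G × G → TwistedCircle G}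
    (hc : IsPhases α C c) (g k l m : G) :
    c (k * l, m) g * c (k, l) g = c (l, m) (k⁻¹ * g * k) * c (k, l * m) g := by
  refine Circle.ext (smul_injective (v := C g (k * l * m)) ?_)
  rw [Circle.coe_mul, Circle.coe_mul]
  have h1 := hc (k⁻¹ * g * k) l m
  have h2 := hc g k (l * m)
  have h3 := hc g k l
  have h4 := hc g (k * l) m
  have h5 := congrArg (fun x => α.toHom k x * (C g k : A.Alg)) h1
  simp only [map_mul, map_smul, smul_mul_assoc] at h5
  rw [h2, mul_assoc, h3, ← α.mul_apply, mul_smul_comm, conj_index, h4, smul_smul, smul_smul,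
    ← mul_assoc k] at h5
  rw [mul_comm, h5]

theorem IsPhases.isMulCocycle₂ {C : G → G → unitary A.Alg} {c : G × G → TwistedCircle G}
    (hc : IsPhases α C c) : groupCohomology.IsMulCocycle₂ c :=
  TwistedCircle.isMulCocycle₂_iff.2 hc.cocycle

/-- The class of the phases does not depend on the crossing operators. -/
theorem IsCrossing.mk_eq {C C' : G → G → unitary A.Alg} (hC : IsCrossing α ρ C)
    (hC' : IsCrossing α ρ C') {c c' : G × G → TwistedCircle G} (hc : IsPhases α C c)
    (hc' : IsPhases α C' c') :
    TwistedCircle.mk c hc.isMulCocycle₂ = TwistedCircle.mk c' hc'.isMulCocycle₂ := by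
  -- Both families implement the same automorphisms, so they differ by phases; these form the
  -- cochain whose coboundary relates c and c'.
  choose x hx using fun g k => exists_phase ((hC.conj g k).symm.trans (hC'.conj g k))
  refine TwistedCircle.mk_eq_mk _ _ (fun k g => x g k) fun k l => funext fun g => ?_
  change c (k, l) g * x g (k * l) = x (k⁻¹ * g * k) l * x g k * c' (k, l) g
  refine Circle.ext (smul_injective (v := C' g (k * l)) ?_)
  have h1 := hc g k l
  rw [hx, hx, hx, map_smul, smul_mul_smul_comm, hc', smul_smul, smul_smul] at h1
  rw [Circle.coe_mul, Circle.coe_mul, Circle.coe_mul, h1]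

/-- Changing the right restriction does not change the phases. -/
theorem IsRightRestriction.exists_phases_eq (h : IsRightRestriction α j L ρ) (hR : α.IsRangeLE R)
    {j' : ℤ} {L' : ℕ} {ρ' : G → (A.Alg ≃⋆ₐ[ℂ] A.Alg)} (h' : IsRightRestriction α j' L' ρ')
    {C : G → G → unitary A.Alg} (hC : IsCrossing α ρ C) {c : G × G → TwistedCircle G}
    (hc : IsPhases α C c) : ∃ C', IsCrossing α ρ' C' ∧ IsPhases α C' c := by
  classical
  -- Outside [m, n) the product ρ' ρ⁻¹ is trivial. On the right this needs the additional R, since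
  -- ρ⁻¹ spreads supports before ρ' acts.
  let m := min (j - L) (j' - L')
  let n := max (j + L + R) (j' + L' + R)
  have hex : ∀ g, ∃ v : unitary A.Alg, (v : A.Alg) ∈ A.sub ((Finset.Ico m n : Finset ℤ) : Set ℤ) ∧
      ρ' g * (ρ g)⁻¹ = Unitary.conjStarAlgAut ℂ A.Alg v := by
    intro g
    refine exists_conj_of_eq_id _ fun a ha => ?_
    rw [Finset.coe_Ico] at ha
    refine aut_apply_eq_self (fun a ha => ?_) (fun a ha => ?_) ha
    · change ρ' g ((ρ g)⁻¹ a) = a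
      rw [h.inv_left g (A.sub_mono (Set.Iio_subset_Iio (min_le_left _ _)) ha),
        h'.left g a (A.sub_mono (Set.Iio_subset_Iio (min_le_right _ _)) ha)]
    · change ρ' g ((ρ g)⁻¹ a) = a
      rw [h.inv_right hR g (A.sub_mono (Set.Ici_subset_Ici.2 (le_max_left _ _)) ha),
        h'.right, α.apply_inv_self]
      have h1 := hR g⁻¹ _ a (A.sub_mono (Set.Ici_subset_Ici.2 (le_max_right _ _)) ha)
      rwa [fatten_Ici, add_sub_cancel_right] at h1
  choose V hV hV' using hex
  have hVV : ∀ g, star (V g : A.Alg) * V g = 1 := fun g => Unitary.star_mul_self_of_mem (V g).2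
  -- The new crossing operators are forced by ρ' = Ad[V] ρ. In the product defining the phases, the
  -- inner V of index k⁻¹gk meets its adjoint and cancels, so the same c remains.
  refine ⟨fun g k => mapUnitary (α.toHom k) (V (k⁻¹ * g * k)) * C g k * star (V g),
    ⟨fun g k => ?_, fun g k => ?_⟩, fun g k l => ?_⟩
  · obtain ⟨S, hS⟩ := hC.isLocal g k
    obtain ⟨T, hT⟩ := (α.isQCA k).preservesLocal (Finset.Ico m n)
    refine ⟨T ∪ S ∪ Finset.Ico m n, mul_mem (mul_mem ?_ ?_) (star_mem ?_)⟩
    · refine A.sub_mono ?_ (hT _ (hV (k⁻¹ * g * k)))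
      exact Finset.coe_subset.2 (Finset.subset_union_left.trans Finset.subset_union_left)
    · refine A.sub_mono ?_ hS
      exact Finset.coe_subset.2 (Finset.subset_union_right.trans Finset.subset_union_left)
    · exact A.sub_mono (Finset.coe_subset.2 Finset.subset_union_right) (hV g)
  · have hstar : Unitary.conjStarAlgAut ℂ A.Alg (star (V g)) =
        (Unitary.conjStarAlgAut ℂ A.Alg (V g))⁻¹ := by
      rw [← map_inv]
      rfl
    rw [map_mul, map_mul, hstar, conj_mapUnitary_eq, ← hV', ← hV', ← hC.conj, map_inv]
    group
  · change α.toHom k (α.toHom l (V (l⁻¹ * (k⁻¹ * g * k) * l)) * C (k⁻¹ * g * k) l *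
      star (V (k⁻¹ * g * k) : A.Alg)) * (α.toHom k (V (k⁻¹ * g * k)) * C g k * star (V g : A.Alg)) =
      _ • (α.toHom (k * l) (V ((k * l)⁻¹ * g * (k * l))) * C g (k * l) * star (V g : A.Alg))
    rw [map_mul, map_mul, ← α.mul_apply, conj_index]
    have h1 : α.toHom k (star (V (k⁻¹ * g * k) : A.Alg)) * α.toHom k (V (k⁻¹ * g * k)) = 1 := by
      rw [← map_mul, hVV, map_one]
    have h2 := hc g k l
    set W := α.toHom (k * l) (V ((k * l)⁻¹ * g * (k * l)))
    calc W * α.toHom k (C (k⁻¹ * g * k) l) * α.toHom k (star (V (k⁻¹ * g * k) : A.Alg)) *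
          (α.toHom k (V (k⁻¹ * g * k)) * C g k * star (V g : A.Alg))
        = W * α.toHom k (C (k⁻¹ * g * k) l) * (α.toHom k (star (V (k⁻¹ * g * k) : A.Alg)) *
          α.toHom k (V (k⁻¹ * g * k))) * C g k * star (V g : A.Alg) := by noncomm_ring
      _ = W * (α.toHom k (C (k⁻¹ * g * k) l) * C g k) * star (V g : A.Alg) := by
        rw [h1]; noncomm_ring
      _ = _ := by rw [h2, mul_smul_comm, smul_mul_assoc]

end Restriction

/-- The data of a right restriction adapted to local unitaries which decouple `α` at `m`. -/
structure IsCut (α : Symmetry G A) (m : ℤ) (R : ℕ) (u : G → unitary A.Alg) : Prop where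
  mem : ∀ g, (u g : A.Alg) ∈ A.sub (Set.Ico (m - R) (m + R))
  right : ∀ g, ∀ a ∈ A.sub (Set.Ici m),
    (u g : A.Alg) * α.toHom g a * star (u g : A.Alg) ∈ A.sub (Set.Ici m)
  right_inv : ∀ g, ∀ a ∈ A.sub (Set.Ici m),
    α.toHom g⁻¹ (star (u g : A.Alg) * a * (u g : A.Alg)) ∈ A.sub (Set.Ici m)

theorem exists_isCut [Finite G] (α : Symmetry G A) {R : ℕ} (hR : α.IsRangeLE R) (m : ℤ) :
    ∃ u, IsCut α m R u := by
  choose u hu hu' hu'' using exists_unitary_preserving α hR m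
  exact ⟨u, hu, hu', hu''⟩

/-- Ad[u_g] ∘ α^(g) on 𝒜_{≥m} is glued with the identity on 𝒜_{<m}. From m + 2R on, the image under
α^(g) lies in 𝒜_{≥m+R} and commutes with u_g; hence the defect size. The exact formulas on both half
lines serve the comparison on an interval. -/
theorem IsCut.exists_restriction {α : Symmetry G A} {m : ℤ} {R : ℕ} {u : G → unitary A.Alg}
    (hu : IsCut α m R u) (hR : α.IsRangeLE R) : ∃ ρ : G → (A.Alg ≃⋆ₐ[ℂ] A.Alg),
      IsRightRestriction α m (2 * R) ρ ∧ (∀ g, ∀ a ∈ A.sub (Set.Iio m), ρ g a = a) ∧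
      ∀ g, ∀ a ∈ A.sub (Set.Ici m), ρ g a = u g * α.toHom g a * star (u g : A.Alg) := by
  have hex : ∀ g, ∃ ρ : A.Alg ≃⋆ₐ[ℂ] A.Alg,
      (∀ a ∈ A.sub (Set.Ici m), ρ a = u g * α.toHom g a * star (u g : A.Alg)) ∧
      ∀ a ∈ A.sub (Set.Ici m)ᶜ, ρ a = a := by
    intro g
    have hloc : PreservesLocal (Unitary.conjStarAlgAut ℂ A.Alg (u g)) :=
      preservesLocal_conj (S := Finset.Ico (m - R) (m + R)) (by
        rw [Finset.coe_Ico]; exact hu.mem g)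
    have hloc' : PreservesLocal (Unitary.conjStarAlgAut ℂ A.Alg (star (u g))) :=
      preservesLocal_conj (S := Finset.Ico (m - R) (m + R)) (by
        rw [Finset.coe_Ico]; exact star_mem (hu.mem g))
    have hsymm : ∀ a, (Unitary.conjStarAlgAut ℂ A.Alg (u g) * α.toHom g).symm a =
        α.toHom g⁻¹ (Unitary.conjStarAlgAut ℂ A.Alg (star (u g)) a) := by
      intro a
      rw [← α.symm_apply, ← Unitary.conjStarAlgAut_symm]
      rfl
    refine exists_glue (X := Set.Ici m) (Unitary.conjStarAlgAut ℂ A.Alg (u g) * α.toHom g)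
      (hloc.comp (α.isQCA g).preservesLocal) ?_ (hu.right g) fun a ha => ?_
    · have := (α.isQCA g⁻¹).preservesLocal.comp hloc'
      simpa only [← hsymm] using this
    · rw [hsymm, Unitary.conjStarAlgAut_star_apply]
      exact hu.right_inv g a ha
  choose ρ hρ hρ' using hex
  have hleft : ∀ g, ∀ a ∈ A.sub (Set.Iio m), ρ g a = a := by
    intro g a ha
    rw [← Set.compl_Ici] at ha
    exact hρ' g a ha
  refine ⟨ρ, ⟨fun g a ha => ?_, fun g a ha => hleft g a ?_⟩, hleft, hρ⟩
  · rw [hρ g a (A.sub_mono (Set.Ici_subset_Ici.2 (by push_cast; omega)) ha)]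
    have h1 := hR g _ a ha
    rw [fatten_Ici] at h1
    have h2 : α.toHom g a ∈ A.sub (Set.Ici (m + R)) :=
      A.sub_mono (Set.Ici_subset_Ici.2 (by push_cast; omega)) h1
    rw [← (commute_of_disjoint (disjoint_Ici_Ico _ _) h2 (hu.mem g)).eq, mul_assoc,
      Unitary.mul_star_self_of_mem (u g).2, mul_one]
  · exact A.sub_mono (Set.Iio_subset_Iio (by omega)) ha

theorem Symmetry.exists_isRightRestriction [Finite G] (α : Symmetry G A) (j : ℤ) :
    ∃ L ρ, IsRightRestriction α j L ρ := by
  obtain ⟨R, hR⟩ := α.exists_isRangeLE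
  obtain ⟨u, hu⟩ := exists_isCut α hR j
  obtain ⟨ρ, hρ, -⟩ := hu.exists_restriction hR
  exact ⟨_, ρ, hρ⟩

/-- The data which compute the anomaly of a symmetry. -/
structure IsAnomalyData (α : Symmetry G A) (c : G × G → TwistedCircle G) : Prop where
  exists_data : ∃ j L ρ C, IsRightRestriction α j L ρ ∧ IsCrossing α ρ C ∧ IsPhases α C c

theorem IsAnomalyData.isMulCocycle₂ {α : Symmetry G A} {c : G × G → TwistedCircle G}
    (h : IsAnomalyData α c) : groupCohomology.IsMulCocycle₂ c := by
  obtain ⟨_, _, _, _, _, _, hc⟩ := h.exists_data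
  exact hc.isMulCocycle₂

theorem exists_isAnomalyData [Finite G] (α : Symmetry G A) : ∃ c, IsAnomalyData α c := by
  obtain ⟨R, hR⟩ := α.exists_isRangeLE
  obtain ⟨L, ρ, hρ⟩ := α.exists_isRightRestriction 0
  obtain ⟨C, hC, -⟩ := hρ.exists_crossing hR
  obtain ⟨c, hc, -⟩ := hC.existsUnique_phases
  exact ⟨c, ⟨0, L, ρ, C, hρ, hC, hc⟩⟩

/-- The first set of data is moved to the second restriction without changing its phases; then only
the crossing operators differ. -/
theorem IsAnomalyData.mk_eq [Finite G] {α : Symmetry G A} {c c' : G × G → TwistedCircle G}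
    (h : IsAnomalyData α c) (h' : IsAnomalyData α c') :
    TwistedCircle.mk c h.isMulCocycle₂ = TwistedCircle.mk c' h'.isMulCocycle₂ := by
  obtain ⟨R, hR⟩ := α.exists_isRangeLE
  obtain ⟨j, L, ρ, C, hρ, hC, hc⟩ := h.exists_data
  obtain ⟨j', L', ρ', C', hρ', hC', hc'⟩ := h'.exists_data
  obtain ⟨D, hD, hDc⟩ := hρ.exists_phases_eq hR hρ' hC hc
  exact hD.mk_eq hC' hDc hc'

/-- The anomaly of a symmetry. -/
def anomaly [Finite G] (α : Symmetry G A) : TwistedCircle.H2 G :=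
  TwistedCircle.mk _ (exists_isAnomalyData α).choose_spec.isMulCocycle₂

theorem IsAnomalyData.anomaly_eq [Finite G] {α : Symmetry G A} {c : G × G → TwistedCircle G}
    (h : IsAnomalyData α c) : anomaly α = TwistedCircle.mk c h.isMulCocycle₂ :=
  (exists_isAnomalyData α).choose_spec.mk_eq h

end SpinChain

end

/-! ### Block products, decoupled symmetries and dependence on an interval only. -/

noncomputable section
open scoped TensorProduct CStarAlgebra

namespace SpinChain

variable {A B : SpinChain} {E : Type} [CStarAlgebra E]

theorem isClosed_comap (f : A.Alg →⋆ₐ[ℂ] E) {K : StarSubalgebra ℂ E} (hK : IsClosed (K : Set E)) :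
    IsClosed (K.comap f : Set A.Alg) :=
  hK.preimage (map_continuous f)

theorem map_mem_of_mem_union (f : A.Alg →⋆ₐ[ℂ] E) {K : StarSubalgebra ℂ E}
    (hK : IsClosed (K : Set E)) {X Y Z : Set ℤ} (hZ : Z ⊆ X ∪ Y) (hX : ∀ a ∈ A.sub X, f a ∈ K)
    (hY : ∀ a ∈ A.sub Y, f a ∈ K) {a : A.Alg} (ha : a ∈ A.sub Z) : f a ∈ K :=
  sub_union_le (K := (K.comap f).toSubalgebra) (isClosed_comap f hK) hX hY (A.sub_mono hZ ha)

theorem eqOn_mem_of_mem_union (f g : A.Alg →⋆ₐ[ℂ] E) {K : StarSubalgebra ℂ E}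
    (hK : IsClosed (K : Set E)) {X Y Z : Set ℤ} (hZ : Z ⊆ X ∪ Y)
    (hX : ∀ a ∈ A.sub X, f a = g a ∧ f a ∈ K) (hY : ∀ a ∈ A.sub Y, f a = g a ∧ f a ∈ K) {a : A.Alg}
    (ha : a ∈ A.sub Z) : f a = g a ∧ f a ∈ K :=
  ⟨eqOn_sub_union f g (fun a ha => (hX a ha).1) (fun a ha => (hY a ha).1) (A.sub_mono hZ ha),
    map_mem_of_mem_union f hK hZ (fun a ha => (hX a ha).2) (fun a ha => (hY a ha).2) ha⟩

/-- On-site algebras generate, by induction over finite sets and closure; so sitewise statements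
imply statements about all regions. -/
theorem sub_le_of_singleton {X : Set ℤ} {K : Subalgebra ℂ A.Alg} (hK : IsClosed (K : Set A.Alg))
    (h : ∀ j ∈ X, ∀ a ∈ A.sub {j}, a ∈ K) {a : A.Alg} (ha : a ∈ A.sub X) : a ∈ K := by
  classical
  refine sub_le_of_finset hK (fun S => ?_) ha
  induction S using Finset.induction_on with
  | empty =>
    intro _ a ha
    rw [Finset.coe_empty] at ha
    obtain ⟨c, rfl⟩ := exists_scalar_of_mem_sub_empty ha
    exact K.smul_mem (one_mem K) c
  | insert j S _ ih =>
    intro hS a ha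
    rw [Finset.coe_insert] at ha hS
    rw [Set.insert_eq] at ha
    exact sub_union_le hK (h j (hS (Set.mem_insert j _)))
      (ih ((Set.subset_insert j _).trans hS)) ha

theorem map_mem_of_singleton (f : A.Alg →⋆ₐ[ℂ] E) {K : StarSubalgebra ℂ E}
    (hK : IsClosed (K : Set E)) {X : Set ℤ} (h : ∀ j ∈ X, ∀ a ∈ A.sub {j}, f a ∈ K) {a : A.Alg}
    (ha : a ∈ A.sub X) : f a ∈ K :=
  sub_le_of_singleton (K := (K.comap f).toSubalgebra) (isClosed_comap f hK) h ha

/-- A `*`-isomorphism of spin chains as a `*`-homomorphism. -/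
def isoHom (φ : A.Alg ≃⋆ₐ[ℂ] B.Alg) : A.Alg →⋆ₐ[ℂ] B.Alg where
  toFun := φ
  map_one' := map_one φ
  map_mul' := map_mul φ
  map_zero' := map_zero φ
  map_add' := map_add φ
  commutes' c := by
    rw [Algebra.algebraMap_eq_smul_one, map_smul, map_one, Algebra.algebraMap_eq_smul_one]
  map_star' := map_star φ

/-! ### Block products -/

section Block

variable {I : ℤ → Set ℤ} {β : A.Alg ≃⋆ₐ[ℂ] A.Alg}

theorem IsBlockProduct.symm (h : IsBlockProduct I β) : IsBlockProduct I β.symm := by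
  obtain ⟨U, hU⟩ := h
  refine ⟨fun a => star (U a), fun a => ⟨star_mem (hU a).1, fun x hx => ?_⟩⟩
  rw [StarAlgEquiv.symm_apply_eq, (hU a).2]
  · rw [← Unitary.conjStarAlgAut_symm, StarAlgEquiv.apply_symm_apply]
  · rw [Unitary.conjStarAlgAut_star_apply]
    exact mul_mem (mul_mem (star_mem (hU a).1) hx) (hU a).1

theorem IsBlockProduct.apply_mem_block (h : IsBlockProduct I β) {a : ℤ} {x : A.Alg}
    (hx : x ∈ A.sub (I a)) : β x ∈ A.sub (I a) := by
  obtain ⟨U, hU⟩ := h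
  rw [(hU a).2 x hx, Unitary.conjStarAlgAut_apply]
  exact mul_mem (mul_mem (hU a).1 hx) (star_mem (hU a).1)

theorem IsBlockProduct.apply_mem (h : IsBlockProduct I β) (hI : ∀ j, ∃ a, j ∈ I a) {X Y : Set ℤ}
    (hXY : ∀ a, ∀ j ∈ I a, j ∈ X → I a ⊆ Y) {x : A.Alg} (hx : x ∈ A.sub X) : β x ∈ A.sub Y := by
  refine map_mem_of_singleton (autHom β) (A.isClosed_sub Y) (fun j hj x hx => ?_) hx
  obtain ⟨a, ha⟩ := hI j
  exact A.sub_mono (hXY a j ha hj) (h.apply_mem_block (A.sub_mono (by simpa using ha) hx))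

theorem IsBlockPartition.exists_abs_le (hI : IsBlockPartition I) :
    ∃ N : ℕ, ∀ a, ∀ i ∈ I a, ∀ j ∈ I a, |i - j| ≤ N := by
  obtain ⟨N, hN⟩ := hI.bounded
  have key : ∀ a, ∀ i ∈ I a, ∀ j ∈ I a, i - j ≤ N := by
    intro a i hi j hj
    have h1 : (Set.Icc j i).encard ≤ N :=
      (Set.encard_le_encard ((hI.ordConnected a).out hj hi)).trans (hN a)
    rw [← Finset.coe_Icc, Set.encard_coe_eq_coe_finsetCard, Nat.cast_le, Int.card_Icc] at h1
    omega
  exact ⟨N, fun a i hi j hj => abs_le.2 ⟨by linarith [key a j hj i hi], key a i hi j hj⟩⟩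

theorem IsBlockPartition.exists_mem (hI : IsBlockPartition I) (j : ℤ) : ∃ a, j ∈ I a :=
  (hI.existsUnique j).exists

theorem IsBlockPartitioned.isQCA (h : IsBlockPartitioned β) : IsQCA β := by
  obtain ⟨I, hI, hβ⟩ := h
  obtain ⟨N, hN⟩ := hI.exists_abs_le
  refine ⟨N, fun X x hx => hβ.apply_mem hI.exists_mem (fun a j hj hjX i hi => ?_) hx⟩
  exact ⟨j, hjX, hN a i hi j hj⟩

theorem IsBlockPartitioned.inv (h : IsBlockPartitioned β) : IsBlockPartitioned β⁻¹ := by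
  obtain ⟨I, hI, hβ⟩ := h
  exact ⟨I, hI, hβ.symm⟩

/-- There is a site which is the leftmost one of its block. -/
theorem IsBlockPartition.exists_boundary (hI : IsBlockPartition I) :
    ∃ m : ℤ, ∀ a, ∀ i ∈ I a, ∀ j ∈ I a, m ≤ i → m ≤ j := by
  obtain ⟨N, hN⟩ := hI.exists_abs_le
  obtain ⟨a, ha⟩ := hI.exists_mem 0
  have hfin : (I a).Finite := (Set.finite_Icc (-N : ℤ) N).subset fun i hi => by
    simpa [abs_le] using hN a i hi 0 ha
  -- Here n is the last site of the block of 0, and the cut is made after it. A block with sites on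
  -- both sides of the cut would contain n by convexity, so it would be this very block, against
  -- maximality.
  obtain ⟨n, hn, hmax⟩ := hfin.exists_maximal ⟨0, ha⟩
  refine ⟨n + 1, fun b i hi j hj h => ?_⟩
  by_contra hlt
  have hnb : n ∈ I b := (hI.ordConnected b).out hj hi ⟨by omega, by omega⟩
  rw [← (hI.existsUnique n).unique hn hnb] at hi
  have := hmax hi (by omega)
  omega

theorem IsFDQC.isQCA {γ : A.Alg ≃⋆ₐ[ℂ] A.Alg} (h : IsFDQC γ) : IsQCA γ := by
  induction h using Submonoid.closure_induction with
  | mem β hβ => exact IsBlockPartitioned.isQCA hβ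
  | one =>
    refine ⟨0, fun X a ha => A.sub_mono (fun i hi => ?_) ha⟩
    exact ⟨i, hi, by simp⟩
  | mul γ δ _ _ hγ hδ =>
    obtain ⟨r, hr⟩ := hγ
    obtain ⟨s, hs⟩ := hδ
    refine ⟨r + s, fun X a ha => A.sub_mono ?_ (hr _ _ (hs X a ha))⟩
    rintro k ⟨j, ⟨i, hi, hj⟩, hk⟩
    refine ⟨i, hi, ?_⟩
    push_cast
    calc |k - i| ≤ |k - j| + |j - i| := abs_sub_le k j i
      _ ≤ r + s := add_le_add hk hj

theorem IsFDQC.inv {γ : A.Alg ≃⋆ₐ[ℂ] A.Alg} (h : IsFDQC γ) : IsFDQC γ⁻¹ := by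
  induction h using Submonoid.closure_induction with
  | mem β hβ => exact Submonoid.subset_closure (IsBlockPartitioned.inv hβ)
  | one => rw [inv_one]; exact one_mem _
  | mul γ δ _ _ hγ hδ => rw [mul_inv_rev]; exact mul_mem hδ hγ

end Block

variable {G : Type} [Group G]

/-! ### Vanishing of the anomaly of decoupled symmetries -/

/-- At a cut between blocks every α^(g) preserves both half chains. The truncations to the right
half are then restrictions with ρ_g = α^(k) ρ_{k⁻¹gk} α^(k⁻¹) exactly, so all crossing operators and
phases can be taken to be 1. -/
theorem anomaly_eq_zero_of_isDecoupled [Finite G] {α : Symmetry G A} (h : α.IsDecoupled) :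
    anomaly α = 0 := by
  obtain ⟨I, hI, hα⟩ := h
  obtain ⟨m, hm⟩ := hI.exists_boundary
  have hX : ∀ g, ∀ a ∈ A.sub (Set.Ici m), α.toHom g a ∈ A.sub (Set.Ici m) := fun g a ha =>
    (hα g).apply_mem hI.exists_mem (fun b j hj hjX i hi => hm b j hj i hi hjX) ha
  have hX' : ∀ g, ∀ a ∈ A.sub (Set.Ici m)ᶜ, α.toHom g a ∈ A.sub (Set.Ici m)ᶜ := by
    intro g a ha
    refine (hα g).apply_mem hI.exists_mem (fun b j hj hjX i hi => ?_) ha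
    exact fun hi' => hjX (hm b i hi j hj hi')
  have hex : ∀ g, ∃ ρ : A.Alg ≃⋆ₐ[ℂ] A.Alg, (∀ a ∈ A.sub (Set.Ici m), ρ a = α.toHom g a) ∧
      ∀ a ∈ A.sub (Set.Ici m)ᶜ, ρ a = a := by
    intro g
    refine exists_glue (α.toHom g) (α.isQCA g).preservesLocal ?_ (hX g) fun a ha => ?_
    · rw [show ⇑(α.toHom g).symm = α.toHom g⁻¹ from funext (α.symm_apply g)]
      exact (α.isQCA g⁻¹).preservesLocal
    · rw [α.symm_apply]
      exact hX g⁻¹ a ha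
  choose ρ hρ hρ' using hex
  have hres : IsRightRestriction α m 0 ρ :=
    ⟨fun g a ha => hρ g a (by simpa using ha),
      fun g a ha => hρ' g a (by rw [Set.compl_Ici]; simpa using ha)⟩
  have hcross : IsCrossing α ρ fun _ _ => 1 := by
    refine ⟨fun g k => ⟨∅, one_mem _⟩, fun g k => ?_⟩
    rw [map_one, mul_inv_eq_one]
    refine aut_ext_compl (X := Set.Ici m) (fun a ha => ?_) fun a ha => ?_
    · change α.toHom k (ρ (k⁻¹ * g * k) (α.toHom k⁻¹ a)) = ρ g a
      rw [hρ _ _ (hX _ a ha), hρ g a ha, ← α.mul_apply, ← α.mul_apply]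
      congr 2
      group
    · change α.toHom k (ρ (k⁻¹ * g * k) (α.toHom k⁻¹ a)) = ρ g a
      rw [hρ' _ _ (hX' _ a ha), hρ' g a ha, α.apply_inv_self]
  have hphase : IsPhases α (fun _ _ => 1) 1 := by
    intro g k l
    change α.toHom k 1 * 1 = ((1 : Circle) : ℂ) • (1 : A.Alg)
    rw [map_one, mul_one, Circle.coe_one, one_smul]
  rw [IsAnomalyData.anomaly_eq ⟨m, 0, ρ, _, hres, hcross, hphase⟩, TwistedCircle.mk_one]

/-! ### The anomaly is determined by the action on an interval -/

theorem IsRangeLE.apply_mem_Ico {α : A.Alg ≃⋆ₐ[ℂ] A.Alg} {R : ℕ} (h : IsRangeLE α R)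
    {m n m' n' : ℤ} (hm : m' ≤ m - R) (hn : n + R ≤ n') {a : A.Alg} (ha : a ∈ A.sub (Set.Ico m n)) :
    α a ∈ A.sub (Set.Ico m' n') := by
  refine A.sub_mono ?_ (h _ a ha)
  rintro j ⟨i, ⟨h1, h2⟩, h3⟩
  rw [abs_le] at h3
  exact ⟨by omega, by omega⟩

theorem Ico_subset_union (m k n : ℤ) : Set.Ico m n ⊆ Set.Ico m k ∪ Set.Ico k n := by
  intro j hj
  rcases lt_or_ge j k with h | h
  · exact Or.inl ⟨hj.1, h⟩
  · exact Or.inr ⟨h, hj.2⟩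

theorem Ici_subset_union (m k : ℤ) : Set.Ici m ⊆ Set.Ico m k ∪ Set.Ici k := by
  intro j hj
  rcases lt_or_ge j k with h | h
  · exact Or.inl ⟨hj, h⟩
  · exact Or.inr h

section Interval

variable {α β : Symmetry G A} {R : ℕ} {m : ℤ} {u : G → unitary A.Alg}

/-- The cut conditions involve the symmetry only near m: elements of 𝒜_{≥m+2R} are mapped to
𝒜_{≥m+R} and do not meet u. So a second symmetry which agrees with α there is decoupled by the same
unitaries. -/
theorem IsCut.congr (hu : IsCut α m R u) (hβ : β.IsRangeLE R)
    (h : ∀ g, ∀ a ∈ A.sub (Set.Ico (m - R) (m + 2 * R)), α.toHom g a = β.toHom g a) :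
    IsCut β m R u := by
  have hcomm : ∀ g, ∀ a ∈ A.sub (Set.Ici (m + R)), Commute a (u g) := fun g a ha =>
    commute_of_disjoint (disjoint_Ici_Ico _ _) ha (hu.mem g)
  refine ⟨hu.mem, fun g a ha => ?_, fun g a ha => ?_⟩
  · refine map_mem_of_mem_union (autHom (Unitary.conjStarAlgAut ℂ A.Alg (u g) * β.toHom g))
      (A.isClosed_sub _) (Ici_subset_union m (m + 2 * R)) (fun a ha => ?_) (fun a ha => ?_) ha
    · change (u g : A.Alg) * β.toHom g a * star (u g : A.Alg) ∈ _
      rw [← h g a (A.sub_mono (Set.Ico_subset_Ico_left (sub_le_self m (Nat.cast_nonneg R))) ha)]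
      exact hu.right g a (A.sub_mono Set.Ico_subset_Ici_self ha)
    · change (u g : A.Alg) * β.toHom g a * star (u g : A.Alg) ∈ _
      have h1 := hβ g _ a ha
      rw [fatten_Ici] at h1
      rw [← (hcomm g _ (A.sub_mono (Set.Ici_subset_Ici.2 (by omega)) h1)).eq, mul_assoc,
        Unitary.mul_star_self_of_mem (u g).2, mul_one]
      exact A.sub_mono (Set.Ici_subset_Ici.2 (by omega)) h1
  · have hconj : ∀ a, (Unitary.conjStarAlgAut ℂ A.Alg (star (u g))) a =
        star (u g : A.Alg) * a * (u g : A.Alg) := Unitary.conjStarAlgAut_star_apply (u g)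
    suffices hs : autHom (β.toHom g⁻¹ * Unitary.conjStarAlgAut ℂ A.Alg (star (u g))) a ∈
        A.sub (Set.Ici m) by
      rw [← hconj]
      exact hs
    refine map_mem_of_mem_union _ (A.isClosed_sub _) (Ici_subset_union m (m + R))
      (fun a ha => ?_) (fun a ha => ?_) ha
    · change β.toHom g⁻¹ (Unitary.conjStarAlgAut ℂ A.Alg (star (u g)) a) ∈ _
      rw [hconj, ← h]
      · exact hu.right_inv g a (A.sub_mono Set.Ico_subset_Ici_self ha)
      · have hu' : (u g : A.Alg) ∈ A.sub (Set.Ico (m - R) (m + 2 * R)) :=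
          A.sub_mono (Set.Ico_subset_Ico_right (by omega)) (hu.mem g)
        refine mul_mem (mul_mem (star_mem hu') ?_) hu'
        exact A.sub_mono (Set.Ico_subset_Ico (by omega) (by omega)) ha
    · change β.toHom g⁻¹ (Unitary.conjStarAlgAut ℂ A.Alg (star (u g)) a) ∈ _
      rw [hconj, mul_assoc, (hcomm g a ha).eq, ← mul_assoc, Unitary.star_mul_self_of_mem (u g).2,
        one_mul]
      have h1 := hβ g⁻¹ _ a ha
      rwa [fatten_Ici, add_sub_cancel_right] at h1

/-- With common decoupling unitaries, the automorphisms implemented by the crossing operators agree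
on a window around m and are trivial outside of it. The crossing operators of α therefore serve β,
with the same phases. -/
theorem anomaly_eq_of_eqOn_Icc [Finite G] (hα : α.IsRangeLE R) (hβ : β.IsRangeLE R) {i : ℤ}
    (h : ∀ g, ∀ a ∈ A.sub (Set.Icc i (i + 12 * R)), α.toHom g a = β.toHom g a) :
    anomaly α = anomaly β := by
  -- The interval is [m - 5R, m + 7R]. It is longer on the right because only there do the
  -- restrictions spread supports.
  obtain ⟨m, rfl⟩ : ∃ m : ℤ, i = m - 5 * R := ⟨i + 5 * R, by omega⟩
  have hI : ∀ {p q : ℤ}, m - 5 * R ≤ p → q ≤ m + 7 * R →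
      ∀ g, ∀ a ∈ A.sub (Set.Ico p q), α.toHom g a = β.toHom g a := by
    intro p q hp hq g a ha
    refine h g a (A.sub_mono ?_ ha)
    rintro j ⟨h1, h2⟩
    exact ⟨by omega, by omega⟩
  obtain ⟨u, hu⟩ := exists_isCut α hα m
  have hu' := hu.congr hβ (hI (by omega) (by omega))
  obtain ⟨ρ, hρ, hρl, hρr⟩ := hu.exists_restriction hα
  obtain ⟨ρ', hρ', hρl', hρr'⟩ := hu'.exists_restriction hβ
  obtain ⟨C, hC, hCm⟩ := hρ.exists_crossing hα
  obtain ⟨c, hc, -⟩ := hC.existsUnique_phases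
  have hJ : Set.Ico (m - (2 * R : ℕ) - R) (m + (2 * R : ℕ) + R + R) =
      Set.Ico (m - 3 * R) (m + 4 * R) := by
    congr 1 <;> push_cast <;> ring
  have hinv : ∀ {σ : A.Alg ≃⋆ₐ[ℂ] A.Alg} {a b : A.Alg}, σ b = a → σ⁻¹ a = b := fun h =>
    (StarAlgEquiv.symm_apply_eq _).2 h.symm
  have hinvr : ∀ {δ : Symmetry G A} {σ : G → (A.Alg ≃⋆ₐ[ℂ] A.Alg)}, IsCut δ m R u →
      (∀ g, ∀ a ∈ A.sub (Set.Ici m), σ g a = u g * δ.toHom g a * star (u g : A.Alg)) →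
      ∀ g, ∀ a ∈ A.sub (Set.Ici m),
        (σ g)⁻¹ a = δ.toHom g⁻¹ (star (u g : A.Alg) * a * (u g : A.Alg)) := by
    intro δ σ hδ hσ g a ha
    refine hinv ?_
    rw [hσ g _ (hδ.right_inv g a ha), δ.apply_inv_self]
    have h1 := Unitary.mul_star_self_of_mem (u g).2
    calc (u g : A.Alg) * (star (u g : A.Alg) * a * u g) * star (u g : A.Alg)
        = ((u g : A.Alg) * star (u g : A.Alg)) * a * ((u g : A.Alg) * star (u g : A.Alg)) := by
          noncomm_ring
      _ = a := by rw [h1, one_mul, mul_one]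
  have hum : ∀ g {p q : ℤ}, p ≤ m - R → m + R ≤ q → (u g : A.Alg) ∈ A.sub (Set.Ico p q) :=
    fun g p q hp hq => A.sub_mono (Set.Ico_subset_Ico hp hq) (hu.mem g)
  -- Supports are tracked through the four factors: from [m-3R, m+4R) to [m-3R, m+5R) by ρ⁻¹, then
  -- to [m-4R, m+6R) by α^(k⁻¹), then to [m-4R, m+7R) by ρ. The last factor α^(k) need only agree
  -- there, which exhausts the right end of the interval.
  have step1 : ∀ g, ∀ a ∈ A.sub (Set.Ico (m - 3 * R) (m + 4 * R)),
      (ρ g)⁻¹ a = (ρ' g)⁻¹ a ∧ (ρ g)⁻¹ a ∈ A.sub (Set.Ico (m - 3 * R) (m + 5 * R)) := by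
    intro g a ha
    refine eqOn_mem_of_mem_union (autHom (ρ g)⁻¹) (autHom (ρ' g)⁻¹) (A.isClosed_sub _)
      (Ico_subset_union _ m _) (fun a ha => ?_) (fun a ha => ?_) ha
    · change (ρ g)⁻¹ a = (ρ' g)⁻¹ a ∧ (ρ g)⁻¹ a ∈ _
      have ha' := A.sub_mono Set.Ico_subset_Iio_self ha
      rw [hinv (hρl g a ha'), hinv (hρl' g a ha')]
      exact ⟨rfl, A.sub_mono (Set.Ico_subset_Ico_right (by omega)) ha⟩
    · change (ρ g)⁻¹ a = (ρ' g)⁻¹ a ∧ (ρ g)⁻¹ a ∈ _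
      have ha' := A.sub_mono Set.Ico_subset_Ici_self ha
      rw [hinvr hu hρr g a ha', hinvr hu' hρr' g a ha']
      have h1 : star (u g : A.Alg) * a * (u g : A.Alg) ∈ A.sub (Set.Ico (m - R) (m + 4 * R)) :=
        mul_mem (mul_mem (star_mem (hum g le_rfl (by omega)))
          (A.sub_mono (Set.Ico_subset_Ico_left (by omega)) ha)) (hum g le_rfl (by omega))
      exact ⟨hI (by omega) (by omega) _ _ h1, (hα g⁻¹).apply_mem_Ico (by omega) (by omega) h1⟩
  have step3 : ∀ g, ∀ a ∈ A.sub (Set.Ico (m - 4 * R) (m + 6 * R)),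
      ρ g a = ρ' g a ∧ ρ g a ∈ A.sub (Set.Ico (m - 4 * R) (m + 7 * R)) := by
    intro g a ha
    refine eqOn_mem_of_mem_union (autHom (ρ g)) (autHom (ρ' g)) (A.isClosed_sub _)
      (Ico_subset_union _ m _) (fun a ha => ?_) (fun a ha => ?_) ha
    · change ρ g a = ρ' g a ∧ ρ g a ∈ _
      have ha' := A.sub_mono Set.Ico_subset_Iio_self ha
      rw [hρl g a ha', hρl' g a ha']
      exact ⟨rfl, A.sub_mono (Set.Ico_subset_Ico_right (by omega)) ha⟩
    · change ρ g a = ρ' g a ∧ ρ g a ∈ _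
      have ha' := A.sub_mono Set.Ico_subset_Ici_self ha
      rw [hρr g a ha', hρr' g a ha', ← hI (by omega) (by omega) g a ha]
      refine ⟨rfl, mul_mem (mul_mem ?_ ?_) (star_mem ?_)⟩
      · exact hum g (by omega) (by omega)
      · exact (hα g).apply_mem_Ico (by omega) (by omega) ha
      · exact hum g (by omega) (by omega)
  have hC' : IsCrossing β ρ' C := by
    refine ⟨hC.isLocal, fun g k => ?_⟩
    refine aut_ext_compl (X := Set.Ico (m - 3 * R) (m + 4 * R)) (fun a ha => ?_) fun a ha => ?_
    · rw [← hC.conj]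
      change β.toHom k (ρ' (k⁻¹ * g * k) (β.toHom k⁻¹ ((ρ' g)⁻¹ a))) =
        α.toHom k (ρ (k⁻¹ * g * k) (α.toHom k⁻¹ ((ρ g)⁻¹ a)))
      obtain ⟨e1, m1⟩ := step1 g a ha
      have e2 := hI (by omega) (by omega) k⁻¹ _ m1
      have m2 := (hα k⁻¹).apply_mem_Ico (m' := m - 4 * R) (n' := m + 6 * R) (by omega) (by omega) m1
      obtain ⟨e3, m3⟩ := step3 (k⁻¹ * g * k) _ m2
      rw [hI (by omega) (by omega) k _ m3, e3, e2, e1]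
    -- Outside of the window both sides act trivially: the β-side by the range estimate, the
    -- conjugation because C is supported in the window.
    · rw [hρ'.crossing_apply hβ g k (by rw [hJ]; exact ha), Unitary.conjStarAlgAut_apply]
      have hCJ := hCm g k
      rw [hJ] at hCJ
      rw [(commute_of_disjoint disjoint_compl_right hCJ ha).eq, mul_assoc,
        Unitary.mul_star_self_of_mem (C g k).2, mul_one]
  have hc' : IsPhases β C c := by
    intro g k l
    rw [← hc g k l, hI (by omega) (by omega) k _ (hJ ▸ hCm (k⁻¹ * g * k) l)]
  rw [IsAnomalyData.anomaly_eq ⟨_, _, _, _, hρ, hC, hc⟩,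
    IsAnomalyData.anomaly_eq ⟨_, _, _, _, hρ', hC', hc'⟩]

end Interval

end SpinChain

end

/-! ### Additivity under stacking and invariance under stable equivalence. -/

noncomputable section
open scoped TensorProduct CStarAlgebra

namespace SpinChain

variable {A B : SpinChain} {E : Type} [CStarAlgebra E]

theorem eqOn_sub_stack (f f' : (A.stack B).Alg →⋆ₐ[ℂ] E) {X : Set ℤ}
    (hl : ∀ a ∈ A.sub X, f (A.inl B a) = f' (A.inl B a))
    (hr : ∀ b ∈ B.sub X, f (A.inr B b) = f' (A.inr B b)) {c : (A.stack B).Alg}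
    (hc : c ∈ (A.stack B).sub X) : f c = f' c :=
  mem_of_forall_stack (StarAlgHom.id ℂ _) (StarAlgHom.equalizer f f') (isClosed_equalizer f f')
    hl hr hc

variable {G : Type} [Group G]

/-! ### The anomaly of a stack -/

theorem IsRightRestriction.mono {α : Symmetry G A} {j : ℤ} {L L' : ℕ}
    {ρ : G → (A.Alg ≃⋆ₐ[ℂ] A.Alg)} (h : IsRightRestriction α j L ρ) (hL : L ≤ L') :
    IsRightRestriction α j L' ρ :=
  ⟨fun g a ha => h.right g a (A.sub_mono (Set.Ici_subset_Ici.2 (by omega)) ha),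
    fun g a ha => h.left g a (A.sub_mono (Set.Iio_subset_Iio (by omega)) ha)⟩

theorem IsRightRestriction.stack {α : Symmetry G A} {β : Symmetry G B} {j : ℤ} {L : ℕ}
    {ρ : G → (A.Alg ≃⋆ₐ[ℂ] A.Alg)} {σ : G → (B.Alg ≃⋆ₐ[ℂ] B.Alg)}
    (hρ : IsRightRestriction α j L ρ) (hσ : IsRightRestriction β j L σ) :
    IsRightRestriction (α.stack β) j L fun g => stackAut (ρ g) (σ g) := by
  refine ⟨fun g c hc => ?_, fun g c hc => ?_⟩
  · refine eqOn_sub_stack (autHom (stackAut (ρ g) (σ g)))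
      (autHom (stackAut (α.toHom g) (β.toHom g))) (fun a ha => ?_) (fun b hb => ?_) hc
    · rw [autHom_apply, autHom_apply, stackAut_inl, stackAut_inl, hρ.right g a ha]
    · rw [autHom_apply, autHom_apply, stackAut_inr, stackAut_inr, hσ.right g b hb]
  · refine eqOn_sub_stack (autHom (stackAut (ρ g) (σ g))) (StarAlgHom.id ℂ _)
      (fun a ha => ?_) (fun b hb => ?_) hc
    · rw [autHom_apply, stackAut_inl, hρ.left g a ha]
      rfl
    · rw [autHom_apply, stackAut_inr, hσ.left g b hb]
      rfl

/-- The unitary `u ⊗ v`. -/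
def stackUnitary (u : unitary A.Alg) (v : unitary B.Alg) : unitary (A.stack B).Alg :=
  ⟨A.inl B u, Unitary.map_mem (A.inl B) u.2⟩ * ⟨A.inr B v, Unitary.map_mem (A.inr B) v.2⟩

theorem coe_stackUnitary (u : unitary A.Alg) (v : unitary B.Alg) :
    (stackUnitary u v : (A.stack B).Alg) = A.inl B u * A.inr B v := rfl

theorem stackAut_conj (u : unitary A.Alg) (v : unitary B.Alg) :
    stackAut (Unitary.conjStarAlgAut ℂ A.Alg u) (Unitary.conjStarAlgAut ℂ B.Alg v) =
      Unitary.conjStarAlgAut ℂ (A.stack B).Alg (stackUnitary u v) := by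
  have hu : A.inl B (u : A.Alg) * star (A.inl B (u : A.Alg)) = 1 := by
    rw [← map_star, ← map_mul, Unitary.mul_star_self_of_mem u.2, map_one]
  have hv : A.inr B (v : B.Alg) * star (A.inr B (v : B.Alg)) = 1 := by
    rw [← map_star, ← map_mul, Unitary.mul_star_self_of_mem v.2, map_one]
  refine StarAlgEquiv.ext fun c => DFunLike.congr_fun (stack_hom_ext
    (φ := autHom (stackAut (Unitary.conjStarAlgAut ℂ A.Alg u) (Unitary.conjStarAlgAut ℂ B.Alg v)))
    (ψ := autHom (Unitary.conjStarAlgAut ℂ (A.stack B).Alg (stackUnitary u v)))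
    (fun a => ?_) fun b => ?_) c
  · rw [autHom_apply, autHom_apply, stackAut_inl, Unitary.conjStarAlgAut_apply,
      Unitary.conjStarAlgAut_apply, coe_stackUnitary, map_mul, map_mul, map_star, star_mul,
      mul_assoc (A.inl B (u : A.Alg)) (A.inr B (v : B.Alg)),
      ← (A.inl_commute_inr B a v).eq]
    calc _ = A.inl B (u : A.Alg) * A.inl B a * (A.inr B (v : B.Alg) * star (A.inr B (v : B.Alg))) *
          star (A.inl B (u : A.Alg)) := by rw [hv, mul_one]
      _ = _ := by noncomm_ring
  · rw [autHom_apply, autHom_apply, stackAut_inr, Unitary.conjStarAlgAut_apply,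
      Unitary.conjStarAlgAut_apply, coe_stackUnitary, (A.inl_commute_inr B u v).eq, map_mul,
      map_mul, map_star, star_mul, mul_assoc (A.inr B (v : B.Alg)) (A.inl B (u : A.Alg)),
      (A.inl_commute_inr B u b).eq]
    calc _ = A.inr B (v : B.Alg) * A.inr B b * (A.inl B (u : A.Alg) * star (A.inl B (u : A.Alg))) *
          star (A.inr B (v : B.Alg)) := by rw [hu, mul_one]
      _ = _ := by noncomm_ring

theorem stackAut_inv (α : A.Alg ≃⋆ₐ[ℂ] A.Alg) (β : B.Alg ≃⋆ₐ[ℂ] B.Alg) :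
    (stackAut α β)⁻¹ = stackAut α⁻¹ β⁻¹ := by
  rw [inv_eq_iff_mul_eq_one, ← stackAut_mul, mul_inv_cancel, mul_inv_cancel, stackAut_one]

theorem IsCrossing.stack {α : Symmetry G A} {β : Symmetry G B}
    {ρ : G → (A.Alg ≃⋆ₐ[ℂ] A.Alg)} {σ : G → (B.Alg ≃⋆ₐ[ℂ] B.Alg)}
    {C : G → G → unitary A.Alg} {D : G → G → unitary B.Alg}
    (hC : IsCrossing α ρ C) (hD : IsCrossing β σ D) :
    IsCrossing (α.stack β) (fun g => stackAut (ρ g) (σ g))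
      fun g k => stackUnitary (C g k) (D g k) := by
  classical
  refine ⟨fun g k => ?_, fun g k => ?_⟩
  · obtain ⟨S, hS⟩ := hC.isLocal g k
    obtain ⟨T, hT⟩ := hD.isLocal g k
    refine ⟨S ∪ T, mul_mem ?_ ?_⟩
    · exact A.inl_mem B (A.sub_mono (Finset.coe_subset.2 Finset.subset_union_left) hS)
    · exact A.inr_mem B (B.sub_mono (Finset.coe_subset.2 Finset.subset_union_right) hT)
  · rw [← stackAut_conj, ← hC.conj, ← hD.conj, stackAut_inv, stackAut_mul, stackAut_mul,
      stackAut_mul]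
    rfl

theorem IsPhases.stack {α : Symmetry G A} {β : Symmetry G B}
    {C : G → G → unitary A.Alg} {D : G → G → unitary B.Alg} {c d : G × G → TwistedCircle G}
    (hc : IsPhases α C c) (hd : IsPhases β D d) :
    IsPhases (α.stack β) (fun g k => stackUnitary (C g k) (D g k)) (c * d) := by
  intro g k l
  change stackAut (α.toHom k) (β.toHom k) _ * _ = ((c (k, l) g * d (k, l) g : Circle) : ℂ) • _
  rw [coe_stackUnitary, coe_stackUnitary, coe_stackUnitary, map_mul, stackAut_inl, stackAut_inr,
    (A.inl_commute_inr B _ _).symm.mul_mul_mul_comm, ← map_mul, ← map_mul, hc, hd, map_smul,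
    map_smul, smul_mul_smul_comm, Circle.coe_mul]

/-- After enlarging the defect sizes to a common one, tensor products of restrictions and of
crossing operators are again such data, and the phases multiply. -/
theorem anomaly_stack [Finite G] (α : Symmetry G A) (β : Symmetry G B) :
    anomaly (α.stack β) = anomaly α + anomaly β := by
  obtain ⟨R, hR⟩ := α.exists_isRangeLE
  obtain ⟨R', hR'⟩ := β.exists_isRangeLE
  obtain ⟨L, ρ, hρ⟩ := α.exists_isRightRestriction 0
  obtain ⟨L', σ, hσ⟩ := β.exists_isRightRestriction 0
  obtain ⟨C, hC, -⟩ := hρ.exists_crossing hR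
  obtain ⟨D, hD, -⟩ := hσ.exists_crossing hR'
  obtain ⟨c, hc, -⟩ := hC.existsUnique_phases
  obtain ⟨d, hd, -⟩ := hD.existsUnique_phases
  have hstack := (hρ.mono (le_max_left L L')).stack (hσ.mono (le_max_right L L'))
  rw [IsAnomalyData.anomaly_eq ⟨_, _, _, _, hρ, hC, hc⟩,
    IsAnomalyData.anomaly_eq ⟨_, _, _, _, hσ, hD, hd⟩,
    IsAnomalyData.anomaly_eq ⟨_, _, _, _, hstack, hC.stack hD, hc.stack hd⟩,
    TwistedCircle.mk_mul]

/-! ### Invariance of the anomaly under locality preserving isomorphisms -/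

/-- Transport of structure: θ carries restrictions and crossing operators of α to those of β, at the
cost of a defect size larger by N, and fixes the scalars λ. -/
theorem anomaly_eq_of_conj [Finite G] {α : Symmetry G A} {β : Symmetry G B}
    (θ : A.Alg ≃⋆ₐ[ℂ] B.Alg) (N : ℕ) (hθ : ∀ X : Set ℤ, ∀ a ∈ A.sub X, θ a ∈ B.sub (fatten X N))
    (hθ' : ∀ X : Set ℤ, ∀ b ∈ B.sub X, θ.symm b ∈ A.sub (fatten X N))
    (h : ∀ g a, θ (α.toHom g a) = β.toHom g (θ a)) : anomaly α = anomaly β := by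
  obtain ⟨R, hR⟩ := α.exists_isRangeLE
  obtain ⟨L, ρ, hρ⟩ := α.exists_isRightRestriction 0
  obtain ⟨C, hC, -⟩ := hρ.exists_crossing hR
  obtain ⟨c, hc, -⟩ := hC.existsUnique_phases
  have h' : ∀ g b, α.toHom g (θ.symm b) = θ.symm (β.toHom g b) := by
    intro g b
    rw [StarAlgEquiv.eq_symm_apply, h, StarAlgEquiv.apply_symm_apply]
  let σ : G → (B.Alg ≃⋆ₐ[ℂ] B.Alg) := fun g => (θ.symm.trans (ρ g)).trans θ
  have hσ : IsRightRestriction β 0 (L + N) σ := by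
    refine ⟨fun g b hb => ?_, fun g b hb => ?_⟩
    · change θ (ρ g (θ.symm b)) = _
      have h1 := hθ' _ b hb
      rw [fatten_Ici] at h1
      rw [hρ.right g _ (A.sub_mono (Set.Ici_subset_Ici.2 (by push_cast; omega)) h1), h,
        StarAlgEquiv.apply_symm_apply]
    · change θ (ρ g (θ.symm b)) = _
      have h1 := hθ' _ b hb
      rw [fatten_Iio] at h1
      rw [hρ.left g _ (A.sub_mono (Set.Iio_subset_Iio (by push_cast; omega)) h1),
        StarAlgEquiv.apply_symm_apply]
  have hD : IsCrossing β σ fun g k => mapUnitary θ (C g k) := by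
    refine ⟨fun g k => ?_, fun g k => StarAlgEquiv.ext fun b => ?_⟩
    · obtain ⟨S, hS⟩ := hC.isLocal g k
      refine ⟨(fatten_finite S.finite_toSet N).toFinset, ?_⟩
      rw [Set.Finite.coe_toFinset]
      exact hθ _ _ hS
    · have h1 := congrArg θ (DFunLike.congr_fun (hC.conj g k) (θ.symm b))
      rw [← conj_mapUnitary, StarAlgEquiv.apply_symm_apply] at h1
      rw [← h1]
      change β.toHom k (θ (ρ _ (θ.symm (β.toHom k⁻¹ (θ ((ρ g).symm (θ.symm b))))))) =
        θ (α.toHom k (ρ _ (α.toHom k⁻¹ ((ρ g).symm (θ.symm b)))))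
      rw [h, ← h', StarAlgEquiv.symm_apply_apply]
  have hd : IsPhases β (fun g k => mapUnitary θ (C g k)) c := by
    intro g k l
    have h1 := congrArg θ (hc g k l)
    rw [map_mul, h, map_smul] at h1
    exact h1
  rw [IsAnomalyData.anomaly_eq ⟨_, _, _, _, hρ, hC, hc⟩,
    IsAnomalyData.anomaly_eq ⟨_, _, _, _, hσ, hD, hd⟩]

theorem IsSitewise.symm {φ : A.Alg ≃⋆ₐ[ℂ] B.Alg} (h : IsSitewise φ) : IsSitewise φ.symm := by
  intro j b
  rw [← h j, StarAlgEquiv.apply_symm_apply]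

theorem IsSitewise.apply_mem {φ : A.Alg ≃⋆ₐ[ℂ] B.Alg} (h : IsSitewise φ) {X : Set ℤ} {a : A.Alg}
    (ha : a ∈ A.sub X) : φ a ∈ B.sub X :=
  map_mem_of_singleton (isoHom φ) (B.isClosed_sub X)
    (fun j hj a ha => B.sub_mono (Set.singleton_subset_iff.2 hj) ((h j a).2 ha)) ha

theorem Symmetry.Equivalent.anomaly_eq [Finite G] {α' : Symmetry G A} {α : Symmetry G B}
    (h : α'.Equivalent α) : anomaly α' = anomaly α := by
  obtain ⟨φ, hφ, γ, hγ, h⟩ := h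
  obtain ⟨r, hr⟩ := hγ.isQCA
  obtain ⟨s, hs⟩ := hγ.inv.isQCA
  -- Identification followed by the circuit intertwines the two symmetries; its spread is that of γ,
  -- because φ is sitewise.
  refine anomaly_eq_of_conj (φ.trans γ) (max r s) (fun X a ha => ?_) (fun X b hb => ?_)
    fun g a => ?_
  · exact B.sub_mono (fatten_mono X (le_max_left r s)) (hr X _ (hφ.apply_mem ha))
  · exact hφ.symm.apply_mem (B.sub_mono (fatten_mono X (le_max_right r s)) (hs X _ hb))
  · change γ (φ _) = _
    rw [h]
    exact γ.apply_symm_apply _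

theorem fatten_zero (X : Set ℤ) : fatten X 0 = X := by
  ext j
  constructor
  · rintro ⟨i, hi, h⟩
    rw [Nat.cast_zero, abs_nonpos_iff, sub_eq_zero] at h
    rwa [h]
  · exact fun hj => ⟨j, hj, by simp⟩

/-- Symmetries of range `0` act by on-site unitaries. -/
theorem Symmetry.IsRangeLE.isDecoupled {α : Symmetry G A} (h : α.IsRangeLE 0) :
    α.IsDecoupled := by
  refine ⟨fun a => {a}, ⟨fun a => Set.ordConnected_singleton, fun j => ⟨j, rfl, fun _ h => h.symm⟩,
    1, fun a => by simp⟩, fun g => ?_⟩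
  have hex : ∀ a : ℤ, ∃ u : unitary A.Alg, (u : A.Alg) ∈ A.sub {a} ∧
      ∀ x ∈ A.sub {a}, α.toHom g x = Unitary.conjStarAlgAut ℂ A.Alg u x := by
    intro a
    have hmem : ∀ x ∈ A.sub ({a} : Finset ℤ), α.toHom g x ∈ A.sub ({a} : Finset ℤ) := by
      intro x hx
      have := h g _ x hx
      rwa [fatten_zero] at this
    -- At range 0 the on-site matrix algebra is mapped to itself, and an automorphism of a full
    -- matrix algebra is inner.
    obtain ⟨u, hu, hu'⟩ := exists_unitary_mem_sub (A.isMatrixUnits_units {a})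
      ((A.isMatrixUnits_units {a}).map (autHom (α.toHom g))) (A.units_mem {a})
      (fun x y => hmem _ (A.units_mem {a} x y))
    rw [Finset.coe_singleton] at hu
    refine ⟨u, hu, fun x hx => ?_⟩
    rw [← Finset.coe_singleton] at hx
    obtain ⟨c, rfl⟩ := (A.spans_units {a} x).1 hx
    simp only [map_sum, map_smul]
    refine Finset.sum_congr rfl fun x _ => Finset.sum_congr rfl fun y _ => ?_
    rw [Unitary.conjStarAlgAut_apply, hu', mul_assoc, Unitary.mul_star_self_of_mem u.2, mul_one,
      autHom_apply]
  choose U hU using hex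
  exact ⟨U, hU⟩

theorem Symmetry.StablyEquivalent.anomaly_eq [Finite G] {α : Symmetry G A} {α' : Symmetry G B}
    (h : α.StablyEquivalent α') : anomaly α = anomaly α' := by
  obtain ⟨C, C', β, β', hβ, hβ', h⟩ := h
  have := h.anomaly_eq
  rwa [anomaly_stack, anomaly_stack, anomaly_eq_zero_of_isDecoupled hβ.isDecoupled,
    anomaly_eq_zero_of_isDecoupled hβ'.isDecoupled, add_zero, add_zero] at this

end SpinChain

end

/-! ### Isomorphisms of stacks, circuits and the monoid of stable classes. -/

noncomputable section
open scoped TensorProduct CStarAlgebra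

namespace SpinChain

variable {A B C D : SpinChain}

/-! ### Isomorphisms of stacks -/

/-- `f ⊗ h` for `*`-homomorphisms `f` and `h`. -/
def stackMap (f : A.Alg →⋆ₐ[ℂ] C.Alg) (h : B.Alg →⋆ₐ[ℂ] D.Alg) :
    (A.stack B).Alg →⋆ₐ[ℂ] (C.stack D).Alg :=
  lift ((C.inl D).comp f) ((C.inr D).comp h) fun a b => C.inl_commute_inr D (f a) (h b)

theorem stackMap_inl (f : A.Alg →⋆ₐ[ℂ] C.Alg) (h : B.Alg →⋆ₐ[ℂ] D.Alg) (a : A.Alg) :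
    stackMap f h (A.inl B a) = C.inl D (f a) := lift_inl _ _ _ a

theorem stackMap_inr (f : A.Alg →⋆ₐ[ℂ] C.Alg) (h : B.Alg →⋆ₐ[ℂ] D.Alg) (b : B.Alg) :
    stackMap f h (A.inr B b) = C.inr D (h b) := lift_inr _ _ _ b

theorem isoHom_apply (φ : A.Alg ≃⋆ₐ[ℂ] B.Alg) (a : A.Alg) : isoHom φ a = φ a := rfl

theorem stackMap_symm_comp (φ : A.Alg ≃⋆ₐ[ℂ] C.Alg) (ψ : B.Alg ≃⋆ₐ[ℂ] D.Alg) :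
    (stackMap (isoHom φ.symm) (isoHom ψ.symm)).comp (stackMap (isoHom φ) (isoHom ψ)) =
      StarAlgHom.id ℂ (A.stack B).Alg := by
  refine stack_hom_ext (fun a => ?_) fun b => ?_
  · rw [StarAlgHom.comp_apply, stackMap_inl, stackMap_inl, isoHom_apply, isoHom_apply,
      StarAlgEquiv.symm_apply_apply]
    rfl
  · rw [StarAlgHom.comp_apply, stackMap_inr, stackMap_inr, isoHom_apply, isoHom_apply,
      StarAlgEquiv.symm_apply_apply]
    rfl

/-- `φ ⊗ ψ` for `*`-isomorphisms `φ` and `ψ`. -/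
def stackIso (φ : A.Alg ≃⋆ₐ[ℂ] C.Alg) (ψ : B.Alg ≃⋆ₐ[ℂ] D.Alg) :
    (A.stack B).Alg ≃⋆ₐ[ℂ] (C.stack D).Alg :=
  StarAlgEquiv.ofStarAlgHom (stackMap (isoHom φ) (isoHom ψ))
    (stackMap (isoHom φ.symm) (isoHom ψ.symm)) (stackMap_symm_comp φ ψ)
    (stackMap_symm_comp φ.symm ψ.symm)

/-- The exchange of the factors of a stack. -/
def commHom (A B : SpinChain) : (A.stack B).Alg →⋆ₐ[ℂ] (B.stack A).Alg :=
  lift (B.inr A) (B.inl A) fun a b => (B.inl_commute_inr A b a).symm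

theorem commHom_inl (a : A.Alg) : commHom A B (A.inl B a) = B.inr A a := lift_inl _ _ _ a

theorem commHom_inr (b : B.Alg) : commHom A B (A.inr B b) = B.inl A b := lift_inr _ _ _ b

theorem commHom_comp (A B : SpinChain) :
    (commHom B A).comp (commHom A B) = StarAlgHom.id ℂ (A.stack B).Alg := by
  refine stack_hom_ext (fun a => ?_) fun b => ?_
  · rw [StarAlgHom.comp_apply, commHom_inl, commHom_inr]
    rfl
  · rw [StarAlgHom.comp_apply, commHom_inr, commHom_inl]
    rfl

/-- The isomorphism `𝒜 ⊗ ℬ ≃ ℬ ⊗ 𝒜`. -/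
def commIso (A B : SpinChain) : (A.stack B).Alg ≃⋆ₐ[ℂ] (B.stack A).Alg :=
  StarAlgEquiv.ofStarAlgHom (commHom A B) (commHom B A) (commHom_comp A B) (commHom_comp B A)

/-- Commutation with star x is assumed too, since the centralizer has to be a star subalgebra for
the density argument. -/
theorem commute_lift {E : Type} [CStarAlgebra E] {f : A.Alg →⋆ₐ[ℂ] E} {h : B.Alg →⋆ₐ[ℂ] E}
    {hc : ∀ a b, Commute (f a) (h b)} {x : E} (hf : ∀ a, Commute (f a) x)
    (hf' : ∀ a, Commute (f a) (star x)) (hh : ∀ b, Commute (h b) x)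
    (hh' : ∀ b, Commute (h b) (star x)) (c : (A.stack B).Alg) : Commute (lift f h hc c) x := by
  have hK : IsClosed (StarSubalgebra.centralizer ℂ {x} : Set E) := by
    rw [StarSubalgebra.coe_centralizer]
    exact Set.isClosed_centralizer _
  have hmem : ∀ {y : E}, Commute y x → Commute y (star x) →
      y ∈ StarSubalgebra.centralizer ℂ {x} := by
    intro y h1 h2
    rw [StarSubalgebra.mem_centralizer_iff]
    rintro z rfl
    exact ⟨h1.symm, h2.symm⟩
  have := mem_of_forall_stack (lift f h hc) (StarSubalgebra.centralizer ℂ {x}) hK (X := Set.univ)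
    (fun a _ => by rw [lift_inl]; exact hmem (hf a) (hf' a))
    (fun b _ => by rw [lift_inr]; exact hmem (hh b) (hh' b)) (mem_sub_univ c)
  rw [StarSubalgebra.mem_centralizer_iff] at this
  exact (this x rfl).1.symm

/-- The inclusion of the second factor into `𝒜 ⊗ (ℬ ⊗ 𝒞)`. -/
abbrev midR (A B C : SpinChain) : B.Alg →⋆ₐ[ℂ] (A.stack (B.stack C)).Alg :=
  (A.inr (B.stack C)).comp (B.inl C)

/-- The inclusion of the third factor into `𝒜 ⊗ (ℬ ⊗ 𝒞)`. -/
abbrev lastR (A B C : SpinChain) : C.Alg →⋆ₐ[ℂ] (A.stack (B.stack C)).Alg :=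
  (A.inr (B.stack C)).comp (B.inr C)

/-- The inclusion of the first factor into `(𝒜 ⊗ ℬ) ⊗ 𝒞`. -/
abbrev firstL (A B C : SpinChain) : A.Alg →⋆ₐ[ℂ] ((A.stack B).stack C).Alg :=
  ((A.stack B).inl C).comp (A.inl B)

/-- The inclusion of the second factor into `(𝒜 ⊗ ℬ) ⊗ 𝒞`. -/
abbrev midL (A B C : SpinChain) : B.Alg →⋆ₐ[ℂ] ((A.stack B).stack C).Alg :=
  ((A.stack B).inl C).comp (A.inr B)

theorem inl_commute_midR (a : A.Alg) (b : B.Alg) :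
    Commute (A.inl (B.stack C) a) (midR A B C b) :=
  A.inl_commute_inr (B.stack C) a (B.inl C b)

theorem inl_commute_lastR (a : A.Alg) (c : C.Alg) :
    Commute (A.inl (B.stack C) a) (lastR A B C c) :=
  A.inl_commute_inr (B.stack C) a (B.inr C c)

theorem midR_commute_lastR (b : B.Alg) (c : C.Alg) :
    Commute (midR A B C b) (lastR A B C c) :=
  (B.inl_commute_inr C b c).map (A.inr (B.stack C))

theorem firstL_commute_midL (a : A.Alg) (b : B.Alg) :
    Commute (firstL A B C a) (midL A B C b) :=
  (A.inl_commute_inr B a b).map ((A.stack B).inl C)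

theorem firstL_commute_inr (a : A.Alg) (c : C.Alg) :
    Commute (firstL A B C a) ((A.stack B).inr C c) :=
  (A.stack B).inl_commute_inr C (A.inl B a) c

theorem midL_commute_inr (b : B.Alg) (c : C.Alg) :
    Commute (midL A B C b) ((A.stack B).inr C c) :=
  (A.stack B).inl_commute_inr C (A.inr B b) c

theorem lift_commute_lastR (x : (A.stack B).Alg) (c : C.Alg) :
    Commute (lift (A.inl (B.stack C)) (midR A B C) inl_commute_midR x) (lastR A B C c) :=
  commute_lift (fun a => inl_commute_lastR a c)
    (fun a => by rw [← map_star]; exact inl_commute_lastR a (star c))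
    (fun b => midR_commute_lastR b c)
    (fun b => by rw [← map_star]; exact midR_commute_lastR b (star c)) x

theorem firstL_commute_lift (a : A.Alg) (x : (B.stack C).Alg) :
    Commute (firstL A B C a) (lift (midL A B C) ((A.stack B).inr C) midL_commute_inr x) :=
  (commute_lift (fun b => (firstL_commute_midL a b).symm)
    (fun b => by rw [← map_star]; exact (firstL_commute_midL (star a) b).symm)
    (fun c => (firstL_commute_inr a c).symm)
    (fun c => by rw [← map_star]; exact (firstL_commute_inr (star a) c).symm) x).symm

/-- The homomorphism `(𝒜 ⊗ ℬ) ⊗ 𝒞 → 𝒜 ⊗ (ℬ ⊗ 𝒞)`. -/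
def assocHom (A B C : SpinChain) : ((A.stack B).stack C).Alg →⋆ₐ[ℂ] (A.stack (B.stack C)).Alg :=
  lift (lift (A.inl (B.stack C)) (midR A B C) inl_commute_midR) (lastR A B C) lift_commute_lastR

/-- The homomorphism `𝒜 ⊗ (ℬ ⊗ 𝒞) → (𝒜 ⊗ ℬ) ⊗ 𝒞`. -/
def assocInvHom (A B C : SpinChain) :
    (A.stack (B.stack C)).Alg →⋆ₐ[ℂ] ((A.stack B).stack C).Alg :=
  lift (firstL A B C) (lift (midL A B C) ((A.stack B).inr C) midL_commute_inr) firstL_commute_lift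

theorem assocHom_inl_inl (a : A.Alg) :
    assocHom A B C ((A.stack B).inl C (A.inl B a)) = A.inl (B.stack C) a :=
  (lift_inl _ _ _ _).trans (lift_inl _ _ _ a)

theorem assocHom_inl_inr (b : B.Alg) :
    assocHom A B C ((A.stack B).inl C (A.inr B b)) = A.inr (B.stack C) (B.inl C b) :=
  (lift_inl _ _ _ _).trans (lift_inr _ _ _ b)

theorem assocHom_inr (c : C.Alg) :
    assocHom A B C ((A.stack B).inr C c) = A.inr (B.stack C) (B.inr C c) :=
  lift_inr _ _ _ c

theorem assocInvHom_inl (a : A.Alg) :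
    assocInvHom A B C (A.inl (B.stack C) a) = (A.stack B).inl C (A.inl B a) :=
  lift_inl _ _ _ a

theorem assocInvHom_inr_inl (b : B.Alg) :
    assocInvHom A B C (A.inr (B.stack C) (B.inl C b)) = (A.stack B).inl C (A.inr B b) :=
  (lift_inr _ _ _ _).trans (lift_inl _ _ _ b)

theorem assocInvHom_inr_inr (c : C.Alg) :
    assocInvHom A B C (A.inr (B.stack C) (B.inr C c)) = (A.stack B).inr C c :=
  (lift_inr _ _ _ _).trans (lift_inr _ _ _ c)

variable {E : Type} [CStarAlgebra E]

theorem stack_hom_ext_left {φ ψ : ((A.stack B).stack C).Alg →⋆ₐ[ℂ] E}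
    (h1 : ∀ a, φ ((A.stack B).inl C (A.inl B a)) = ψ ((A.stack B).inl C (A.inl B a)))
    (h2 : ∀ b, φ ((A.stack B).inl C (A.inr B b)) = ψ ((A.stack B).inl C (A.inr B b)))
    (h3 : ∀ c, φ ((A.stack B).inr C c) = ψ ((A.stack B).inr C c)) : φ = ψ :=
  stack_hom_ext (fun x => DFunLike.congr_fun (stack_hom_ext
    (φ := φ.comp ((A.stack B).inl C)) (ψ := ψ.comp ((A.stack B).inl C)) h1 h2) x) h3

theorem stack_hom_ext_right {φ ψ : (A.stack (B.stack C)).Alg →⋆ₐ[ℂ] E}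
    (h1 : ∀ a, φ (A.inl (B.stack C) a) = ψ (A.inl (B.stack C) a))
    (h2 : ∀ b, φ (A.inr (B.stack C) (B.inl C b)) = ψ (A.inr (B.stack C) (B.inl C b)))
    (h3 : ∀ c, φ (A.inr (B.stack C) (B.inr C c)) = ψ (A.inr (B.stack C) (B.inr C c))) : φ = ψ :=
  stack_hom_ext h1 fun x => DFunLike.congr_fun (stack_hom_ext
    (φ := φ.comp (A.inr (B.stack C))) (ψ := ψ.comp (A.inr (B.stack C))) h2 h3) x

/-- The isomorphism `(𝒜 ⊗ ℬ) ⊗ 𝒞 ≃ 𝒜 ⊗ (ℬ ⊗ 𝒞)`. -/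
def assocIso (A B C : SpinChain) : ((A.stack B).stack C).Alg ≃⋆ₐ[ℂ] (A.stack (B.stack C)).Alg :=
  StarAlgEquiv.ofStarAlgHom (assocHom A B C) (assocInvHom A B C)
    (stack_hom_ext_left
      (fun a => by
        rw [StarAlgHom.comp_apply, assocHom_inl_inl, assocInvHom_inl]
        rfl)
      (fun b => by
        rw [StarAlgHom.comp_apply, assocHom_inl_inr, assocInvHom_inr_inl]
        rfl)
      fun c => by
        rw [StarAlgHom.comp_apply, assocHom_inr, assocInvHom_inr_inr]
        rfl)
    (stack_hom_ext_right
      (fun a => by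
        rw [StarAlgHom.comp_apply, assocInvHom_inl, assocHom_inl_inl]
        rfl)
      (fun b => by
        rw [StarAlgHom.comp_apply, assocInvHom_inr_inl, assocHom_inl_inr]
        rfl)
      fun c => by
        rw [StarAlgHom.comp_apply, assocInvHom_inr_inr, assocHom_inr]
        rfl)

/-- An isomorphism which respects the on-site algebras in both directions is sitewise. -/
theorem isSitewise_of_mem {φ : A.Alg ≃⋆ₐ[ℂ] B.Alg} (h : ∀ j : ℤ, ∀ a ∈ A.sub {j}, φ a ∈ B.sub {j})
    (h' : ∀ j : ℤ, ∀ b ∈ B.sub {j}, φ.symm b ∈ A.sub {j}) : IsSitewise φ := by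
  refine fun j a => ⟨fun ha => ?_, h j a⟩
  have := h' j _ ha
  rwa [StarAlgEquiv.symm_apply_apply] at this

theorem commHom_mem {X : Set ℤ} {c : (A.stack B).Alg} (hc : c ∈ (A.stack B).sub X) :
    commHom A B c ∈ (B.stack A).sub X :=
  mem_of_forall_stack _ _ ((B.stack A).isClosed_sub X)
    (fun a ha => by rw [commHom_inl]; exact B.inr_mem A ha)
    (fun b hb => by rw [commHom_inr]; exact B.inl_mem A hb) hc

theorem isSitewise_commIso (A B : SpinChain) : IsSitewise (commIso A B) :=
  isSitewise_of_mem (fun _ _ h => commHom_mem h) fun _ _ h => commHom_mem h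

theorem stackMap_mem {f : A.Alg →⋆ₐ[ℂ] C.Alg} {h : B.Alg →⋆ₐ[ℂ] D.Alg} {X : Set ℤ}
    (hf : ∀ a ∈ A.sub X, f a ∈ C.sub X) (hh : ∀ b ∈ B.sub X, h b ∈ D.sub X) {c : (A.stack B).Alg}
    (hc : c ∈ (A.stack B).sub X) : stackMap f h c ∈ (C.stack D).sub X :=
  mem_of_forall_stack _ _ ((C.stack D).isClosed_sub X)
    (fun a ha => by rw [stackMap_inl]; exact C.inl_mem D (hf a ha))
    (fun b hb => by rw [stackMap_inr]; exact C.inr_mem D (hh b hb)) hc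

theorem IsSitewise.stackIso {φ : A.Alg ≃⋆ₐ[ℂ] C.Alg} {ψ : B.Alg ≃⋆ₐ[ℂ] D.Alg} (hφ : IsSitewise φ)
    (hψ : IsSitewise ψ) : IsSitewise (stackIso φ ψ) :=
  isSitewise_of_mem
    (fun _ _ h => stackMap_mem (fun _ ha => hφ.apply_mem ha) (fun _ hb => hψ.apply_mem hb) h)
    fun _ _ h =>
      stackMap_mem (fun _ ha => hφ.symm.apply_mem ha) (fun _ hb => hψ.symm.apply_mem hb) h

theorem isSitewise_assocIso (A B C : SpinChain) : IsSitewise (assocIso A B C) := by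
  refine isSitewise_of_mem (fun j x hx => ?_) fun j x hx => ?_
  · refine mem_of_forall_stack (assocHom A B C) _ (SpinChain.isClosed_sub _ _) (fun y hy => ?_)
      (fun c hc => ?_) hx
    · refine mem_of_forall_stack ((assocHom A B C).comp ((A.stack B).inl C)) _
        (SpinChain.isClosed_sub _ _) (fun a ha => ?_) (fun b hb => ?_) hy
      · rw [StarAlgHom.comp_apply, assocHom_inl_inl]
        exact A.inl_mem _ ha
      · rw [StarAlgHom.comp_apply, assocHom_inl_inr]
        exact A.inr_mem _ (B.inl_mem _ hb)
    · rw [assocHom_inr]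
      exact A.inr_mem _ (B.inr_mem _ hc)
  · refine mem_of_forall_stack (assocInvHom A B C) _ (SpinChain.isClosed_sub _ _) (fun a ha => ?_)
      (fun y hy => ?_) hx
    · rw [assocInvHom_inl]
      exact (A.stack B).inl_mem _ (A.inl_mem _ ha)
    · refine mem_of_forall_stack ((assocInvHom A B C).comp (A.inr (B.stack C))) _
        (SpinChain.isClosed_sub _ _) (fun b hb => ?_) (fun c hc => ?_) hy
      · rw [StarAlgHom.comp_apply, assocInvHom_inr_inl]
        exact (A.stack B).inl_mem _ (A.inr_mem _ hb)
      · rw [StarAlgHom.comp_apply, assocInvHom_inr_inr]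
        exact (A.stack B).inr_mem _ hc

/-! ### Permanence properties of circuits -/

theorem IsBlockPartitioned.conj {φ : A.Alg ≃⋆ₐ[ℂ] B.Alg} (hφ : IsSitewise φ)
    {β : A.Alg ≃⋆ₐ[ℂ] A.Alg} (h : IsBlockPartitioned β) :
    IsBlockPartitioned ((φ.symm.trans β).trans φ) := by
  obtain ⟨I, hI, U, hU⟩ := h
  refine ⟨I, hI, fun a => mapUnitary φ (U a), fun a => ⟨hφ.apply_mem (hU a).1, fun x hx => ?_⟩⟩
  change φ (β (φ.symm x)) = _
  rw [(hU a).2 _ (hφ.symm.apply_mem hx), ← conj_mapUnitary, StarAlgEquiv.apply_symm_apply]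

/-- Allows circuits to be moved across identifications of spin chains, as symmetry and transitivity
of equivalence require. -/
theorem IsFDQC.conj {φ : A.Alg ≃⋆ₐ[ℂ] B.Alg} (hφ : IsSitewise φ)
    {γ : A.Alg ≃⋆ₐ[ℂ] A.Alg} (h : IsFDQC γ) : IsFDQC ((φ.symm.trans γ).trans φ) := by
  induction h using Submonoid.closure_induction with
  | mem β hβ => exact Submonoid.subset_closure (IsBlockPartitioned.conj hφ hβ)
  | one =>
    have : (φ.symm.trans (1 : A.Alg ≃⋆ₐ[ℂ] A.Alg)).trans φ = 1 :=
      StarAlgEquiv.ext fun x => φ.apply_symm_apply x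
    rw [this]
    exact one_mem _
  | mul γ δ _ _ hγ hδ =>
    have : (φ.symm.trans (γ * δ)).trans φ =
        (φ.symm.trans γ).trans φ * (φ.symm.trans δ).trans φ := by
      refine StarAlgEquiv.ext fun x => ?_
      change φ (γ (δ (φ.symm x))) = φ (γ (φ.symm (φ (δ (φ.symm x)))))
      rw [StarAlgEquiv.symm_apply_apply]
    rw [this]
    exact mul_mem hγ hδ

theorem IsBlockPartitioned.stackAut_one {β : A.Alg ≃⋆ₐ[ℂ] A.Alg} (h : IsBlockPartitioned β)
    (B : SpinChain) : IsBlockPartitioned (stackAut β (1 : B.Alg ≃⋆ₐ[ℂ] B.Alg)) := by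
  obtain ⟨I, hI, U, hU⟩ := h
  refine ⟨I, hI, fun a => stackUnitary (U a) 1, fun a => ⟨?_, fun x hx => ?_⟩⟩
  · rw [coe_stackUnitary]
    exact mul_mem (A.inl_mem B (hU a).1) (inr_mem A B (one_mem _))
  · rw [← stackAut_conj, map_one]
    refine eqOn_sub_stack (autHom (stackAut β 1))
      (autHom (stackAut (Unitary.conjStarAlgAut ℂ A.Alg (U a)) 1)) (fun y hy => ?_) (fun b _ => ?_) hx
    · rw [autHom_apply, autHom_apply, stackAut_inl, stackAut_inl, (hU a).2 y hy]
    · rw [autHom_apply, autHom_apply, stackAut_inr, stackAut_inr]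

theorem IsFDQC.stackAut_one {γ : A.Alg ≃⋆ₐ[ℂ] A.Alg} (h : IsFDQC γ) (B : SpinChain) :
    IsFDQC (stackAut γ (1 : B.Alg ≃⋆ₐ[ℂ] B.Alg)) := by
  induction h using Submonoid.closure_induction with
  | mem β hβ => exact Submonoid.subset_closure (IsBlockPartitioned.stackAut_one hβ B)
  | one => rw [SpinChain.stackAut_one]; exact one_mem _
  | mul γ δ _ _ hγ hδ =>
    rw [← mul_one (1 : B.Alg ≃⋆ₐ[ℂ] B.Alg), stackAut_mul]
    exact mul_mem hγ hδ

/-! ### Equivalence and stable equivalence -/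

namespace Symmetry

variable {G : Type} [Group G] {α : Symmetry G A} {β : Symmetry G B} {δ : Symmetry G C}
  {ε : Symmetry G D}

theorem Equivalent.of_iso (φ : A.Alg ≃⋆ₐ[ℂ] B.Alg) (hφ : IsSitewise φ)
    (h : ∀ g a, φ (α.toHom g a) = β.toHom g (φ a)) : α.Equivalent β :=
  ⟨φ, hφ, 1, one_mem _, fun g a => by rw [h, inv_one, one_mul, mul_one]⟩

theorem Equivalent.refl (α : Symmetry G A) : α.Equivalent α :=
  .of_iso (StarAlgEquiv.refl ℂ _) (fun _ _ => Iff.rfl) fun _ _ => rfl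

theorem Equivalent.symm (h : α.Equivalent β) : β.Equivalent α := by
  obtain ⟨φ, hφ, γ, hγ, h⟩ := h
  refine ⟨φ.symm, hφ.symm, (φ.symm.symm.trans γ⁻¹).trans φ.symm, hγ.inv.conj hφ.symm,
    fun g b => ?_⟩
  obtain ⟨a, rfl⟩ := (φ.trans γ).surjective b
  change φ.symm (β.toHom g (γ (φ a))) =
    φ.symm (γ (φ (α.toHom g (φ.symm (γ.symm (φ (φ.symm (γ (φ a)))))))))
  rw [φ.apply_symm_apply, γ.symm_apply_apply, φ.symm_apply_apply, h]
  exact congrArg φ.symm (γ.apply_symm_apply _).symm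

theorem Equivalent.trans (h : α.Equivalent β) (h' : β.Equivalent δ) : α.Equivalent δ := by
  obtain ⟨φ, hφ, γ, hγ, h⟩ := h
  obtain ⟨ψ, hψ, χ, hχ, h'⟩ := h'
  -- The circuit γ on the middle chain is transported along ψ and followed by χ.
  refine ⟨φ.trans ψ, fun j a => (hψ j _).trans (hφ j a), χ * (ψ.symm.trans γ).trans ψ,
    mul_mem hχ (hγ.conj hψ), fun g a => ?_⟩
  change ψ (φ (α.toHom g a)) = ψ (γ.symm (ψ.symm (χ.symm (δ.toHom g (χ (ψ (γ (ψ.symm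
    (ψ (φ a))))))))))
  have h1 := h' g (γ (φ a))
  change ψ _ = χ.symm (δ.toHom g (χ (ψ (γ (φ a))))) at h1
  rw [h, ψ.symm_apply_apply, ← h1, ψ.symm_apply_apply]
  rfl

theorem Equivalent.stack_right (h : α.Equivalent β) (δ : Symmetry G C) :
    (α.stack δ).Equivalent (β.stack δ) := by
  obtain ⟨φ, hφ, γ, hγ, h⟩ := h
  refine ⟨stackIso φ (StarAlgEquiv.refl ℂ _), hφ.stackIso fun _ _ => Iff.rfl, stackAut γ 1,
    hγ.stackAut_one C, fun g x => ?_⟩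
  rw [stackAut_inv, inv_one]
  change stackIso φ (StarAlgEquiv.refl ℂ _) (stackAut (α.toHom g) (δ.toHom g) x) =
    (stackAut γ⁻¹ 1 * stackAut (β.toHom g) (δ.toHom g) * stackAut γ 1 :
      (B.stack C).Alg ≃⋆ₐ[ℂ] (B.stack C).Alg)
      (stackIso φ (StarAlgEquiv.refl ℂ _) x)
  rw [← stackAut_mul, ← stackAut_mul, one_mul, mul_one]
  refine DFunLike.congr_fun (stack_hom_ext
    (φ := (stackMap (isoHom φ) (isoHom (StarAlgEquiv.refl ℂ _))).comp
      (autHom (stackAut (α.toHom g) (δ.toHom g))))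
    (ψ := (autHom (stackAut (γ⁻¹ * β.toHom g * γ) (δ.toHom g))).comp
      (stackMap (isoHom φ) (isoHom (StarAlgEquiv.refl ℂ _)))) (fun a => ?_) fun c => ?_) x
  · rw [StarAlgHom.comp_apply, StarAlgHom.comp_apply, autHom_apply, autHom_apply, stackAut_inl,
      stackMap_inl, stackMap_inl, stackAut_inl, isoHom_apply, isoHom_apply, h]
  · rw [StarAlgHom.comp_apply, StarAlgHom.comp_apply, autHom_apply, autHom_apply, stackAut_inr,
      stackMap_inr, stackMap_inr, stackAut_inr]
    rfl

theorem Equivalent.stack_comm (α : Symmetry G A) (β : Symmetry G B) :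
    (α.stack β).Equivalent (β.stack α) := by
  refine .of_iso (commIso A B) (isSitewise_commIso A B) fun g x => DFunLike.congr_fun
    (stack_hom_ext
      (φ := (commHom A B).comp (autHom (stackAut (α.toHom g) (β.toHom g))))
      (ψ := (autHom (stackAut (β.toHom g) (α.toHom g))).comp (commHom A B))
      (fun a => ?_) fun b => ?_) x
  · rw [StarAlgHom.comp_apply, StarAlgHom.comp_apply, autHom_apply, autHom_apply, stackAut_inl,
      commHom_inl, commHom_inl, stackAut_inr]
  · rw [StarAlgHom.comp_apply, StarAlgHom.comp_apply, autHom_apply, autHom_apply, stackAut_inr,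
      commHom_inr, commHom_inr, stackAut_inl]

theorem Equivalent.stack_assoc (α : Symmetry G A) (β : Symmetry G B) (δ : Symmetry G C) :
    ((α.stack β).stack δ).Equivalent (α.stack (β.stack δ)) := by
  refine .of_iso (assocIso A B C) (isSitewise_assocIso A B C) fun g x => DFunLike.congr_fun
    (stack_hom_ext_left
      (φ := (assocHom A B C).comp
        (autHom (stackAut (stackAut (α.toHom g) (β.toHom g)) (δ.toHom g))))
      (ψ := (autHom (stackAut (α.toHom g) (stackAut (β.toHom g) (δ.toHom g)))).comp
        (assocHom A B C)) (fun a => ?_) (fun b => ?_) fun c => ?_) x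
  · simp only [StarAlgHom.comp_apply, autHom_apply, stackAut_inl, assocHom_inl_inl]
  · simp only [StarAlgHom.comp_apply, autHom_apply, stackAut_inl, stackAut_inr, assocHom_inl_inr]
  · simp only [StarAlgHom.comp_apply, autHom_apply, stackAut_inr, assocHom_inr]

theorem Equivalent.stack_left (α : Symmetry G A) (h : β.Equivalent δ) :
    (α.stack β).Equivalent (α.stack δ) :=
  ((stack_comm α β).trans (h.stack_right α)).trans (stack_comm δ α)

theorem Equivalent.stack_right_comm (α : Symmetry G A) (β : Symmetry G B) (δ : Symmetry G C) :
    ((α.stack β).stack δ).Equivalent ((α.stack δ).stack β) :=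
  ((stack_assoc α β δ).trans (stack_left α (stack_comm β δ))).trans (stack_assoc α δ β).symm

theorem IsRangeLE.stack {R : ℕ} (hα : α.IsRangeLE R) (hβ : β.IsRangeLE R) :
    (α.stack β).IsRangeLE R := by
  intro g X c hc
  refine mem_of_forall_stack (autHom (stackAut (α.toHom g) (β.toHom g))) _
    ((A.stack B).isClosed_sub _) (fun a ha => ?_) (fun b hb => ?_) hc
  · rw [autHom_apply, stackAut_inl]
    exact A.inl_mem B (hα g X a ha)
  · rw [autHom_apply, stackAut_inr]
    exact A.inr_mem B (hβ g X b hb)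

theorem StablyEquivalent.symm (h : α.StablyEquivalent β) : β.StablyEquivalent α := by
  obtain ⟨P, Q, κ, ν, hκ, hν, h⟩ := h
  exact ⟨Q, P, ν, κ, hν, hκ, h.symm⟩

/-- The ancillas are combined: from α⊗κ ∼₀ β⊗ν and β⊗κ' ∼₀ δ⊗ν' one gets α⊗(κ⊗κ') ∼₀ (β⊗ν)⊗κ' ∼₀
(β⊗κ')⊗ν ∼₀ δ⊗(ν'⊗ν). -/
theorem StablyEquivalent.trans (h : α.StablyEquivalent β) (h' : β.StablyEquivalent δ) :
    α.StablyEquivalent δ := by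
  obtain ⟨P, Q, κ, ν, hκ, hν, h⟩ := h
  obtain ⟨P', Q', κ', ν', hκ', hν', h'⟩ := h'
  refine ⟨P.stack P', Q'.stack Q, κ.stack κ', ν'.stack ν, hκ.stack hκ', hν'.stack hν, ?_⟩
  exact (Equivalent.stack_assoc α κ κ').symm.trans <| (h.stack_right κ').trans <|
    (Equivalent.stack_right_comm β ν κ').trans <| (h'.stack_right ν).trans <|
    Equivalent.stack_assoc δ ν' ν

theorem StablyEquivalent.stack_right (h : α.StablyEquivalent β) (δ : Symmetry G C) :
    (α.stack δ).StablyEquivalent (β.stack δ) := by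
  obtain ⟨P, Q, κ, ν, hκ, hν, h⟩ := h
  exact ⟨P, Q, κ, ν, hκ, hν, (Equivalent.stack_right_comm α δ κ).trans <|
    (h.stack_right δ).trans (Equivalent.stack_right_comm β ν δ)⟩

end Symmetry

/-- The spin chain with one-dimensional on-site Hilbert spaces. -/
def trivialChain : SpinChain where
  site _ := Unit
  fin _ := inferInstance
  nonempty _ := inferInstance
  bounded := ⟨1, fun _ => by simp⟩

namespace Symmetry

variable {G : Type} [Group G] {α : Symmetry G A} {β : Symmetry G B}

/-- The trivial symmetry on the trivial spin chain. -/
def trivial (G : Type) [Group G] : Symmetry G trivialChain where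
  toHom := 1
  isQCA _ := ⟨0, fun X _ ha => trivialChain.sub_mono (fatten_zero X).ge ha⟩

theorem isRangeLE_trivial : (trivial G).IsRangeLE 0 :=
  fun _ X _ ha => trivialChain.sub_mono (fatten_zero X).ge ha

theorem Equivalent.stablyEquivalent (h : α.Equivalent β) : α.StablyEquivalent β :=
  ⟨_, _, trivial G, trivial G, isRangeLE_trivial, isRangeLE_trivial, h.stack_right _⟩

theorem StablyEquivalent.stack_trivial (α : Symmetry G A) :
    (α.stack (trivial G)).StablyEquivalent α :=
  -- With two trivial copies as the ancilla on the right, associativity alone is the required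
  -- equivalence.
  ⟨_, _, trivial G, (trivial G).stack (trivial G), isRangeLE_trivial,
    isRangeLE_trivial.stack isRangeLE_trivial, Equivalent.stack_assoc _ _ _⟩

end Symmetry

end SpinChain

namespace SymG

variable {G : Type} [Group G]

open SpinChain.Symmetry in
theorem equivalence_stablyEquivalent : Equivalence (StablyEquivalent (G := G)) where
  refl α := (Equivalent.refl α.sym).stablyEquivalent
  symm h := SpinChain.Symmetry.StablyEquivalent.symm h
  trans h h' := SpinChain.Symmetry.StablyEquivalent.trans h h'

/-- The setoid of stable equivalence. -/
abbrev stableSetoid (G : Type) [Group G] : Setoid (SymG G) :=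
  ⟨StablyEquivalent, equivalence_stablyEquivalent⟩

open SpinChain.Symmetry in
theorem StablyEquivalent.stack {α α' β β' : SymG G} (h : StablyEquivalent α α')
    (h' : StablyEquivalent β β') : StablyEquivalent (α.stack β) (α'.stack β') := by
  have h1 : StablyEquivalent (α.stack β) (α'.stack β) :=
    SpinChain.Symmetry.StablyEquivalent.stack_right h β.sym
  have h2 : StablyEquivalent (β.stack α') (β'.stack α') :=
    SpinChain.Symmetry.StablyEquivalent.stack_right h' α'.sym
  have h3 : StablyEquivalent (α'.stack β) (β.stack α') :=
    (Equivalent.stack_comm α'.sym β.sym).stablyEquivalent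
  have h4 : StablyEquivalent (β'.stack α') (α'.stack β') :=
    (Equivalent.stack_comm β'.sym α'.sym).stablyEquivalent
  have e := equivalence_stablyEquivalent (G := G)
  exact e.trans h1 (e.trans h3 (e.trans h2 h4))

open SpinChain.Symmetry in
/-- The commutative monoid of stable equivalence classes of symmetries under stacking. -/
abbrev stableCommMonoid (G : Type) [Group G] : CommMonoid (Quotient (stableSetoid G)) where
  mul := Quotient.map₂ SymG.stack fun _ _ h _ _ h' => StablyEquivalent.stack h h'
  one := Quotient.mk _ ⟨_, trivial G⟩
  mul_assoc := by
    rintro ⟨α⟩ ⟨β⟩ ⟨γ⟩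
    exact Quotient.sound (Equivalent.stack_assoc α.sym β.sym γ.sym).stablyEquivalent
  mul_comm := by
    rintro ⟨α⟩ ⟨β⟩
    exact Quotient.sound (Equivalent.stack_comm α.sym β.sym).stablyEquivalent
  mul_one := by
    rintro ⟨α⟩
    exact Quotient.sound (SpinChain.Symmetry.StablyEquivalent.stack_trivial α.sym)
  one_mul := by
    rintro ⟨α⟩
    have h1 : StablyEquivalent (stack ⟨_, trivial G⟩ α) (stack α ⟨_, trivial G⟩) :=
      (Equivalent.stack_comm (trivial G) α.sym).stablyEquivalent
    have h2 : StablyEquivalent (stack α ⟨_, trivial G⟩) α :=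
      SpinChain.Symmetry.StablyEquivalent.stack_trivial α.sym
    exact Quotient.sound (equivalence_stablyEquivalent.trans h1 h2)

end SymG

end

theorem mainTheorem4 (G : Type) [Group G] [Finite G] :
    ∃ Λ : SymG G → TwistedCircle.H2 G,
      (∀ (A : SpinChain) (α : SpinChain.Symmetry G A) (j : ℤ),
        (∃ L ρ, SpinChain.IsRightRestriction α j L ρ) ∧
        ∀ L ρ, SpinChain.IsRightRestriction α j L ρ →
          (∃ C, SpinChain.IsCrossing α ρ C) ∧
          ∀ C, SpinChain.IsCrossing α ρ C →
            (∃! c, SpinChain.IsPhases α C c) ∧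
            ∀ c, SpinChain.IsPhases α C c →
              (∀ g k l m, 1 = (c (k, l * m) g * c (l, m) (k⁻¹ * g * k)) /
                (c (k, l) g * c (k * l, m) g)) ∧
              ∃ hc : groupCohomology.IsMulCocycle₂ c, Λ ⟨A, α⟩ = TwistedCircle.mk c hc) ∧
      (∀ (A : SpinChain) (α : SpinChain.Symmetry G A), α.IsDecoupled → Λ ⟨A, α⟩ = 0) ∧
      (∀ (A : SpinChain) (α β : SpinChain.Symmetry G A) (R : ℕ) (i : ℤ),
        α.IsRangeLE R → β.IsRangeLE R →
        (∀ g, ∀ a ∈ A.sub (Set.Icc i (i + 12 * R)), α.toHom g a = β.toHom g a) →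
        Λ ⟨A, α⟩ = Λ ⟨A, β⟩) ∧
      (∀ α β : SymG G, Λ (α.stack β) = Λ α + Λ β) ∧
      (∀ α β : SymG G, α.StablyEquivalent β → Λ α = Λ β) ∧
      ∃ (h : Equivalence (SymG.StablyEquivalent (G := G)))
        (_ : CommMonoid (Quotient ⟨SymG.StablyEquivalent (G := G), h⟩))
        (Λ' : Quotient ⟨SymG.StablyEquivalent (G := G), h⟩ →* Multiplicative (TwistedCircle.H2 G)),
        (∀ α β : SymG G, (Quotient.mk _ α * Quotient.mk _ β : Quotient ⟨_, h⟩) =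
          Quotient.mk _ (α.stack β)) ∧
        ∀ α : SymG G, Λ' (Quotient.mk _ α) = Multiplicative.ofAdd (Λ α) := by
  let _ := SymG.stableCommMonoid G
  refine ⟨fun α => SpinChain.anomaly α.sym, fun A α j => ⟨α.exists_isRightRestriction j,
    fun L ρ hρ => ⟨?_, fun C hC => ⟨hC.existsUnique_phases, fun c hc => ⟨fun g k l m => ?_, ?_⟩⟩⟩⟩,
    fun A α => SpinChain.anomaly_eq_zero_of_isDecoupled,
    fun A α β R i hα hβ => SpinChain.anomaly_eq_of_eqOn_Icc hα hβ,
    fun α β => SpinChain.anomaly_stack α.sym β.sym,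
    fun α β h => SpinChain.Symmetry.StablyEquivalent.anomaly_eq h,
    SymG.equivalence_stablyEquivalent, SymG.stableCommMonoid G,
    { toFun := Quotient.lift (fun α => Multiplicative.ofAdd (SpinChain.anomaly α.sym))
        fun α β h => congrArg _ (SpinChain.Symmetry.StablyEquivalent.anomaly_eq h)
      -- The unit is the trivial symmetry, which has range 0 and so is decoupled.
      map_one' := congrArg Multiplicative.ofAdd (SpinChain.anomaly_eq_zero_of_isDecoupled
        SpinChain.Symmetry.isRangeLE_trivial.isDecoupled)
      map_mul' := by
        rintro ⟨α⟩ ⟨β⟩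
        exact congrArg Multiplicative.ofAdd (SpinChain.anomaly_stack α.sym β.sym) },
    fun α β => rfl, fun α => rfl⟩
  · obtain ⟨R, hR⟩ := α.exists_isRangeLE
    obtain ⟨C, hC, -⟩ := hρ.exists_crossing hR
    exact ⟨C, hC⟩
  · rw [eq_comm, div_eq_one, mul_comm, ← hc.cocycle, mul_comm]
  · exact ⟨hc.isMulCocycle₂, SpinChain.IsAnomalyData.anomaly_eq ⟨j, L, ρ, C, hρ, hC, hc⟩⟩
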